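/- Let $1<\alpha\le 2$, $a<b$, $c<d$, $T>0$, $\Omega=[a,b]\times[c,d]$. For a function $f$ on the line let $$L^{\alpha}f(x)=-\frac{1}{2\cos(\alpha\pi/2)\,\Gamma(2-\alpha)}\,\frac{d^2}{dx^2}\left(\int_{-\infty}^{x}\frac{f(\xi)\,d\xi}{(x-\xi)^{\alpha-1}}+\int_{x}^{\infty}\frac{f(\xi)\,d\xi}{(\xi-x)^{\alpha-1}}\right)\quad(1<\alpha<2),\qquad L^{2}f=f'',$$ and let $L_\alpha=L^\alpha_x+L^\alpha_y$ be the sum of these operators in the two variables. Let $u(x,y,t)$ be a complex-valued function that solves $$\mathbf i u_t+L_\alpha u+|u|^2u=0\ \text{ in the interior of }\Omega,\ 0<t<T,\qquad u(x,y,0)=u_0(x,y),$$ and vanishes on $\partial\Omega$ and outside $\Omega$ for $0\le t\le T$. Suppose that $u$ is smooth enough, i.e. of class $C^K$ for a certain absolute integer $K$, on $\Omega\times[0,T]$ and, if $\alpha<2$ (when $L_\alpha$ is nonlocal), also on $\mathbb R^2\times[0,T]$. For positive integers $N,M_x,M_y$ put $\tau=T/N$, $h_x=(b-a)/M_x$,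 $h_y=(d-c)/M_y$, $x_j=a+jh_x$, $y_k=c+kh_y$, $t_n=n\tau$, and, for grid functions, $$(\mathcal L^\alpha_xV)_{j,k}=-\frac1{h_x^{\alpha}}\sum_{s=1}^{M_x-1}c^\alpha_{j-s}V_{s,k},\quad (\mathcal L^\alpha_yV)_{j,k}=-\frac1{h_y^{\alpha}}\sum_{s=1}^{M_y-1}c^\alpha_{k-s}V_{j,s},\quad c^\alpha_s=\frac{(-1)^s\Gamma(\alpha+1)}{\Gamma(\frac\alpha2-s+1)\Gamma(\frac\alpha2+s+1)},$$ where $1/\Gamma$ is taken to be $0$ at the poles of $\Gamma$. Let $U^n_{j,k}$ ($0\le n\le N$, $0\le j\le M_x$, $0\le k\le M_y$) be zero for $j\in\{0,M_x\}$ or $k\in\{0,M_y\}$ and satisfy, for $1\le j\le M_x-1$, $1\le k\le M_y-1$, $$U^0_{j,k}=u_0(x_j,y_k),\qquad U^1_{j,k}=U^0_{j,k}+\tau\left(\mathbf i(\mathcal L^\alpha_xu_0)_{j,k}+\mathbf i(\mathcal L^\alpha_yu_0)_{j,k}+\mathbf i|u_0(x_j,y_k)|^2u_0(x_j,y_k)\right),$$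 $$\left(\tfrac1\tau-\mathbf i|U^n_{j,k}|^2-\mathbf i\mathcal L^\alpha_x-\mathbf i\mathcal L^\alpha_y\right)U^{n+1}_{j,k}=\left(\tfrac1\tau+\mathbf i|U^n_{j,k}|^2+\mathbf i\mathcal L^\alpha_x+\mathbf i\mathcal L^\alpha_y\right)U^{n-1}_{j,k},\quad 1\le n\le N-1 .$$ Let $\|V\|_\infty=\max_{1\le j\le M_x-1,\,1\le k\le M_y-1}|V_{j,k}|$ (which is $0$ if there are no such indices). Then $C_m=\max_{(x,y)\in\Omega,\,0\le t\le T}|u(x,y,t)|$ exists, and there are positive constants $\tau_0,h_0,C_0$, independent of $N,M_x,M_y$, such that, whenever $\tau<\tau_0$, $h_x<h_0$ and $h_y<h_0$, for all $1\le n\le N$, $$\|U^n\|_\infty\le C_*:=C_m+1 ,$$ where $\tau_0$ and $h_0$ are constants for which, under the same restrictions on $\tau,h_x,h_y$, the error estimate $\|u^n-U^n\|_\infty\le C_0(\tau^2+h_x^2+h_y^2)$, $1\le n\le N$, holds, with $u^n_{j,k}=u(x_j,y_k,t_n)$. -/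

import Mathlib

namespace FracNLS

noncomputable section

/-! ### The Riesz fractional derivative on the line -/

/-- Left Riemann-Liouville derivative of order `α` in `(1, 2]` on the line,
`(1 / Γ (2 - α)) (d/dx)^2 ∫_{-∞}^x f ξ / (x - ξ)^(α - 1) dξ` for `α < 2`.
For `α = 2` the fractional integral of order `2 - α = 0` is the identity. -/
def leftRL (α : ℝ) (f : ℝ → ℂ) (x : ℝ) : ℂ :=
  if α = 2 then iteratedDeriv 2 f x
  else ((1 / Real.Gamma (2 - α) : ℝ) : ℂ) *
    iteratedDeriv 2 (fun z : ℝ => ∫ ξ in Set.Iio z, f ξ / (((z - ξ) ^ (α - 1) : ℝ) : ℂ)) x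

/-- Right Riemann-Liouville derivative of order `α` in `(1, 2]` on the line. -/
def rightRL (α : ℝ) (f : ℝ → ℂ) (x : ℝ) : ℂ :=
  if α = 2 then iteratedDeriv 2 f x
  else ((1 / Real.Gamma (2 - α) : ℝ) : ℂ) *
    iteratedDeriv 2 (fun z : ℝ => ∫ ξ in Set.Ioi z, f ξ / (((ξ - z) ^ (α - 1) : ℝ) : ℂ)) x

/-- Riesz derivative of order `α` in one variable. -/
def riesz (α : ℝ) (f : ℝ → ℂ) (x : ℝ) : ℂ :=
  ((-(1 / (2 * Real.cos (α * Real.pi / 2))) : ℝ) : ℂ) * (leftRL α f x + rightRL α f x)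

/-- The two-dimensional operator: Riesz derivative in `x` plus Riesz derivative in `y`. -/
def riesz2 (α : ℝ) (v : ℝ → ℝ → ℂ) (x y : ℝ) : ℂ :=
  riesz α (fun ξ => v ξ y) x + riesz α (fun η => v x η) y

/-! ### The exact solution -/

/-- `u` solves `i u_t + L_α u + |u|^2 u = 0` in `(a, b) × (c, d)` for `0 < t < T`, with initial
value `u₀` and with zero values on the boundary of the box and outside of it (`L_α` acts on the
function on the whole plane). -/
structure IsSolution (α a b c d T : ℝ) (u₀ : ℝ → ℝ → ℂ) (u : ℝ → ℝ → ℝ → ℂ) : Prop where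
  equation : ∀ x ∈ Set.Ioo a b, ∀ y ∈ Set.Ioo c d, ∀ t ∈ Set.Ioo 0 T,
    Complex.I * deriv (fun s => u x y s) t + riesz2 α (fun ξ η => u ξ η t) x y
      + ((‖u x y t‖ ^ 2 : ℝ) : ℂ) * u x y t = 0
  initial : ∀ x y, u x y 0 = u₀ x y
  zero_outside : ∀ x y, ¬ (x ∈ Set.Ioo a b ∧ y ∈ Set.Ioo c d) → ∀ t ∈ Set.Icc 0 T, u x y t = 0

/-- Smoothness of order `K`, up to the boundary in space and time. For `α < 2` the operator is
nonlocal and sees `u` on the whole plane, so it is `u` on the plane that has to be smooth; for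
`α = 2` the operator is the Laplacian and only the closed box matters. -/
structure IsSmoothOfOrder (K : ℕ) (α a b c d T : ℝ) (u : ℝ → ℝ → ℝ → ℂ) : Prop where
  on_box : ContDiffOn ℝ (K : WithTop ℕ∞) (fun p : ℝ × ℝ × ℝ => u p.1 p.2.1 p.2.2)
    (Set.Icc a b ×ˢ Set.Icc c d ×ˢ Set.Icc 0 T)
  on_plane : α < 2 → ContDiffOn ℝ (K : WithTop ℕ∞) (fun p : ℝ × ℝ × ℝ => u p.1 p.2.1 p.2.2)
    (Set.univ ×ˢ Set.univ ×ˢ Set.Icc 0 T)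

/-! ### The difference scheme -/

/-- Coefficients of the fractional centred difference. -/
def coeff (α : ℝ) (s : ℤ) : ℝ :=
  (-1) ^ s * Real.Gamma (α + 1) / (Real.Gamma (α / 2 - s + 1) * Real.Gamma (α / 2 + s + 1))

/-- Fractional centred difference in `x` for grid functions that vanish off the interior grid. -/
def diffX (α h : ℝ) (M : ℕ) (V : ℕ → ℕ → ℂ) (j k : ℕ) : ℂ :=
  -(((1 / h ^ α : ℝ) : ℂ) * ∑ s ∈ Finset.Ioo 0 M, ((coeff α ((j : ℤ) - (s : ℤ)) : ℝ) : ℂ) * V s k)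

/-- Fractional centred difference in `y` for grid functions that vanish off the interior grid. -/
def diffY (α h : ℝ) (M : ℕ) (V : ℕ → ℕ → ℂ) (j k : ℕ) : ℂ :=
  -(((1 / h ^ α : ℝ) : ℂ) * ∑ s ∈ Finset.Ioo 0 M, ((coeff α ((k : ℤ) - (s : ℤ)) : ℝ) : ℂ) * V j s)

/-- The discrete operator, the sum of the differences in `x` and in `y`. -/
def diff2 (α hx hy : ℝ) (Mx My : ℕ) (V : ℕ → ℕ → ℂ) (j k : ℕ) : ℂ :=
  diffX α hx Mx V j k + diffY α hy My V j k

/-- Maximum norm over the interior grid points (zero if there are none). -/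
def supNorm (Mx My : ℕ) (V : ℕ → ℕ → ℂ) : ℝ :=
  (((Finset.Ioo 0 Mx ×ˢ Finset.Ioo 0 My).sup (fun p => ‖V p.1 p.2‖₊) : NNReal) : ℝ)

/-- Restriction of a function on the plane to the grid `x_j = a + j hx`, `y_k = c + k hy`. -/
def onGrid (a c hx hy : ℝ) (v : ℝ → ℝ → ℂ) (j k : ℕ) : ℂ :=
  v (a + j * hx) (c + k * hy)

/-- `U n j k`, for `n ≤ N`, `j ≤ Mx`, `k ≤ My`, solves the three-level linearized implicit scheme
with time step `τ`, mesh sizes `hx`, `hy`, started from `u₀`. -/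
structure IsSchemeSolution (α a c τ hx hy : ℝ) (N Mx My : ℕ) (u₀ : ℝ → ℝ → ℂ)
    (U : ℕ → ℕ → ℕ → ℂ) : Prop where
  boundary_x : ∀ n ≤ N, ∀ k ≤ My, U n 0 k = 0 ∧ U n Mx k = 0
  boundary_y : ∀ n ≤ N, ∀ j ≤ Mx, U n j 0 = 0 ∧ U n j My = 0
  initial : ∀ j ∈ Finset.Ioo 0 Mx, ∀ k ∈ Finset.Ioo 0 My, U 0 j k = onGrid a c hx hy u₀ j k
  first : ∀ j ∈ Finset.Ioo 0 Mx, ∀ k ∈ Finset.Ioo 0 My,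
    U 1 j k = U 0 j k + (τ : ℂ) *
      (Complex.I * diff2 α hx hy Mx My (onGrid a c hx hy u₀) j k
        + Complex.I * ((‖onGrid a c hx hy u₀ j k‖ ^ 2 : ℝ) : ℂ) * onGrid a c hx hy u₀ j k)
  step : ∀ n, 1 ≤ n → n + 1 ≤ N → ∀ j ∈ Finset.Ioo 0 Mx, ∀ k ∈ Finset.Ioo 0 My,
    1 / (τ : ℂ) * U (n + 1) j k
        - Complex.I * ((‖U n j k‖ ^ 2 : ℝ) : ℂ) * U (n + 1) j k
        - Complex.I * diff2 α hx hy Mx My (U (n + 1)) j k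
      = 1 / (τ : ℂ) * U (n - 1) j k
        + Complex.I * ((‖U n j k‖ ^ 2 : ℝ) : ℂ) * U (n - 1) j k
        + Complex.I * diff2 α hx hy Mx My (U (n - 1)) j k

end

end FracNLS

/-!
# Convergence of a linearly implicit scheme for the fractional nonlinear Schrödinger equation

The maximum `C_m` exists by compactness, and the bound `C_m + 1` follows from the error estimate
as soon as the right-hand side of the estimate is at most one. So everything is in the error
estimate, whose difficulty is the maximum norm in two dimensions: an energy argument yields only
Euclidean norms, and there must be no relation between `τ`, `hx` and `hy`.

*Discrete Sobolev inequality.* The coefficients `c_s` are the Fourier coefficients of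
`|2 sin (π x)| ^ α` (`coeff_eq_integral`, `hasSum_symbol`). Hence the negative of the
one-dimensional difference operator is a positive semidefinite matrix `A`, and, as `α > 1` makes
`1 / (1 + symbol)` integrable over the frequencies, `1 + A` dominates the rank one matrix of a
point evaluation times `1 / (K h)`. In the plane
`(1 + A ⊗ 1 + 1 ⊗ B) ^ 2 ≥ (1 + A) ⊗ (1 + B)`, which gives `discrete_sobolev`: the maximum norm is
bounded by `√(hx hy)` times the sum of the Euclidean norms of `V` and `L V`, where `L` is the
discrete operator. It remains to bound the error in the graph norm of `L`.

*Stability.* A step of the scheme is a Cayley transform of the symmetric operator `L`, so it does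
not increase the norm except through the source `F` (`norm_step_le`). Moreover `L e + F` is
propagated without a source, up to the differences of `F` between time levels (`norm_map_add_le`).
With Gronwall's inequality this bounds the graph norm of the error, provided that `F` and its
differences over two time steps are Lipschitz functions of the error (`scheme_stability`). Here `F`
consists of the residual of the exact solution and of the error of the cubic term; for the latter
the Lipschitz bounds hold as long as the error is at most one.

*Consistency.* For `α < 2` the Riesz derivative of a smooth function with compact support is the
Fourier multiplier `-|2 π ξ| ^ α` (`LineChain.riesz_eq`), the difference operator is the multiplier
`-|2 sin (π h ξ)| ^ α / h ^ α` (`LineChain.diff1_eq`), and the expansion of the quotient of the two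
symbols gives the truncation error up to third order. For `α = 2`, where the solution need not be
smooth across the boundary, Taylor's formula on the closed interval does the same. The structures
`Chain` and `Family` and the function `jet` treat both cases together. Thus the residual is of
order `ε = τ ^ 2 + hx ^ 2 + hy ^ 2`, and its differences over two time steps are of order `τ ε`,
because the differences of the solution are again a family of smooth functions, with a bound of
order `τ` (`exists_norm_schemeResidual_le`).

*The first step.* The error after the explicit first step must be small in the graph norm as well,
so `L` is applied to the truncation error of the initial value. That error does not vanish towards
the boundary for a general function, and then its differences would be large. But the equation
expresses the Riesz derivative in `x` near the sides `x = a, b` by functions that are linear in the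
distance to the boundary up to a cubic error, so that the second derivative of the Riesz derivative,
the leading coefficient of the truncation error, is zero there (`jet_two_boundary`,
`exists_norm_diff1_truncation_le`).

The theorem follows by induction over the time levels (`exists_error_bound`): errors at most one up
to the level `n` give an error of order `ε` at the level `n + 1`, with a constant that does not
depend on `n`, hence again an error at most one.
-/

open Real MeasureTheory Set Filter Topology

namespace FracNLS

/-! ### The coefficients and their symbol -/

/-- The symbol `|2 sin (π x)| ^ α` of the fractional centred difference, in the frequency
variable `x` of period one. -/
noncomputable def symbol (α x : ℝ) : ℝ := |2 * Real.sin (π * x)| ^ α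

lemma symbol_nonneg (α x : ℝ) : 0 ≤ symbol α x := Real.rpow_nonneg (abs_nonneg _) _

lemma continuous_symbol {α : ℝ} (hα : 0 < α) : Continuous (symbol α) := by
  unfold symbol
  exact Continuous.rpow_const (by fun_prop) fun _ => Or.inr hα.le

lemma symbol_eq_of_mem {α x : ℝ} (hx : x ∈ Icc (0 : ℝ) 1) :
    symbol α x = (2 * Real.sin (π * x)) ^ α := by
  have : 0 ≤ Real.sin (π * x) :=
    Real.sin_nonneg_of_nonneg_of_le_pi (mul_nonneg pi_pos.le hx.1)
      (by nlinarith [pi_pos, hx.2])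
  rw [symbol, abs_of_nonneg (by positivity)]

lemma symbol_one_sub (α x : ℝ) : symbol α (1 - x) = symbol α x := by
  simp [symbol, mul_sub, Real.sin_pi_sub]

lemma symbol_periodic (α : ℝ) : Function.Periodic (symbol α) 1 := by
  intro x
  simp [symbol, mul_add, Real.sin_add_pi]

lemma coeff_neg (α : ℝ) (s : ℤ) : coeff α (-s) = coeff α s := by
  unfold coeff
  rw [zpow_neg, ← inv_zpow]
  push_cast
  rw [mul_comm (Real.Gamma (α / 2 - -(s : ℝ) + 1))]
  simp [sub_eq_add_neg]

/-- The recurrence satisfied by the coefficients. It also holds where the arguments of `Γ` meet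
the poles, since there the quotients in `coeff` vanish. -/
lemma coeff_succ {α : ℝ} (hα : 0 < α) (s : ℕ) :
    ((s : ℝ) + 1 + α / 2) * coeff α (s + 1) = (s - α / 2) * coeff α s := by
  unfold coeff
  push_cast
  rw [zpow_add_one₀ (by norm_num)]
  have h1 : Real.Gamma (α / 2 + (s + 1) + 1) = (s + 1 + α / 2) * Real.Gamma (α / 2 + s + 1) := by
    rw [show α / 2 + ((s : ℝ) + 1) + 1 = (s + 1 + α / 2) + 1 by ring,
      Real.Gamma_add_one (by positivity)]
    congr 2; ring
  have hp : (s : ℝ) + 1 + α / 2 ≠ 0 := by positivity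
  have hG : Real.Gamma (α / 2 + s + 1) ≠ 0 := (Real.Gamma_pos_of_pos (by positivity)).ne'
  have e : α / 2 - ((s : ℝ) + 1) + 1 = α / 2 - s := by ring
  rw [h1, e]
  by_cases h0 : α / 2 - (s : ℝ) = 0
  · simp [h0, show (s : ℝ) - α / 2 = 0 by linarith]
  · rw [Real.Gamma_add_one h0]
    have h0' : (s : ℝ) - α / 2 ≠ 0 := fun h => h0 (by linarith)
    by_cases hz : Real.Gamma (α / 2 - s) = 0
    · simp [hz]
    · rw [show (s : ℝ) - α / 2 = -(α / 2 - s) by ring]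
      generalize α / 2 - (s : ℝ) = d at *
      field_simp

lemma coeff_zero (α : ℝ) : coeff α 0 = Real.Gamma (α + 1) / Real.Gamma (α / 2 + 1) ^ 2 := by
  simp [coeff, sq]

/-- A Beta integral in trigonometric form. -/
lemma integral_sin_rpow {α : ℝ} (hα : 1 < α) :
    ∫ θ in (0 : ℝ)..π, (Real.sin θ / 2) ^ α
      = Real.Gamma ((α + 1) / 2) ^ 2 / Real.Gamma (α + 1) := by
  set p : ℝ := (α - 1) / 2 with hp
  have hp0 : 0 < p := by rw [hp]; linarith
  have hbeta : ∫ x in (0 : ℝ)..1, (x ^ p * (1 - x) ^ p)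
      = Real.Gamma ((α + 1) / 2) ^ 2 / Real.Gamma (α + 1) := by
    have hpos : 0 < ((((α + 1) / 2 : ℝ) : ℂ)).re := by
      rw [Complex.ofReal_re]; linarith
    have h := Complex.Gamma_mul_Gamma_eq_betaIntegral hpos hpos
    have hI : Complex.betaIntegral (((α + 1) / 2 : ℝ) : ℂ) (((α + 1) / 2 : ℝ) : ℂ)
        = ((∫ x in (0 : ℝ)..1, (x ^ p * (1 - x) ^ p) : ℝ) : ℂ) := by
      rw [Complex.betaIntegral, ← intervalIntegral.integral_ofReal]
      refine intervalIntegral.integral_congr fun x hx => ?_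
      rw [uIcc_of_le zero_le_one] at hx
      have e : (((α + 1) / 2 : ℝ) : ℂ) - 1 = ((p : ℝ) : ℂ) := by
        rw [hp]; push_cast; ring
      simp only [e]
      push_cast
      rw [Complex.ofReal_cpow hx.1, Complex.ofReal_cpow (by linarith [hx.2])]
      push_cast
      rfl
    rw [hI, Complex.Gamma_ofReal, ← Complex.ofReal_add, Complex.Gamma_ofReal] at h
    have h' : Real.Gamma ((α + 1) / 2) * Real.Gamma ((α + 1) / 2)
        = Real.Gamma ((α + 1) / 2 + (α + 1) / 2)
          * ∫ x in (0 : ℝ)..1, (x ^ p * (1 - x) ^ p) := by exact_mod_cast h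
    rw [add_halves] at h'
    rw [eq_div_iff (Real.Gamma_pos_of_pos (by linarith)).ne', sq, h']
    ring
  rw [← hbeta]
  have hsub := intervalIntegral.integral_comp_mul_deriv (a := 0) (b := π)
    (f := fun θ : ℝ => (1 - Real.cos θ) / 2) (f' := fun θ => Real.sin θ / 2)
    (g := fun x : ℝ => x ^ p * (1 - x) ^ p)
    (fun θ _ => by
      have := ((hasDerivAt_const θ (1 : ℝ)).sub (Real.hasDerivAt_cos θ)).div_const 2
      simpa using this) (by fun_prop)
    ((Real.continuous_rpow_const hp0.le).mul
      (Continuous.rpow_const (by fun_prop) fun _ => Or.inr hp0.le))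
  simp only [Real.cos_zero, sub_self, zero_div, Real.cos_pi, sub_neg_eq_add] at hsub
  norm_num at hsub
  rw [← hsub]
  refine intervalIntegral.integral_congr fun θ hθ => ?_
  rw [uIcc_of_le pi_pos.le] at hθ
  have hs : 0 ≤ Real.sin θ := Real.sin_nonneg_of_mem_Icc hθ
  have h1 : (0:ℝ) ≤ (1 - Real.cos θ) / 2 := by linarith [Real.cos_le_one θ]
  have h2 : (0:ℝ) ≤ 1 - (1 - Real.cos θ) / 2 := by linarith [Real.neg_one_le_cos θ]
  have e : (1 - Real.cos θ) / 2 * (1 - (1 - Real.cos θ) / 2) = (Real.sin θ / 2) ^ (2 : ℝ) := by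
    rw [Real.rpow_two, div_pow, Real.sin_sq]; ring
  rw [← Real.mul_rpow h1 h2, e, ← Real.rpow_mul (by positivity)]
  have e2 : (2 : ℝ) * p = α - 1 := by rw [hp]; ring
  rw [e2]
  have := Real.rpow_add_one' (x := Real.sin θ / 2) (y := α - 1) (by positivity) (by linarith)
  rw [← this, sub_add_cancel]

/-- The cosine coefficients of the symbol. -/
noncomputable def cosCoeff (α : ℝ) (m : ℕ) : ℝ :=
  ∫ x in (0 : ℝ)..1, (2 * Real.sin (π * x)) ^ α * Real.cos (2 * π * m * x)

lemma cosCoeff_zero {α : ℝ} (hα : 1 < α) : cosCoeff α 0 = coeff α 0 := by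
  have h1 : cosCoeff α 0 = ∫ x in (0 : ℝ)..1, (fun θ => 4 ^ α * (Real.sin θ / 2) ^ α) (π * x) := by
    unfold cosCoeff
    refine intervalIntegral.integral_congr fun x hx => ?_
    rw [uIcc_of_le zero_le_one] at hx
    have : 0 ≤ Real.sin (π * x) :=
      Real.sin_nonneg_of_nonneg_of_le_pi (mul_nonneg pi_pos.le hx.1)
        (by nlinarith [pi_pos, hx.2])
    simp only [Nat.cast_zero, mul_zero, zero_mul, Real.cos_zero, mul_one]
    rw [← Real.mul_rpow (by norm_num) (by positivity)]
    congr 1; ring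
  rw [h1, intervalIntegral.integral_comp_mul_left (fun θ => 4 ^ α * (Real.sin θ / 2) ^ α) pi_pos.ne',
    mul_zero, mul_one,
    intervalIntegral.integral_const_mul, integral_sin_rpow hα, coeff_zero, smul_eq_mul]
  have hd := Real.Gamma_mul_Gamma_add_half_of_pos (s := (α + 1) / 2) (by linarith)
  rw [show (α + 1) / 2 + 1 / 2 = α / 2 + 1 by ring, show 2 * ((α + 1) / 2) = α + 1 by ring,
    show 1 - (α + 1) = -α by ring, Real.rpow_neg (by norm_num)] at hd
  have hG1 : Real.Gamma (α / 2 + 1) ≠ 0 := (Real.Gamma_pos_of_pos (by linarith)).ne'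
  have hG2 : Real.Gamma (α + 1) ≠ 0 := (Real.Gamma_pos_of_pos (by linarith)).ne'
  have h4 : (4 : ℝ) ^ α = 2 ^ α * 2 ^ α := by
    rw [← Real.mul_rpow (by norm_num) (by norm_num)]; norm_num
  have h2 : (2 : ℝ) ^ α ≠ 0 := (Real.rpow_pos_of_pos (by norm_num) _).ne'
  have hd2 : Real.Gamma ((α + 1) / 2) * Real.Gamma (α / 2 + 1) * 2 ^ α
      = Real.Gamma (α + 1) * √π := by
    rw [hd]; field_simp
  have hsq : √π ^ 2 = π := Real.sq_sqrt pi_pos.le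
  rw [h4, inv_mul_eq_div, div_eq_div_iff pi_pos.ne' (by positivity)]
  field_simp
  calc _ = (Real.Gamma ((α + 1) / 2) * Real.Gamma (α / 2 + 1) * 2 ^ α) ^ 2 := by ring_nf
    _ = _ := by rw [hd2, mul_pow, hsq]

lemma cosCoeff_succ {α : ℝ} (hα : 1 < α) (m : ℕ) :
    ((m : ℝ) + 1 + α / 2) * cosCoeff α (m + 1) = (m - α / 2) * cosCoeff α m := by
  set w : ℝ → ℝ := fun x => (2 * Real.sin (π * x)) ^ α with hw
  have hwc : Continuous w := Continuous.rpow_const (by fun_prop) fun _ => Or.inr (by linarith)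
  -- integrate the derivative of `(2 sin πx)^(α+1) cos ((2m+1)πx)`, which vanishes at `0` and `1`
  set F : ℝ → ℝ := fun x => (2 * Real.sin (π * x)) ^ (α + 1) * Real.cos ((2 * m + 1) * π * x)
  set F' : ℝ → ℝ := fun x => 2 * π * (w x * ((m + 1 + α / 2) * Real.cos (2 * π * (m + 1) * x))
      - w x * ((m - α / 2) * Real.cos (2 * π * m * x)))
  have hF : ∀ x ∈ uIcc (0:ℝ) 1, HasDerivAt F (F' x) x := by
    intro x hx
    rw [uIcc_of_le zero_le_one] at hx
    have hs : 0 ≤ Real.sin (π * x) :=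
      Real.sin_nonneg_of_nonneg_of_le_pi (mul_nonneg pi_pos.le hx.1)
        (by nlinarith [pi_pos, hx.2])
    have h1 : HasDerivAt (fun x : ℝ => 2 * Real.sin (π * x)) (2 * (Real.cos (π * x) * π)) x := by
      have := ((hasDerivAt_id x).const_mul π).sin.const_mul 2
      simpa using this
    have h2 : HasDerivAt (fun x : ℝ => Real.cos ((2 * m + 1) * π * x))
        (-Real.sin ((2 * m + 1) * π * x) * ((2 * m + 1) * π)) x := by
      have := ((hasDerivAt_id x).const_mul ((2 * m + 1) * π)).cos
      simpa using this
    have h3 := (h1.rpow_const (p := α + 1) (Or.inr (by linarith))).mul h2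
    refine h3.congr_deriv ?_
    have e1 : (2 * Real.sin (π * x)) ^ (α + 1 - 1) = w x := by simp [hw]
    have e2 : (2 * Real.sin (π * x)) ^ (α + 1) = w x * (2 * Real.sin (π * x)) := by
      rw [Real.rpow_add_one' (by positivity) (by linarith)]
    have e3 : 2 * π * (m + 1) * x = (2 * m + 1) * π * x + π * x := by ring
    have e4 : 2 * π * m * x = (2 * m + 1) * π * x - π * x := by ring
    simp only [F', e1, e2, e3, e4, Real.cos_add, Real.cos_sub]
    ring
  have hint : IntervalIntegrable F' volume 0 1 := by
    apply Continuous.intervalIntegrable; fun_prop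
  have h := intervalIntegral.integral_eq_sub_of_hasDerivAt hF hint
  have hF1 : F 1 = 0 := by simp [F, Real.zero_rpow (by linarith : α + 1 ≠ 0)]
  have hF0 : F 0 = 0 := by simp [F, Real.zero_rpow (by linarith : α + 1 ≠ 0)]
  rw [hF1, hF0, sub_zero, intervalIntegral.integral_const_mul, intervalIntegral.integral_sub] at h
  · have h' := (mul_eq_zero.1 h).resolve_left (by positivity)
    have e : ∀ (c : ℝ) (k : ℝ), (∫ x in (0:ℝ)..1, w x * (c * Real.cos (2 * π * k * x)))
        = c * ∫ x in (0:ℝ)..1, w x * Real.cos (2 * π * k * x) := by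
      intro c k
      rw [← intervalIntegral.integral_const_mul]
      congr 1; ext x; ring
    rw [e, e] at h'
    unfold cosCoeff
    push_cast
    linarith
  · apply Continuous.intervalIntegrable; fun_prop
  · apply Continuous.intervalIntegrable; fun_prop

lemma cosCoeff_eq {α : ℝ} (hα : 1 < α) (m : ℕ) : cosCoeff α m = coeff α m := by
  induction m with
  | zero => exact cosCoeff_zero hα
  | succ m ih =>
    have h1 := cosCoeff_succ hα m
    have h2 := coeff_succ (α := α) (by linarith) m
    rw [ih, ← h2] at h1
    have := mul_left_cancel₀ (by positivity) h1
    exact_mod_cast this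

/-- The coefficients of the centred difference are the Fourier coefficients of its symbol. -/
lemma coeff_eq_integral {α : ℝ} (hα : 1 < α) (m : ℤ) :
    ((coeff α m : ℝ) : ℂ) = ∫ x in (0 : ℝ)..1,
      ((symbol α x : ℝ) : ℂ) * Complex.exp (2 * π * Complex.I * m * x) := by
  have hc := continuous_symbol (α := α) (by linarith)
  -- the sine part vanishes by the symmetry `x ↦ 1 - x`
  have hsin : ∫ x in (0 : ℝ)..1, symbol α x * Real.sin (2 * π * m * x) = 0 := by
    have h := intervalIntegral.integral_comp_sub_left (a := 0) (b := 1)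
      (fun x => symbol α x * Real.sin (2 * π * m * x)) 1
    simp only [sub_self, sub_zero, symbol_one_sub] at h
    have e : ∀ x : ℝ, Real.sin (2 * π * m * (1 - x)) = - Real.sin (2 * π * m * x) := by
      intro x
      rw [show 2 * π * (m:ℝ) * (1 - x) = m * (2 * π) - 2 * π * m * x by ring,
        Real.sin_int_mul_two_pi_sub]
    simp only [e, mul_neg, intervalIntegral.integral_neg] at h
    linarith
  have hcos : ∫ x in (0 : ℝ)..1, symbol α x * Real.cos (2 * π * m * x) = coeff α m := by
    have key : ∀ k : ℕ, ∫ x in (0 : ℝ)..1, symbol α x * Real.cos (2 * π * k * x) = coeff α k := by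
      intro k
      rw [← cosCoeff_eq hα]
      refine intervalIntegral.integral_congr fun x hx => ?_
      rw [uIcc_of_le zero_le_one] at hx
      simp only [symbol_eq_of_mem hx]
    rcases Int.eq_nat_or_neg m with ⟨k, rfl | rfl⟩
    · exact_mod_cast key k
    · rw [coeff_neg, ← key k]
      congr 1; ext x
      push_cast
      rw [show 2 * π * -(k:ℝ) * x = -(2 * π * k * x) by ring, Real.cos_neg]
  have : ∀ x : ℝ, ((symbol α x : ℝ) : ℂ) * Complex.exp (2 * π * Complex.I * m * x)
      = ((symbol α x * Real.cos (2 * π * m * x) : ℝ) : ℂ)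
        + ((symbol α x * Real.sin (2 * π * m * x) : ℝ) : ℂ) * Complex.I := by
    intro x
    rw [show (2 * π * Complex.I * m * x : ℂ) = ((2 * π * m * x : ℝ) : ℂ) * Complex.I by
      push_cast; ring, Complex.exp_mul_I]
    push_cast
    ring
  simp only [this]
  rw [intervalIntegral.integral_add, intervalIntegral.integral_mul_const,
    intervalIntegral.integral_ofReal, intervalIntegral.integral_ofReal, hsin, hcos]
  · simp
  · apply Continuous.intervalIntegrable; fun_prop
  · apply Continuous.intervalIntegrable; fun_prop

lemma coeff_succ_nonpos {α : ℝ} (hα : 1 < α) (hα2 : α ≤ 2) (s : ℕ) : coeff α (s + 1 : ℕ) ≤ 0 := by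
  have hstep := fun s : ℕ => coeff_succ (α := α) (by linarith) s
  have h0 : 0 < coeff α 0 := by
    rw [coeff_zero]
    exact div_pos (Real.Gamma_pos_of_pos (by linarith))
      (pow_pos (Real.Gamma_pos_of_pos (by linarith)) 2)
  induction s with
  | zero =>
    have := hstep 0
    simp only [Nat.cast_zero, zero_add, zero_sub] at this
    by_contra hcon
    push Not at hcon
    have h1 : 0 < coeff α 1 := by simpa using hcon
    have h0' : coeff α ((0 : ℕ) : ℤ) = coeff α 0 := by simp
    have e : (1 + α / 2) * coeff α 1 = -(α / 2) * coeff α 0 := by simpa using this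
    nlinarith
  | succ s ih =>
    have := hstep (s + 1)
    by_contra hcon
    push Not at hcon
    have h1 : 0 < coeff α ((s + 1 : ℕ) + 1 : ℤ) := by exact_mod_cast hcon
    have h2 : (0:ℝ) ≤ ((s + 1 : ℕ) : ℝ) - α / 2 := by push_cast; nlinarith [Nat.cast_nonneg (α := ℝ) s]
    have h3 : (0:ℝ) < ((s + 1 : ℕ) : ℝ) + 1 + α / 2 := by positivity
    nlinarith [mul_pos h3 h1, mul_nonneg h2 (neg_nonneg.2 ih)]

/-- The coefficients are summable: by `coeff_succ` the quantities `(s + α / 2) * coeff α s`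
have the increments `-α * coeff α s`, and for `s ≥ 1` they are monotone and of constant sign. -/
lemma summable_coeff {α : ℝ} (hα : 1 < α) (hα2 : α ≤ 2) : Summable (fun m : ℤ => coeff α m) := by
  have hstep := fun s : ℕ => coeff_succ (α := α) (by linarith) s
  have hneg := coeff_succ_nonpos hα hα2
  have hsum : Summable (fun s : ℕ => -coeff α (s + 1 : ℕ)) := by
    refine summable_of_sum_range_le (c := -(1 + α / 2) * coeff α 1 / α) (fun s => neg_nonneg.2 (hneg s)) ?_
    intro n
    have htel : ∀ n : ℕ, α * ∑ s ∈ Finset.range n, -coeff α (s + 1 : ℕ)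
        = ((n : ℝ) + 1 + α / 2) * coeff α (n + 1 : ℕ) - (1 + α / 2) * coeff α 1 := by
      intro n
      induction n with
      | zero => simp
      | succ n ih =>
        rw [Finset.sum_range_succ, mul_add, ih]
        have := hstep (n + 1)
        push_cast at this ⊢
        linarith
    rw [le_div_iff₀ (by linarith), mul_comm, htel]
    have : ((n : ℝ) + 1 + α / 2) * coeff α (n + 1 : ℕ) ≤ 0 :=
      mul_nonpos_of_nonneg_of_nonpos (by positivity) (hneg n)
    linarith
  have hnat : Summable (fun s : ℕ => coeff α s) := by
    rw [← summable_nat_add_iff 1]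
    simpa using hsum.neg
  refine Summable.of_nat_of_neg hnat ?_
  simpa only [coeff_neg] using hnat

/-- The coefficients have a first absolute moment. The recurrence makes `s (s + α / 2) c_s` a
sequence with increments `((1 - α) s - α / 2) c_s`, nonnegative for `s ≥ 1`. -/
lemma summable_abs_mul_coeff {α : ℝ} (hα : 1 < α) (hα2 : α ≤ 2) :
    Summable (fun m : ℤ => |(m : ℝ)| * |coeff α m|) := by
  have hneg := coeff_succ_nonpos hα hα2
  have htel : ∀ n : ℕ, ∑ s ∈ Finset.range n, ((α - 1) * (s + 1) + α / 2) * -coeff α (s + 1 : ℕ)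
      = ((n : ℝ) + 1) * (n + 1 + α / 2) * coeff α (n + 1 : ℕ) - (1 + α / 2) * coeff α 1 := by
    intro n
    induction n with
    | zero => simp
    | succ n ih =>
      rw [Finset.sum_range_succ, ih]
      have := coeff_succ (α := α) (by linarith) (n + 1)
      push_cast at this ⊢
      linear_combination ((n : ℝ) + 1 + 1) * -this
  have hsum : Summable (fun s : ℕ => ((α - 1) * (s + 1) + α / 2) * -coeff α (s + 1 : ℕ)) := by
    have hpos : ∀ s : ℕ, 0 ≤ (α - 1) * ((s : ℝ) + 1) + α / 2 := fun s =>
      add_nonneg (mul_nonneg (by linarith) (by positivity)) (by linarith)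
    refine summable_of_sum_range_le (c := -((1 + α / 2) * coeff α 1))
      (fun s => mul_nonneg (hpos s) (neg_nonneg.2 (hneg s))) fun n => ?_
    rw [htel]
    have : ((n : ℝ) + 1) * (n + 1 + α / 2) * coeff α (n + 1 : ℕ) ≤ 0 :=
      mul_nonpos_of_nonneg_of_nonpos (by positivity) (hneg n)
    linarith
  have hnat : Summable (fun s : ℕ => |((s : ℤ) : ℝ)| * |coeff α s|) := by
    rw [← summable_nat_add_iff 1]
    refine Summable.of_nonneg_of_le (fun s => by positivity) (fun s => ?_)
      (hsum.mul_left (α - 1)⁻¹)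
    have h1 : 0 < α - 1 := by linarith
    rw [abs_of_nonpos (hneg s), ← mul_assoc]
    refine mul_le_mul_of_nonneg_right ?_ (neg_nonneg.2 (hneg s))
    rw [le_inv_mul_iff₀ h1, Int.cast_natCast, Nat.abs_cast]
    push_cast
    linarith
  refine Summable.of_nat_of_neg hnat ?_
  simpa only [coeff_neg, Int.cast_neg, abs_neg] using hnat

/-- The Fourier series of the symbol. -/
lemma hasSum_symbol {α : ℝ} (hα : 1 < α) (hα2 : α ≤ 2) (x : ℝ) :
    HasSum (fun m : ℤ => ((coeff α m : ℝ) : ℂ) * Complex.exp (-(2 * π * Complex.I * m * x)))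
      ((symbol α x : ℝ) : ℂ) := by
  have hc := continuous_symbol (α := α) (by linarith)
  have hper : Function.Periodic (fun x : ℝ => ((symbol α x : ℝ) : ℂ)) 1 := fun x => by
    simp only [symbol_periodic α x]
  let f : C(AddCircle (1 : ℝ), ℂ) :=
    ⟨hper.lift, continuous_coinduced_dom.2 (by
      change Continuous (fun x : ℝ => ((symbol α x : ℝ) : ℂ)); fun_prop)⟩
  have hf : ∀ x : ℝ, f (x : AddCircle (1:ℝ)) = ((symbol α x : ℝ) : ℂ) := fun x => rfl
  have : Fact ((0:ℝ) < 1) := ⟨one_pos⟩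
  have hco : ∀ m : ℤ, fourierCoeff f m = ((coeff α m : ℝ) : ℂ) := by
    intro m
    rw [fourierCoeff_eq_intervalIntegral _ _ 0, ← coeff_neg, coeff_eq_integral hα]
    simp only [zero_add, div_one, one_smul]
    congr 1; ext x
    rw [hf, fourier_coe_apply, smul_eq_mul, mul_comm]
    congr 2; push_cast; ring
  have hs : Summable (fourierCoeff f) := by
    have : fourierCoeff f = fun m : ℤ => ((coeff α m : ℝ) : ℂ) := funext hco
    rw [this]
    exact_mod_cast (summable_coeff hα hα2)
  have h := has_pointwise_sum_fourier_series_of_summable hs (((-x : ℝ)) : AddCircle (1:ℝ))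
  rw [hf] at h
  have e : symbol α (-x) = symbol α x := by simp [symbol]
  rw [e] at h
  convert h using 2 with m
  rw [hco, fourier_coe_apply, smul_eq_mul]
  congr 2; push_cast; ring

lemma hasSum_coeff {α : ℝ} (hα : 1 < α) (hα2 : α ≤ 2) :
    HasSum (fun m : ℤ => (coeff α m : ℂ)) 0 := by
  simpa [symbol, Real.zero_rpow (by linarith : α ≠ 0)] using hasSum_symbol hα hα2 0

section

open scoped Matrix ComplexOrder Kronecker

/-! ### A discrete Sobolev inequality -/

lemma dotProduct_single_mulVec {ι : Type*} [Fintype ι] [DecidableEq ι] (v : ι → ℂ) (j : ι) :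
    star v ⬝ᵥ Matrix.single j j (1 : ℂ) *ᵥ v = ((‖v j‖ ^ 2 : ℝ) : ℂ) := by
  rw [Matrix.single_mulVec, one_mul, dotProduct, Finset.sum_eq_single j]
  · rw [Function.update_self, Pi.star_apply, RCLike.star_def, Complex.conj_mul']
    push_cast
    rfl
  · intro b _ hb
    rw [Function.update_of_ne hb, Pi.zero_apply, mul_zero]
  · simp

/-- If `A` and `B` are positive semidefinite and `1 + A`, `1 + B` dominate rank one diagonal
matrices, then `(1 + A ⊗ 1 + 1 ⊗ B)²` dominates `(1 + A) ⊗ (1 + B)`, hence the tensor product of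
the rank one matrices. -/
lemma norm_sq_le_of_posSemidef {ι κ : Type*} [Fintype ι] [Fintype κ] [DecidableEq ι]
    [DecidableEq κ] {A : Matrix ι ι ℂ} {B : Matrix κ κ ℂ} (hA : A.PosSemidef)
    (hB : B.PosSemidef) {x y : ℝ} (hx : 0 ≤ x) (hy : 0 ≤ y) (j : ι) (k : κ)
    (hAx : (1 + A - (x : ℂ) • Matrix.single j j 1).PosSemidef)
    (hBy : (1 + B - (y : ℂ) • Matrix.single k k 1).PosSemidef) (V : ι × κ → ℂ) :
    x * y * ‖V (j, k)‖ ^ 2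
      ≤ ∑ q, ‖((1 + A ⊗ₖ (1 : Matrix κ κ ℂ) + (1 : Matrix ι ι ℂ) ⊗ₖ B) *ᵥ V) q‖ ^ 2 := by
  set D : Matrix (ι × κ) (ι × κ) ℂ := 1 + A ⊗ₖ (1 : Matrix κ κ ℂ) + (1 : Matrix ι ι ℂ) ⊗ₖ B with hD
  have hI : (1 : Matrix ι ι ℂ).PosSemidef := Matrix.PosSemidef.one
  have hK : (1 : Matrix κ κ ℂ).PosSemidef := Matrix.PosSemidef.one
  have hAA : (A * A).PosSemidef := by
    simpa [hA.isHermitian.eq] using Matrix.posSemidef_conjTranspose_mul_self A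
  have hBB : (B * B).PosSemidef := by
    simpa [hB.isHermitian.eq] using Matrix.posSemidef_conjTranspose_mul_self B
  have hx' : (0 : ℂ) ≤ (x : ℂ) := by exact_mod_cast hx
  have hy' : (0 : ℂ) ≤ (y : ℂ) := by exact_mod_cast hy
  have hsj : (Matrix.single j j (1 : ℂ)).PosSemidef := by
    have := Matrix.posSemidef_conjTranspose_mul_self (Matrix.single j j (1 : ℂ))
    simpa using this
  have h1A : (1 + B).PosSemidef := hK.add hB
  have hDh : Dᴴ = D := by
    have h1 : (A ⊗ₖ (1 : Matrix κ κ ℂ))ᴴ = A ⊗ₖ (1 : Matrix κ κ ℂ) :=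
      (hA.kronecker hK).isHermitian.eq
    have h2 : ((1 : Matrix ι ι ℂ) ⊗ₖ B)ᴴ = (1 : Matrix ι ι ℂ) ⊗ₖ B :=
      (hI.kronecker hB).isHermitian.eq
    rw [hD, Matrix.conjTranspose_add, Matrix.conjTranspose_add, h1, h2, Matrix.conjTranspose_one]
  have hsq : D * D = (((A * A) ⊗ₖ (1 : Matrix κ κ ℂ) + (1 : Matrix ι ι ℂ) ⊗ₖ (B * B)
      + A ⊗ₖ (1 : Matrix κ κ ℂ) + (1 : Matrix ι ι ℂ) ⊗ₖ B + A ⊗ₖ B)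
      + (1 + A - (x : ℂ) • Matrix.single j j 1) ⊗ₖ (1 + B)
      + ((x : ℂ) • Matrix.single j j 1) ⊗ₖ (1 + B - (y : ℂ) • Matrix.single k k 1))
      + ((x : ℂ) • Matrix.single j j 1) ⊗ₖ ((y : ℂ) • Matrix.single k k 1) := by
    have e1 : A ⊗ₖ (1 : Matrix κ κ ℂ) * A ⊗ₖ (1 : Matrix κ κ ℂ) = (A * A) ⊗ₖ (1 : Matrix κ κ ℂ) := by
      rw [← Matrix.mul_kronecker_mul, mul_one]
    have e2 : (1 : Matrix ι ι ℂ) ⊗ₖ B * (1 : Matrix ι ι ℂ) ⊗ₖ B = (1 : Matrix ι ι ℂ) ⊗ₖ (B * B) := by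
      rw [← Matrix.mul_kronecker_mul, mul_one]
    have e3 : A ⊗ₖ (1 : Matrix κ κ ℂ) * (1 : Matrix ι ι ℂ) ⊗ₖ B = A ⊗ₖ B := by
      rw [← Matrix.mul_kronecker_mul, mul_one, one_mul]
    have e4 : (1 : Matrix ι ι ℂ) ⊗ₖ B * A ⊗ₖ (1 : Matrix κ κ ℂ) = A ⊗ₖ B := by
      rw [← Matrix.mul_kronecker_mul, mul_one, one_mul]
    have e5 : (1 : Matrix ι ι ℂ) ⊗ₖ (1 : Matrix κ κ ℂ) = 1 := Matrix.one_kronecker_one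
    have lhs : D * D = 1 + A ⊗ₖ (1 : Matrix κ κ ℂ) + A ⊗ₖ (1 : Matrix κ κ ℂ)
        + (1 : Matrix ι ι ℂ) ⊗ₖ B + (1 : Matrix ι ι ℂ) ⊗ₖ B + (A * A) ⊗ₖ (1 : Matrix κ κ ℂ)
        + (1 : Matrix ι ι ℂ) ⊗ₖ (B * B) + A ⊗ₖ B + A ⊗ₖ B := by
      rw [hD]
      simp only [add_mul, mul_add, one_mul, mul_one, e1, e2, e3, e4]
      abel
    rw [lhs, sub_eq_add_neg, sub_eq_add_neg]
    have eneg1 : (-((x : ℂ) • Matrix.single j j (1:ℂ))) ⊗ₖ (1 + B)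
        = -(((x : ℂ) • Matrix.single j j (1:ℂ)) ⊗ₖ (1 + B)) := by
      ext ⟨_, _⟩ ⟨_, _⟩; simp [Matrix.kroneckerMap_apply]
    have eneg2 : ((x : ℂ) • Matrix.single j j (1:ℂ)) ⊗ₖ (-((y : ℂ) • Matrix.single k k (1:ℂ)))
        = -(((x : ℂ) • Matrix.single j j (1:ℂ)) ⊗ₖ ((y : ℂ) • Matrix.single k k (1:ℂ))) := by
      ext ⟨_, _⟩ ⟨_, _⟩; simp [Matrix.kroneckerMap_apply]
    rw [Matrix.add_kronecker (1 + A), eneg1,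
      Matrix.kronecker_add ((x : ℂ) • Matrix.single j j (1:ℂ)) (1 + B), eneg2,
      Matrix.add_kronecker, Matrix.kronecker_add, Matrix.kronecker_add, e5]
    abel
  have hpsd := ((((((hAA.kronecker hK).add (hI.kronecker hBB)).add (hA.kronecker hK)).add
    (hI.kronecker hB)).add (hA.kronecker hB)).add (hAx.kronecker h1A)).add
    ((hsj.smul hx').kronecker hBy)
  have hnn := hpsd.re_dotProduct_nonneg V
  have hE : star V ⬝ᵥ (((x : ℂ) • Matrix.single j j (1:ℂ)) ⊗ₖ ((y : ℂ) • Matrix.single k k (1:ℂ))) *ᵥ V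
      = ((x * y * ‖V (j, k)‖ ^ 2 : ℝ) : ℂ) := by
    rw [Matrix.smul_kronecker, Matrix.kronecker_smul, Matrix.single_kronecker_single,
      Matrix.smul_mulVec, Matrix.smul_mulVec, mul_one, dotProduct_smul, dotProduct_smul,
      dotProduct_single_mulVec, smul_eq_mul, smul_eq_mul]
    push_cast
    ring
  have hDD : star V ⬝ᵥ (D * D) *ᵥ V = ((∑ q, ‖(D *ᵥ V) q‖ ^ 2 : ℝ) : ℂ) := by
    rw [← Matrix.mulVec_mulVec, Matrix.dotProduct_mulVec]
    have : star V ᵥ* D = star (D *ᵥ V) := by rw [Matrix.star_mulVec, hDh]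
    rw [this, dotProduct]
    push_cast
    refine Finset.sum_congr rfl fun q _ => ?_
    rw [Pi.star_apply, RCLike.star_def, RCLike.conj_mul]
    rfl
  clear_value D
  have hfin := congrArg (fun M => star V ⬝ᵥ M *ᵥ V) hsq
  simp only [] at hfin
  rw [hDD, Matrix.add_mulVec, dotProduct_add, hE] at hfin
  have hre := congrArg Complex.re hfin
  rw [Complex.add_re, Complex.ofReal_re, Complex.ofReal_re] at hre
  rw [hre]
  have : (0:ℝ) ≤ Complex.re _ := hnn
  linarith

/-- The matrix of the negative of the one-dimensional difference operator on the interior grid. -/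
noncomputable def stiffness (α h : ℝ) (M : ℕ) :
    Matrix (Finset.Ioo 0 M) (Finset.Ioo 0 M) ℂ :=
  Matrix.of fun j s => ((1 / h ^ α : ℝ) : ℂ) * ((coeff α ((j : ℕ) - (s : ℕ) : ℤ) : ℝ) : ℂ)

/-- The trigonometric polynomial with coefficients `v`. -/
noncomputable def trigPoly {M : ℕ} (v : Finset.Ioo 0 M → ℂ) (x : ℝ) : ℂ :=
  ∑ s, v s * Complex.exp (-(2 * π * Complex.I * ((s : ℕ) : ℤ) * x))

lemma continuous_trigPoly {M : ℕ} (v : Finset.Ioo 0 M → ℂ) : Continuous (trigPoly v) := by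
  unfold trigPoly; fun_prop

lemma integral_exp_int (m : ℤ) :
    ∫ x in (0 : ℝ)..1, Complex.exp (2 * π * Complex.I * m * x) = if m = 0 then 1 else 0 := by
  split_ifs with hm
  · simp [hm]
  · have hne : (2 * π * Complex.I * m : ℂ) ≠ 0 := by
      simp [Complex.I_ne_zero, pi_ne_zero, hm]
    rw [integral_exp_mul_complex hne]
    have : Complex.exp (2 * π * Complex.I * m * (1 : ℝ)) = 1 := by
      rw [Complex.exp_eq_one_iff]
      exact ⟨m, by push_cast; ring⟩
    rw [this]
    simp

/-- Parseval's identity with a weight. -/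
lemma integral_weight_trigPoly {M : ℕ} (v : Finset.Ioo 0 M → ℂ) {g : ℝ → ℝ} (hg : Continuous g) :
    ((∫ x in (0 : ℝ)..1, g x * ‖trigPoly v x‖ ^ 2 : ℝ) : ℂ)
      = ∑ j : Finset.Ioo 0 M, ∑ s : Finset.Ioo 0 M, star (v j) * (∫ x in (0 : ℝ)..1, ((g x : ℝ) : ℂ)
        * Complex.exp (2 * π * Complex.I * (((j : ℕ) - (s : ℕ) : ℤ)) * x)) * v s := by
  rw [← intervalIntegral.integral_ofReal]
  have hpt : ∀ x : ℝ, ((g x * ‖trigPoly v x‖ ^ 2 : ℝ) : ℂ) = ∑ j : Finset.Ioo 0 M, ∑ s : Finset.Ioo 0 M, star (v j) *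
      (((g x : ℝ) : ℂ) * Complex.exp (2 * π * Complex.I * (((j : ℕ) - (s : ℕ) : ℤ)) * x)) * v s := by
    intro x
    push_cast
    rw [← Complex.conj_mul' (trigPoly v x)]
    have : (starRingEnd ℂ) (trigPoly v x)
        = ∑ j, star (v j) * Complex.exp (2 * π * Complex.I * ((j : ℕ) : ℤ) * x) := by
      unfold trigPoly
      rw [map_sum]
      refine Finset.sum_congr rfl fun j _ => ?_
      rw [map_mul, ← Complex.exp_conj]
      congr 2
      simp only [map_neg, map_mul, Complex.conj_I, Complex.conj_ofReal, map_intCast, map_ofNat]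
      ring
    rw [this, trigPoly, Finset.sum_mul_sum, Finset.mul_sum]
    refine Finset.sum_congr rfl fun j _ => ?_
    rw [Finset.mul_sum]
    refine Finset.sum_congr rfl fun s _ => ?_
    have : Complex.exp (2 * π * Complex.I * (((j : ℕ) : ℂ) - ((s : ℕ) : ℂ)) * x)
        = Complex.exp (2 * π * Complex.I * ((j : ℕ) : ℤ) * x)
          * Complex.exp (-(2 * π * Complex.I * ((s : ℕ) : ℤ) * x)) := by
      rw [← Complex.exp_add]; congr 1; push_cast; ring
    rw [this]
    ring
  simp only [hpt]
  rw [intervalIntegral.integral_finsetSum]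
  · refine Finset.sum_congr rfl fun j _ => ?_
    rw [intervalIntegral.integral_finsetSum]
    · refine Finset.sum_congr rfl fun s _ => ?_
      rw [intervalIntegral.integral_mul_const, intervalIntegral.integral_const_mul]
    · intro s _
      apply Continuous.intervalIntegrable; fun_prop
  · intro j _
    apply Continuous.intervalIntegrable; fun_prop

lemma dotProduct_stiffness {α : ℝ} (hα : 1 < α) (h : ℝ) {M : ℕ} (v : Finset.Ioo 0 M → ℂ) :
    star v ⬝ᵥ stiffness α h M *ᵥ v
      = ((∫ x in (0 : ℝ)..1, (1 / h ^ α * symbol α x) * ‖trigPoly v x‖ ^ 2 : ℝ) : ℂ) := by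
  have hc := continuous_symbol (α := α) (by linarith)
  rw [integral_weight_trigPoly v (by fun_prop)]
  simp only [dotProduct, Matrix.mulVec, stiffness, Matrix.of_apply, Finset.mul_sum, Pi.star_apply]
  refine Finset.sum_congr rfl fun j _ => Finset.sum_congr rfl fun s _ => ?_
  rw [coeff_eq_integral hα, ← intervalIntegral.integral_const_mul, mul_assoc]
  push_cast
  simp only [mul_assoc]

lemma dotProduct_one {M : ℕ} (v : Finset.Ioo 0 M → ℂ) :
    star v ⬝ᵥ (1 : Matrix (Finset.Ioo 0 M) (Finset.Ioo 0 M) ℂ) *ᵥ v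
      = ((∫ x in (0 : ℝ)..1, (1 : ℝ) * ‖trigPoly v x‖ ^ 2 : ℝ) : ℂ) := by
  rw [integral_weight_trigPoly v (by fun_prop)]
  simp only [Complex.ofReal_one, one_mul, Matrix.one_mulVec, dotProduct, Pi.star_apply]
  refine Finset.sum_congr rfl fun j _ => ?_
  rw [Finset.sum_eq_single j]
  · rw [integral_exp_int]; simp
  · intro s _ hs
    rw [integral_exp_int, if_neg]
    · simp
    · intro h0
      apply hs
      ext
      omega
  · simp

lemma stiffness_isHermitian (α h : ℝ) (M : ℕ) : (stiffness α h M).IsHermitian := by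
  ext j s
  simp only [stiffness, Matrix.conjTranspose_apply, Matrix.of_apply, star_mul']
  rw [← coeff_neg, neg_sub]
  simp

lemma stiffness_posSemidef {α : ℝ} (hα : 1 < α) {h : ℝ} (hh : 0 < h) (M : ℕ) :
    (stiffness α h M).PosSemidef := by
  refine Matrix.PosSemidef.of_dotProduct_mulVec_nonneg (stiffness_isHermitian α h M) fun v => ?_
  rw [dotProduct_stiffness hα]
  have : 0 ≤ ∫ x in (0 : ℝ)..1, (1 / h ^ α * symbol α x) * ‖trigPoly v x‖ ^ 2 :=
    intervalIntegral.integral_nonneg zero_le_one fun x _ =>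
      mul_nonneg (mul_nonneg (by positivity) (symbol_nonneg α x)) (by positivity)
  exact_mod_cast this

lemma eq_integral_trigPoly {M : ℕ} (v : Finset.Ioo 0 M → ℂ) (j : Finset.Ioo 0 M) :
    v j = ∫ x in (0 : ℝ)..1, trigPoly v x * Complex.exp (2 * π * Complex.I * ((j : ℕ) : ℤ) * x) := by
  have hpt : ∀ x : ℝ, trigPoly v x * Complex.exp (2 * π * Complex.I * ((j : ℕ) : ℤ) * x)
      = ∑ s, v s * Complex.exp (2 * π * Complex.I * (((j : ℕ) - (s : ℕ) : ℤ)) * x) := by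
    intro x
    rw [trigPoly, Finset.sum_mul]
    refine Finset.sum_congr rfl fun s _ => ?_
    rw [mul_assoc, ← Complex.exp_add]
    congr 2; push_cast; ring
  simp only [hpt]
  rw [intervalIntegral.integral_finsetSum]
  · rw [Finset.sum_eq_single j]
    · rw [intervalIntegral.integral_const_mul, integral_exp_int]; simp
    · intro s _ hs
      rw [intervalIntegral.integral_const_mul, integral_exp_int, if_neg, mul_zero]
      intro h0
      apply hs
      ext
      omega
    · simp
  · intro s _
    apply Continuous.intervalIntegrable; fun_prop

/-- The inverse symbol of `1 + A` has an integral of order `h`; this is where `1 < α` enters. -/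
lemma integral_inv_symbol_le {α : ℝ} (hα : 1 < α) (hα2 : α ≤ 2) {h : ℝ} (hh : 0 < h) :
    ∫ x in (0 : ℝ)..1, (1 + 1 / h ^ α * symbol α x)⁻¹
      ≤ (8 * ∫ y : ℝ, (1 + ‖y‖) ^ (-α)) * h := by
  have hc := continuous_symbol (α := α) (by linarith)
  set g : ℝ → ℝ := fun x => (1 + ‖x / h‖) ^ (-α) with hg
  have hgi : Integrable g := by
    have := (integrable_one_add_norm (E := ℝ) (μ := volume) (r := α) (by simpa using hα))
    exact this.comp_div hh.ne'
  have hgI : ∫ x, g x = h * ∫ y : ℝ, (1 + ‖y‖) ^ (-α) := by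
    have := Measure.integral_comp_div (fun y : ℝ => (1 + ‖y‖) ^ (-α)) h
    rw [abs_of_pos hh] at this
    simpa [hg] using this
  have hgc : Continuous g := by
    refine Continuous.rpow_const (by fun_prop) fun x => Or.inl ?_
    have := norm_nonneg (x / h)
    positivity
  have hg0 : ∀ x, 0 ≤ g x := fun x => Real.rpow_nonneg (by have := norm_nonneg (x / h); positivity) _
  have key : ∀ x : ℝ, 0 ≤ x → x ≤ 1 / 2 → (1 + 1 / h ^ α * symbol α x)⁻¹ ≤ 4 * g x := by
    intro x hx0 hx1
    have hs : x ≤ 2 * Real.sin (π * x) := by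
      have := Real.mul_le_sin (x := π * x) (by positivity) (by nlinarith [pi_pos])
      have e : 2 / π * (π * x) = 2 * x := by field_simp
      linarith
    have h1 : (x / h) ^ α ≤ 1 / h ^ α * symbol α x := by
      rw [symbol_eq_of_mem ⟨hx0, by linarith⟩, Real.div_rpow hx0 hh.le, one_div, inv_mul_eq_div]
      gcongr
    have hy : 0 ≤ x / h := by positivity
    have h2 : (1 + x / h) ^ α ≤ 4 * (1 + (x / h) ^ α) := by
      have hmax : 1 + x / h ≤ 2 * max 1 (x / h) := by
        linarith [le_max_left 1 (x / h), le_max_right 1 (x / h)]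
      have hm0 : 0 ≤ max 1 (x / h) := by positivity
      calc (1 + x / h) ^ α ≤ (2 * max 1 (x / h)) ^ α := by gcongr
        _ = 2 ^ α * (max 1 (x / h)) ^ α := Real.mul_rpow (by norm_num) hm0
        _ ≤ 2 ^ (2:ℝ) * (1 + (x / h) ^ α) := by
            gcongr
            · norm_num
            · rcases max_cases 1 (x / h) with ⟨h, _⟩ | ⟨h, _⟩ <;> rw [h]
              · rw [Real.one_rpow]; linarith [Real.rpow_nonneg hy α]
              · linarith
        _ = _ := by norm_num
    have hgx : g x = ((1 + x / h) ^ α)⁻¹ := by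
      simp only [hg]
      rw [Real.norm_of_nonneg hy, Real.rpow_neg (by positivity)]
    rw [hgx]
    have hp : 0 < (1 + x / h) ^ α := by positivity
    calc (1 + 1 / h ^ α * symbol α x)⁻¹ ≤ ((1 + x / h) ^ α / 4)⁻¹ := by
          apply inv_anti₀ (by positivity)
          linarith
      _ = _ := by rw [inv_div]; ring
  have hpt : ∀ x ∈ Icc (0:ℝ) 1, (1 + 1 / h ^ α * symbol α x)⁻¹ ≤ 4 * g x + 4 * g (1 - x) := by
    intro x hx
    rcases le_total x (1 / 2) with h1 | h1
    · linarith [key x hx.1 h1, hg0 (1 - x)]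
    · have := key (1 - x) (by linarith [hx.2]) (by linarith)
      rw [symbol_one_sub] at this
      linarith [hg0 x]
  have hle : ∫ x in (0:ℝ)..1, g x ≤ ∫ x, g x := by
    rw [intervalIntegral.integral_of_le zero_le_one]
    exact setIntegral_le_integral hgi (Eventually.of_forall hg0)
  have hle' : ∫ x in (0:ℝ)..1, g (1 - x) = ∫ x in (0:ℝ)..1, g x := by
    simp [intervalIntegral.integral_comp_sub_left g 1]
  have hden : ∀ x, 1 + 1 / h ^ α * symbol α x ≠ 0 := fun x => by
    have := symbol_nonneg α x; positivity
  calc ∫ x in (0 : ℝ)..1, (1 + 1 / h ^ α * symbol α x)⁻¹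
      ≤ ∫ x in (0:ℝ)..1, (4 * g x + 4 * g (1 - x)) := by
        apply intervalIntegral.integral_mono_on zero_le_one _ _ hpt
        · exact (Continuous.inv₀ (by fun_prop) hden).intervalIntegrable _ _
        · apply Continuous.intervalIntegrable; fun_prop
    _ = 8 * ∫ x in (0:ℝ)..1, g x := by
        rw [intervalIntegral.integral_add, intervalIntegral.integral_const_mul,
          intervalIntegral.integral_const_mul, hle']
        · ring
        · apply Continuous.intervalIntegrable; fun_prop
        · apply Continuous.intervalIntegrable; fun_prop
    _ ≤ 8 * ∫ x, g x := by linarith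
    _ = _ := by rw [hgI]; ring

/-- One-dimensional discrete Sobolev inequality, in matrix form. -/
lemma one_add_stiffness_sub_posSemidef {α : ℝ} (hα : 1 < α) (hα2 : α ≤ 2) {h K : ℝ} (hh : 0 < h)
    (hK : 0 < K) (hKα : 8 * ∫ y : ℝ, (1 + ‖y‖) ^ (-α) ≤ K) {M : ℕ} (j : Finset.Ioo 0 M) :
    (1 + stiffness α h M - (((K * h)⁻¹ : ℝ) : ℂ) • Matrix.single j j 1).PosSemidef := by
  refine Matrix.PosSemidef.of_dotProduct_mulVec_nonneg ?_ fun v => ?_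
  · refine Matrix.IsHermitian.sub (Matrix.isHermitian_one.add (stiffness_isHermitian α h M)) ?_
    ext a b
    simp only [Matrix.conjTranspose_apply, Matrix.smul_apply, Matrix.single_apply, smul_eq_mul,
      star_mul']
    simp only [and_comm]
    split_ifs <;> simp
  have hc := continuous_symbol (α := α) (by linarith)
  have hT := continuous_trigPoly v
  set w : ℝ → ℝ := fun x => 1 + 1 / h ^ α * symbol α x with hw
  have hwpos : ∀ x, 0 < w x := fun x => by
    have := symbol_nonneg α x; simp only [hw]; positivity
  have hwc : Continuous w := by fun_prop
  have hwi : Continuous fun x => (w x)⁻¹ := hwc.inv₀ fun x => (hwpos x).ne'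
  set Q := ∫ x in (0 : ℝ)..1, w x * ‖trigPoly v x‖ ^ 2 with hQ
  set S := ∫ x in (0 : ℝ)..1, ‖trigPoly v x‖ with hS
  set P := ∫ x in (0 : ℝ)..1, (w x)⁻¹ with hP
  have hS0 : 0 ≤ S := intervalIntegral.integral_nonneg zero_le_one fun x _ => norm_nonneg _
  have hPle : P ≤ K * h := (integral_inv_symbol_le hα hα2 hh).trans (by gcongr)
  have hKh : 0 < K * h := by positivity
  -- Cauchy-Schwarz, from the square of `‖T‖ - (S / (K h)) / w`
  have hCS : S ^ 2 / (K * h) ≤ Q := by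
    set lam := S / (K * h) with hlam
    have h0 : 0 ≤ ∫ x in (0 : ℝ)..1, w x * (‖trigPoly v x‖ - lam * (w x)⁻¹) ^ 2 :=
      intervalIntegral.integral_nonneg zero_le_one fun x _ =>
        mul_nonneg (hwpos x).le (sq_nonneg _)
    have e : ∀ x, w x * (‖trigPoly v x‖ - lam * (w x)⁻¹) ^ 2
        = w x * ‖trigPoly v x‖ ^ 2 - 2 * lam * ‖trigPoly v x‖ + lam ^ 2 * (w x)⁻¹ := by
      intro x
      have := (hwpos x).ne'
      field_simp
      ring
    simp only [e] at h0
    rw [intervalIntegral.integral_add, intervalIntegral.integral_sub,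
      intervalIntegral.integral_const_mul, intervalIntegral.integral_const_mul] at h0
    · have h1 : lam ^ 2 * P ≤ lam ^ 2 * (K * h) := by gcongr
      have h2 : lam ^ 2 * (K * h) = S ^ 2 / (K * h) := by rw [hlam]; field_simp
      have h3 : 2 * lam * S = 2 * (S ^ 2 / (K * h)) := by rw [hlam]; field_simp
      linarith
    all_goals apply Continuous.intervalIntegrable; fun_prop
  have hvj : ‖v j‖ ≤ S := by
    rw [eq_integral_trigPoly v j]
    refine (intervalIntegral.norm_integral_le_integral_norm zero_le_one).trans (le_of_eq ?_)
    rw [hS]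
    congr 1; ext x
    rw [norm_mul, show (2 * π * Complex.I * ((j : ℕ) : ℤ) * x : ℂ)
      = ((2 * π * (j : ℕ) * x : ℝ) : ℂ) * Complex.I by push_cast; ring,
      Complex.norm_exp_ofReal_mul_I, mul_one]
  have hsum : star v ⬝ᵥ (1 + stiffness α h M) *ᵥ v = ((Q : ℝ) : ℂ) := by
    rw [Matrix.add_mulVec, dotProduct_add, dotProduct_stiffness hα, dotProduct_one,
      ← Complex.ofReal_add, ← intervalIntegral.integral_add]
    · rw [hQ]
      congr 2; ext x; simp only [hw]; ring
    all_goals apply Continuous.intervalIntegrable; fun_prop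
  have hE : star v ⬝ᵥ ((((K * h)⁻¹ : ℝ) : ℂ) • Matrix.single j j (1:ℂ)) *ᵥ v
      = (((K * h)⁻¹ * ‖v j‖ ^ 2 : ℝ) : ℂ) := by
    rw [Matrix.smul_mulVec, dotProduct_smul, dotProduct_single_mulVec, smul_eq_mul]
    push_cast
    rfl
  rw [Matrix.sub_mulVec, dotProduct_sub, hsum, hE, ← Complex.ofReal_sub]
  have : (K * h)⁻¹ * ‖v j‖ ^ 2 ≤ Q := by
    refine le_trans ?_ hCS
    rw [inv_mul_eq_div]
    gcongr
  have h0 : 0 ≤ Q - (K * h)⁻¹ * ‖v j‖ ^ 2 := by linarith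
  exact_mod_cast h0

/-- The interior grid points. -/
abbrev Grid (Mx My : ℕ) : Type := Finset.Ioo 0 Mx × Finset.Ioo 0 My

/-- The matrix of the two-dimensional difference operator on the interior grid. -/
noncomputable def laplaceMatrix (α hx hy : ℝ) (Mx My : ℕ) :
    Matrix (Grid Mx My) (Grid Mx My) ℂ :=
  -(stiffness α hx Mx ⊗ₖ (1 : Matrix (Finset.Ioo 0 My) (Finset.Ioo 0 My) ℂ)
    + (1 : Matrix (Finset.Ioo 0 Mx) (Finset.Ioo 0 Mx) ℂ) ⊗ₖ stiffness α hy My)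

lemma laplaceMatrix_mulVec (α hx hy : ℝ) (Mx My : ℕ) (V : ℕ → ℕ → ℂ) (p : Grid Mx My) :
    (laplaceMatrix α hx hy Mx My *ᵥ fun q => V q.1 q.2) p
      = diff2 α hx hy Mx My V p.1 p.2 := by
  obtain ⟨j, k⟩ := p
  have e1 : ((stiffness α hx Mx ⊗ₖ (1 : Matrix (Finset.Ioo 0 My) (Finset.Ioo 0 My) ℂ)) *ᵥ
      fun q => V q.1 q.2) (j, k) = -diffX α hx Mx V j k := by
    simp only [Matrix.mulVec, dotProduct, Matrix.kroneckerMap_apply, Fintype.sum_prod_type,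
      Matrix.one_apply, diffX, neg_neg, Finset.mul_sum]
    rw [← Finset.sum_coe_sort (Finset.Ioo 0 Mx)]
    refine Finset.sum_congr rfl fun s _ => ?_
    simp [stiffness, mul_assoc]
  have e2 : (((1 : Matrix (Finset.Ioo 0 Mx) (Finset.Ioo 0 Mx) ℂ) ⊗ₖ stiffness α hy My) *ᵥ
      fun q => V q.1 q.2) (j, k) = -diffY α hy My V j k := by
    simp only [Matrix.mulVec, dotProduct, Matrix.kroneckerMap_apply, Fintype.sum_prod_type,
      Matrix.one_apply, diffY, neg_neg, Finset.mul_sum]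
    rw [Finset.sum_eq_single j, ← Finset.sum_coe_sort (Finset.Ioo 0 My)]
    · refine Finset.sum_congr rfl fun s _ => ?_
      simp [stiffness, mul_assoc]
    · intro b _ hb
      simp [hb.symm]
    · simp
  rw [laplaceMatrix, Matrix.neg_mulVec, Pi.neg_apply, Matrix.add_mulVec, Pi.add_apply, e1, e2,
    diff2]
  ring

/-- The two-dimensional discrete operator on the Euclidean space of grid functions. -/
noncomputable def laplaceLin (α hx hy : ℝ) (Mx My : ℕ) :
    EuclideanSpace ℂ (Grid Mx My) →ₗ[ℂ] EuclideanSpace ℂ (Grid Mx My) :=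
  Matrix.toEuclideanLin (laplaceMatrix α hx hy Mx My)

lemma laplaceLin_apply (α hx hy : ℝ) (Mx My : ℕ) (V : ℕ → ℕ → ℂ) (p : Grid Mx My) :
    laplaceLin α hx hy Mx My (WithLp.toLp 2 fun q => V q.1 q.2) p
      = diff2 α hx hy Mx My V p.1 p.2 :=
  laplaceMatrix_mulVec α hx hy Mx My V p

lemma laplaceLin_isSymmetric {α hx hy : ℝ} (hα : 1 < α) (hhx : 0 < hx) (hhy : 0 < hy)
    (Mx My : ℕ) : (laplaceLin α hx hy Mx My).IsSymmetric := by
  refine Matrix.isSymmetric_toEuclideanLin_iff.2 (Matrix.IsHermitian.neg (Matrix.IsHermitian.add ?_ ?_))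
  · exact ((stiffness_posSemidef hα hhx Mx).kronecker Matrix.PosSemidef.one).isHermitian
  · exact (Matrix.PosSemidef.one.kronecker (stiffness_posSemidef hα hhy My)).isHermitian

/-- Discrete Sobolev inequality in the plane: the maximum norm is controlled by the graph norm of
the discrete operator, uniformly in both mesh sizes. -/
theorem discrete_sobolev {α : ℝ} (hα : 1 < α) (hα2 : α ≤ 2) :
    ∃ K : ℝ, 0 < K ∧ ∀ (Mx My : ℕ) (hx hy : ℝ), 0 < hx → 0 < hy →
      ∀ (V : EuclideanSpace ℂ (Grid Mx My)) (p : Grid Mx My),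
        ‖V p‖ ≤ K * √(hx * hy) * (‖V‖ + ‖laplaceLin α hx hy Mx My V‖) := by
  have hI : 0 ≤ ∫ y : ℝ, (1 + ‖y‖) ^ (-α) := integral_nonneg fun y =>
    Real.rpow_nonneg (by positivity) _
  set K : ℝ := 8 * (∫ y : ℝ, (1 + ‖y‖) ^ (-α)) + 1 with hK
  have hK0 : 0 < K := by positivity
  refine ⟨K, hK0, fun Mx My hx hy hhx hhy V p => ?_⟩
  have h := norm_sq_le_of_posSemidef (stiffness_posSemidef hα hhx Mx)
    (stiffness_posSemidef hα hhy My) (x := (K * hx)⁻¹) (y := (K * hy)⁻¹) (by positivity)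
    (by positivity) p.1 p.2
    (one_add_stiffness_sub_posSemidef hα hα2 hhx hK0 (by rw [hK]; linarith) p.1)
    (one_add_stiffness_sub_posSemidef hα hα2 hhy hK0 (by rw [hK]; linarith) p.2) V.ofLp
  have hrhs : ∑ q, ‖((1 + stiffness α hx Mx ⊗ₖ (1 : Matrix (Finset.Ioo 0 My) (Finset.Ioo 0 My) ℂ)
      + (1 : Matrix (Finset.Ioo 0 Mx) (Finset.Ioo 0 Mx) ℂ) ⊗ₖ stiffness α hy My) *ᵥ V.ofLp) q‖ ^ 2
      = ‖V - laplaceLin α hx hy Mx My V‖ ^ 2 := by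
    rw [EuclideanSpace.norm_sq_eq]
    refine Finset.sum_congr rfl fun q _ => ?_
    congr 2
    have : (laplaceLin α hx hy Mx My V).ofLp = laplaceMatrix α hx hy Mx My *ᵥ V.ofLp := rfl
    rw [WithLp.ofLp_sub, Pi.sub_apply, this, laplaceMatrix, Matrix.neg_mulVec, Pi.neg_apply,
      add_assoc, Matrix.add_mulVec, Matrix.one_mulVec, Pi.add_apply]
    ring
  rw [hrhs] at h
  have h2 : ‖V p‖ ^ 2 ≤ (K * √(hx * hy) * ‖V - laplaceLin α hx hy Mx My V‖) ^ 2 := by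
    rw [mul_pow, mul_pow, Real.sq_sqrt (by positivity)]
    have e : (K * hx)⁻¹ * (K * hy)⁻¹ = (K ^ 2 * (hx * hy))⁻¹ := by
      rw [← mul_inv]; congr 1; ring
    rw [e, inv_mul_le_iff₀ (by positivity)] at h
    exact h
  refine (le_abs_self _).trans ((abs_le_of_sq_le_sq h2 (by positivity)).trans ?_)
  gcongr
  exact norm_sub_le _ _

end

/-! ### Stability of the three-level scheme -/

/-- A discrete Gronwall inequality for running maxima with an implicit term. -/
lemma gronwall_partialSups {a : ℕ → ℝ} {ε c τ : ℝ} (ha : ∀ m, 0 ≤ a m) (hε : 0 ≤ ε) (hc : 0 ≤ c)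
    (hτ : 0 ≤ τ) (hcτ : c * τ ≤ 1 / 2) {k n : ℕ}
    (h : ∀ m, k ≤ m → m < n →
      a (m + 1) ≤ partialSups a m + c * τ * (partialSups a (m + 1) + ε)) :
    ∀ m, k ≤ m → m ≤ n →
      partialSups a m + ε ≤ (partialSups a k + ε) * Real.exp (2 * c * (m * τ)) := by
  have hP : ∀ m, 0 ≤ partialSups a m := fun m => (ha m).trans (le_partialSups a m)
  intro m hkm
  induction m, hkm using Nat.le_induction with
  | base =>
    intro _
    have h1 : 1 ≤ Real.exp (2 * c * (k * τ)) := Real.one_le_exp (by positivity)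
    nlinarith [hP k]
  | succ m hkm ih =>
    intro hmn
    have ih' := ih (by omega)
    have hstep : partialSups a (m + 1) + ε
        ≤ (partialSups a m + ε) + c * τ * (partialSups a (m + 1) + ε) := by
      have h0 : 0 ≤ c * τ * (partialSups a (m + 1) + ε) :=
        mul_nonneg (by positivity) (by linarith [hP (m + 1)])
      have : partialSups a (m + 1) ≤ partialSups a m + c * τ * (partialSups a (m + 1) + ε) := by
        rw [partialSups_add_one]
        refine sup_le (by rw [← partialSups_add_one]; linarith) ?_
        rw [← partialSups_add_one]
        exact h m hkm (by omega)
      linarith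
    set X := partialSups a (m + 1) + ε
    set Y := partialSups a m + ε
    have hX : 0 ≤ X := add_nonneg (hP _) hε
    have hY : 0 ≤ Y := add_nonneg (hP _) hε
    have hx0 : 0 ≤ c * τ := by positivity
    have h2 : X ≤ Y * (1 + 2 * (c * τ)) := by
      nlinarith [mul_nonneg hx0 (sub_nonneg.2 hcτ), mul_nonneg hY hx0,
        mul_nonneg (mul_nonneg hY hx0) (sub_nonneg.2 hcτ)]
    have h3 : 1 + 2 * (c * τ) ≤ Real.exp (2 * (c * τ)) := by
      linarith [Real.add_one_le_exp (2 * (c * τ))]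
    calc X ≤ Y * Real.exp (2 * (c * τ)) := h2.trans (by gcongr)
      _ ≤ (partialSups a k + ε) * Real.exp (2 * c * (m * τ)) * Real.exp (2 * (c * τ)) := by
          gcongr
      _ = _ := by
          rw [mul_assoc, ← Real.exp_add]
          congr 2; push_cast; ring

section

variable {E : Type*} [NormedAddCommGroup E] [InnerProductSpace ℂ E]

/-- One step of the scheme, measured in the norm. -/
lemma norm_step_le {L : E →ₗ[ℂ] E} (hL : L.IsSymmetric) {τ : ℝ} (hτ : 0 ≤ τ) {p q f : E}
    (h : Complex.I • (p - q) + (τ : ℂ) • L (p + q) + (2 * τ : ℂ) • f = 0) :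
    ‖p‖ ≤ ‖q‖ + 2 * τ * ‖f‖ := by
  have h1 := congrArg (fun z => (inner ℂ (p + q) z).im) h
  simp only [inner_add_right, inner_smul_right, inner_zero_right, Complex.zero_im,
    Complex.add_im] at h1
  have h2 : (inner ℂ (p + q) (L (p + q))).im = 0 := hL.im_inner_self_apply (p + q)
  have e1 : (Complex.I * (inner ℂ (p + q) (p - q))).im = ‖p‖ ^ 2 - ‖q‖ ^ 2 := by
    rw [Complex.I_mul_im, inner_sub_right, inner_add_left, inner_add_left, Complex.sub_re,
      Complex.add_re, Complex.add_re]
    have a1 : (inner ℂ p p).re = ‖p‖ ^ 2 := by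
      rw [inner_self_eq_norm_sq_to_K]; norm_cast
    have a2 : (inner ℂ q q).re = ‖q‖ ^ 2 := by
      rw [inner_self_eq_norm_sq_to_K]; norm_cast
    have a3 : (inner ℂ p q).re = (inner ℂ q p).re := inner_re_symm (𝕜 := ℂ) p q
    rw [a1, a2, a3]; ring
  have e2 : ((τ : ℂ) * inner ℂ (p + q) (L (p + q))).im = 0 := by
    rw [Complex.im_ofReal_mul, h2, mul_zero]
  have e3 : ((2 * τ : ℂ) * inner ℂ (p + q) f).im = 2 * τ * (inner ℂ (p + q) f).im := by
    have : (2 * τ : ℂ) = ((2 * τ : ℝ) : ℂ) := by push_cast; rfl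
    rw [this, Complex.im_ofReal_mul]
  have e0 : (inner ℂ (p + q) (L p) + inner ℂ (p + q) (L q)) = inner ℂ (p + q) (L (p + q)) := by
    rw [map_add, inner_add_right]
  have h3 : ‖p‖ ^ 2 - ‖q‖ ^ 2 + 2 * τ * (inner ℂ (p + q) f).im = 0 := by
    rw [← e1, ← e3]
    linarith [h1, e2]
  have h4 : |(inner ℂ (p + q) f).im| ≤ (‖p‖ + ‖q‖) * ‖f‖ :=
    (Complex.abs_im_le_norm _).trans ((norm_inner_le_norm _ _).trans
      (by gcongr; exact norm_add_le _ _))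
  have h5 : ‖p‖ ^ 2 - ‖q‖ ^ 2 ≤ 2 * τ * ((‖p‖ + ‖q‖) * ‖f‖) := by
    have := (abs_le.1 h4).1
    nlinarith
  by_contra hcon
  push Not at hcon
  have hf : 0 ≤ 2 * τ * ‖f‖ := by positivity
  nlinarith [norm_nonneg p, norm_nonneg q]

/-- Applying `L` to one step of the scheme shows that `L p + f` and `L q + f` solve the step
without a source; so the graph norm is controlled through time differences of the source only. -/
lemma norm_map_add_le {L : E →ₗ[ℂ] E} (hL : L.IsSymmetric) {τ : ℝ} (hτ : 0 ≤ τ) {p q f : E}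
    (h : Complex.I • (p - q) + (τ : ℂ) • L (p + q) + (2 * τ : ℂ) • f = 0) :
    ‖L p + f‖ ≤ ‖L q + f‖ := by
  have h1 : Complex.I • ((L p + f) - (L q + f)) + (τ : ℂ) • L ((L p + f) + (L q + f))
      + (2 * τ : ℂ) • (0 : E) = 0 := by
    have h2 := congrArg L h
    simp only [map_add, map_sub, map_smul, map_zero] at h2 ⊢
    refine Eq.trans ?_ h2
    module
  simpa using norm_step_le hL hτ h1

lemma norm_sub_le_of_step {L : E →ₗ[ℂ] E} {τ : ℝ} (hτ : 0 ≤ τ) {p q f : E}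
    (h : Complex.I • (p - q) + (τ : ℂ) • L (p + q) + (2 * τ : ℂ) • f = 0) :
    ‖p - q‖ ≤ τ * (‖L p‖ + ‖L q‖ + 2 * ‖f‖) := by
  have h1 : Complex.I • (p - q) = -((τ : ℂ) • (L p + L q + (2 : ℂ) • f)) := by
    rw [eq_neg_iff_add_eq_zero, ← h, map_add]
    module
  have h2 := congrArg norm h1
  rw [norm_smul, Complex.norm_I, one_mul, norm_neg, norm_smul, Complex.norm_real,
    Real.norm_of_nonneg hτ] at h2
  rw [h2]
  gcongr
  refine (norm_add_le _ _).trans (add_le_add (norm_add_le _ _) ?_)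
  rw [norm_smul]
  simp

end

/-- Stability of the linearly implicit three-level scheme in the graph norm of the space operator.
The source `F` may depend on the solution, as long as it is Lipschitz, and so are its time
differences. -/
theorem scheme_stability {κ T : ℝ} (hκ : 0 < κ) (hT : 0 < T) :
    ∃ C : ℝ, 0 < C ∧ ∀ (E : Type) [NormedAddCommGroup E] [InnerProductSpace ℂ E] (L : E →ₗ[ℂ] E),
      L.IsSymmetric → ∀ (τ ε : ℝ) (n : ℕ) (e F : ℕ → E), 0 ≤ τ → 0 ≤ ε → 12 * κ * τ ≤ 1 →
        (n + 1) * τ ≤ T → e 0 = 0 → ‖e 1‖ ≤ ε → ‖L (e 1)‖ ≤ ε →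
        (∀ m, 1 ≤ m → m ≤ n → Complex.I • (e (m + 1) - e (m - 1))
          + (τ : ℂ) • L (e (m + 1) + e (m - 1)) + (2 * τ : ℂ) • F m = 0) →
        (∀ m, 1 ≤ m → m ≤ n → ‖F m‖ ≤ κ * (‖e m‖ + ‖e (m + 1)‖ + ‖e (m - 1)‖ + ε)) →
        (∀ m, 3 ≤ m → m ≤ n → ‖F m - F (m - 2)‖ ≤ κ * (‖e m - e (m - 2)‖
          + ‖e (m + 1) - e (m - 1)‖ + ‖e (m - 1) - e (m - 3)‖
          + τ * (‖e m‖ + ‖e (m + 1)‖ + ‖e (m - 1)‖ + ‖e (m - 2)‖ + ‖e (m - 3)‖ + ε))) →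
        ∀ m, m ≤ n + 1 → ‖e m‖ + ‖L (e m)‖ ≤ C * ε := by
  set X : ℝ := Real.exp (12 * κ * T) with hX
  have hX1 : 1 ≤ X := Real.one_le_exp (by positivity)
  -- bounds for `‖e‖ / ε`, `‖F‖ / ε` and the source in the second use of Gronwall's inequality
  set A : ℝ := 2 * X with hA
  set φ : ℝ := κ * (3 * A + 1) with hφ
  set η : ℝ := 12 * φ + 5 * A + 1 with hη
  have hA0 : 0 < A := by positivity
  have hφ0 : 0 < φ := by positivity
  have hη0 : 0 < η := by positivity
  refine ⟨A + ((1 + φ + η) * X + φ), by positivity, ?_⟩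
  intro E _ _ L hL τ ε n e F hτ hε hκτ hnT he0 he1 hLe1 heq hF hFd
  have hexp : ∀ m : ℕ, m ≤ n + 1 → Real.exp (2 * (6 * κ) * (m * τ)) ≤ X := by
    intro m hm
    apply Real.exp_le_exp.2
    have : (m : ℝ) * τ ≤ T := le_trans (by gcongr; exact_mod_cast hm) hnT
    nlinarith
  -- the norm of `e`
  have hA' : ∀ m, m ≤ n + 1 → ‖e m‖ ≤ A * ε := by
    have hg := gronwall_partialSups (a := fun m => ‖e m‖) (ε := ε) (c := 6 * κ) (τ := τ)
      (fun m => norm_nonneg _) hε (by positivity) hτ (by linarith) (k := 1) (n := n + 1) (by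
        intro m h1 hm
        have h2 := norm_step_le hL hτ (heq m h1 (by omega))
        have h3 := hF m h1 (by omega)
        have p0 : ‖e (m - 1)‖ ≤ partialSups (fun m => ‖e m‖) m :=
          le_partialSups_of_le (fun m => ‖e m‖) (by omega)
        have p1 : ‖e m‖ ≤ partialSups (fun m => ‖e m‖) (m + 1) :=
          le_partialSups_of_le (fun m => ‖e m‖) (by omega)
        have p2 : ‖e (m + 1)‖ ≤ partialSups (fun m => ‖e m‖) (m + 1) :=
          le_partialSups_of_le (fun m => ‖e m‖) (by omega)
        have p3 : ‖e (m - 1)‖ ≤ partialSups (fun m => ‖e m‖) (m + 1) :=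
          le_partialSups_of_le (fun m => ‖e m‖) (by omega)
        calc ‖e (m + 1)‖ ≤ ‖e (m - 1)‖ + 2 * τ * ‖F m‖ := h2
          _ ≤ partialSups (fun m => ‖e m‖) m
              + 2 * τ * (κ * (partialSups (fun m => ‖e m‖) (m + 1)
                + partialSups (fun m => ‖e m‖) (m + 1)
                + partialSups (fun m => ‖e m‖) (m + 1) + 3 * ε)) := by
              gcongr
              refine h3.trans ?_
              gcongr
              linarith
          _ = _ := by ring)
    have hP1 : partialSups (fun m => ‖e m‖) 1 ≤ ε := by
      refine partialSups_le _ _ _ fun i hi => ?_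
      interval_cases i
      · simpa [he0] using hε
      · exact he1
    intro m hm
    rcases Nat.eq_zero_or_pos m with rfl | hm1
    · rw [he0, norm_zero]; positivity
    have h1 := hg m hm1 hm
    have h2 : ‖e m‖ ≤ partialSups (fun m => ‖e m‖) m := le_partialSups (fun m => ‖e m‖) m
    calc ‖e m‖ ≤ partialSups (fun m => ‖e m‖) m + ε := by linarith
      _ ≤ _ := h1
      _ ≤ (ε + ε) * X := by
          gcongr
          exact hexp m hm
      _ = A * ε := by rw [hA]; ring
  have hφ' : ∀ m, 1 ≤ m → m ≤ n → ‖F m‖ ≤ φ * ε := by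
    intro m h1 hm
    refine (hF m h1 hm).trans ?_
    have a1 := hA' m (by omega)
    have a2 := hA' (m + 1) (by omega)
    have a3 := hA' (m - 1) (by omega)
    rw [hφ, mul_assoc]
    gcongr
    linarith
  -- the graph norm
  set g : ℕ → ℝ := fun m => if m ≤ 1 then ‖L (e m)‖ else ‖L (e m) + F (m - 1)‖ with hg
  have hg0 : ∀ m, 0 ≤ g m := fun m => by
    simp only [hg]; split_ifs <;> exact norm_nonneg _
  have hgL : ∀ m, m ≤ n + 1 → ‖L (e m)‖ ≤ g m + φ * ε := by
    intro m hm
    by_cases h1 : m ≤ 1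
    · simp only [hg, if_pos h1]
      have : 0 ≤ φ * ε := by positivity
      linarith
    · simp only [hg, if_neg h1]
      have := hφ' (m - 1) (by omega) (by omega)
      have h2 : ‖L (e m)‖ ≤ ‖L (e m) + F (m - 1)‖ + ‖F (m - 1)‖ := by
        simpa using norm_sub_le (L (e m) + F (m - 1)) (F (m - 1))
      linarith
  have hstep : ∀ m, 1 ≤ m → m ≤ n → g (m + 1) ≤ ‖L (e (m - 1)) + F m‖ := by
    intro m h1 hm
    have : ¬ (m + 1 ≤ 1) := by omega
    simp only [hg, if_neg this, Nat.add_sub_cancel]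
    exact norm_map_add_le hL hτ (heq m h1 hm)
  have hdiff : ∀ m, 1 ≤ m → m ≤ n → ∀ k, m + 1 ≤ k →
      ‖e (m + 1) - e (m - 1)‖ ≤ τ * (2 * partialSups g k + 4 * (φ * ε)) := by
    intro m h1 hm k hk
    refine (norm_sub_le_of_step hτ (heq m h1 hm)).trans ?_
    have a1 := hgL (m + 1) (by omega)
    have a2 := hgL (m - 1) (by omega)
    have a3 := hφ' m h1 hm
    have b1 : g (m + 1) ≤ partialSups g k := le_partialSups_of_le g (by omega)
    have b2 : g (m - 1) ≤ partialSups g k := le_partialSups_of_le g (by omega)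
    refine mul_le_mul_of_nonneg_left ?_ hτ
    linarith
  have hgr := gronwall_partialSups (a := g) (ε := η * ε) (c := 6 * κ) (τ := τ)
    hg0 (by positivity) (by positivity) hτ (by linarith) (k := 3) (n := n + 1) (by
      intro m h3 hm
      have h1 := hstep m (by omega) (by omega)
      have h2 : ‖L (e (m - 1)) + F m‖ ≤ g (m - 1) + ‖F m - F (m - 2)‖ := by
        have : ¬ (m - 1 ≤ 1) := by omega
        simp only [hg, if_neg this]
        rw [show m - 1 - 1 = m - 2 by omega,
          show L (e (m - 1)) + F m = (L (e (m - 1)) + F (m - 2)) + (F m - F (m - 2)) by abel]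
        exact norm_add_le _ _
      have h4 := hFd m h3 (by omega)
      have d1 := hdiff (m - 1) (by omega) (by omega) (m + 1) (by omega)
      have d2 := hdiff m (by omega) (by omega) (m + 1) (by omega)
      have d3 := hdiff (m - 2) (by omega) (by omega) (m + 1) (by omega)
      rw [show m - 1 + 1 = m by omega, show m - 1 - 1 = m - 2 by omega] at d1
      rw [show m - 2 + 1 = m - 1 by omega, show m - 2 - 1 = m - 3 by omega] at d3
      have a1 := hA' m (by omega)
      have a2 := hA' (m + 1) (by omega)
      have a3 := hA' (m - 1) (by omega)
      have a4 := hA' (m - 2) (by omega)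
      have a5 := hA' (m - 3) (by omega)
      have b2 : g (m - 1) ≤ partialSups g m := le_partialSups_of_le g (by omega)
      have h5 : ‖F m - F (m - 2)‖
          ≤ κ * (3 * (τ * (2 * partialSups g (m + 1) + 4 * (φ * ε)))
            + τ * (5 * (A * ε) + ε)) := by
        refine h4.trans ?_
        have : τ * (‖e m‖ + ‖e (m + 1)‖ + ‖e (m - 1)‖ + ‖e (m - 2)‖ + ‖e (m - 3)‖ + ε)
            ≤ τ * (5 * (A * ε) + ε) := by
          gcongr
          linarith
        gcongr
        linarith
      have h6 : κ * (3 * (τ * (2 * partialSups g (m + 1) + 4 * (φ * ε))) + τ * (5 * (A * ε) + ε))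
          = 6 * κ * τ * partialSups g (m + 1) + κ * τ * (η * ε) := by rw [hη]; ring
      have h7 : 0 ≤ κ * τ * (η * ε) := by positivity
      linarith)
  have hP3 : ∀ m, m ≤ 3 → m ≤ n + 1 → g m ≤ (1 + φ) * ε := by
    intro m hm hmn
    have hφε : 0 ≤ φ * ε := by positivity
    interval_cases m
    · simp only [hg, he0, map_zero, norm_zero, Nat.zero_le, if_true]; positivity
    · simp only [hg, le_refl, if_true]; linarith
    · refine (hstep 1 le_rfl (by omega)).trans ?_
      simp only [Nat.sub_self, he0, map_zero, zero_add]
      linarith [hφ' 1 le_rfl (by omega)]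
    · refine (hstep 2 (by omega) (by omega)).trans ((norm_add_le _ _).trans ?_)
      have := hφ' 2 (by omega) (by omega)
      simp only [Nat.add_one_sub_one] at *
      linarith
  have hη' : 0 ≤ η * ε := by positivity
  intro m hm
  have hgm : g m ≤ (1 + φ + η) * X * ε := by
    have hle : (1 + φ) * ε ≤ (1 + φ + η) * X * ε := by
      have : 1 + φ ≤ (1 + φ + η) * X := by nlinarith
      gcongr
    by_cases h3 : m ≤ 3
    · exact (hP3 m h3 hm).trans hle
    · push Not at h3
      have h1 := hgr m h3.le hm
      have h2 : partialSups g 3 ≤ (1 + φ) * ε :=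
        partialSups_le _ _ _ fun i hi => hP3 i hi (by omega)
      have h4 : g m ≤ partialSups g m := le_partialSups g m
      calc g m ≤ partialSups g m + η * ε := by linarith
        _ ≤ _ := h1
        _ ≤ ((1 + φ) * ε + η * ε) * X := by
            gcongr
            exact hexp m hm
        _ = _ := by ring
  have h1 := hgL m hm
  have h2 := hA' m hm
  calc _ ≤ A * ε + ((1 + φ + η) * X * ε + φ * ε) := by linarith
    _ = _ := by ring

section

open scoped FourierTransform

/-! ### Fourier multipliers on the line -/

/-- Third order expansion of the quotient of the discrete by the continuous symbol. -/
lemma abs_sinc_rpow_sub_le {α y : ℝ} (hα : 1 < α) (hα2 : α ≤ 2) (hy : y ≠ 0) :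
    |(|Real.sin y| / |y|) ^ α - 1 + α * y ^ 2 / 6| ≤ 3 * |y| ^ 3 := by
  have hy0 : 0 < |y| := abs_pos.2 hy
  have hr0 : 0 ≤ |Real.sin y| / |y| := by positivity
  have hr1 : |Real.sin y| / |y| ≤ 1 := by
    rw [div_le_one hy0]; exact Real.abs_sin_le_abs
  have hsq : y ^ 2 = |y| ^ 2 := (sq_abs y).symm
  rw [hsq]
  set u := |y| with hu
  rcases le_or_gt 1 u with h1 | h1
  · have ha : 0 ≤ (|Real.sin y| / u) ^ α := by positivity
    have hb : (|Real.sin y| / u) ^ α ≤ 1 := Real.rpow_le_one hr0 hr1 (by linarith)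
    have hc : u ^ 2 ≤ u ^ 3 := pow_le_pow_right₀ h1 (by norm_num)
    have hd : 1 ≤ u ^ 2 := one_le_pow₀ h1
    rw [abs_le]
    constructor <;> nlinarith
  · have hs : |Real.sin y| = Real.sin u := by
      rw [hu, Real.abs_sin_eq_sin_abs_of_abs_le_pi (by linarith [pi_gt_three])]
    have hb := Real.sin_bound (x := u) (by rw [abs_of_pos hy0]; exact h1.le)
    rw [abs_of_pos hy0] at hb
    rw [hs] at hr0 hr1 ⊢
    set z := 1 - Real.sin u / u with hz
    have hrz : Real.sin u / u = 1 - z := by rw [hz]; ring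
    have hz0 : 0 ≤ z := by linarith
    have hz1 : z ≤ 1 := by linarith
    have hzb : |z - u ^ 2 / 6| ≤ u ^ 3 * (5 / 96) := by
      have e : z - u ^ 2 / 6 = -(Real.sin u - (u - u ^ 3 / 6)) / u := by
        rw [hz]; field_simp; ring
      rw [e, abs_div, abs_neg, abs_of_pos hy0, div_le_iff₀ hy0]
      have h5 : u ^ 5 ≤ u ^ 4 := pow_le_pow_of_le_one hy0.le h1.le (by norm_num)
      have h40 : 0 ≤ u ^ 4 := by positivity
      calc _ ≤ u ^ 5 / 100 := hb
        _ ≤ u ^ 4 * (5 / 96) := by linarith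
        _ = _ := by ring
    rw [hrz]
    have lower : 1 - α * z ≤ (1 - z) ^ α := by
      have := one_add_mul_self_le_rpow_one_add (s := -z) (by linarith) hα.le
      simpa [sub_eq_add_neg] using this
    have upper : (1 - z) ^ α ≤ 1 - α * z + z ^ 2 := by
      have h := rpow_one_add_le_one_add_mul_self (s := -z) (by linarith) (p := α - 1)
        (by linarith) (by linarith)
      have e : (1 - z) ^ α = (1 - z) * (1 - z) ^ (α - 1) := by
        have := Real.rpow_add_one' (x := 1 - z) (y := α - 1) (by linarith) (by linarith)
        rw [sub_add_cancel] at this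
        rw [this, mul_comm]
      have h' : (1 - z) ^ (α - 1) ≤ 1 + (α - 1) * -z := by simpa [sub_eq_add_neg] using h
      rw [e]
      have := mul_le_mul_of_nonneg_left h' (show 0 ≤ 1 - z by linarith)
      nlinarith
    have hu3 : u ^ 4 ≤ u ^ 3 := pow_le_pow_of_le_one hy0.le h1.le (by norm_num)
    have hu32 : u ^ 3 ≤ u ^ 2 := pow_le_pow_of_le_one hy0.le h1.le (by norm_num)
    obtain ⟨hz2, hz3⟩ := abs_le.1 hzb
    have hzle : z ≤ u ^ 2 := by nlinarith [sq_nonneg u]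
    have hzsq : z ^ 2 ≤ u ^ 3 := by
      calc z ^ 2 ≤ (u ^ 2) ^ 2 := by gcongr
        _ = u ^ 4 := by ring
        _ ≤ u ^ 3 := hu3
    have hu30 : 0 ≤ u ^ 3 := by positivity
    rw [abs_le]
    constructor <;> nlinarith

/-- The symbols of the discrete and of the continuous operator agree up to second order; the term
with `α / 24` becomes the leading term of the truncation error. -/
lemma abs_symbol_sub_le {α : ℝ} (hα : 1 < α) (hα2 : α ≤ 2) {h : ℝ} (hh : 0 < h) (ξ : ℝ) :
    |1 / h ^ α * symbol α (h * ξ) - |2 * π * ξ| ^ α + α / 24 * h ^ 2 * (|2 * π * ξ| ^ α * |2 * π * ξ| ^ 2)|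
      ≤ h ^ 3 * (|2 * π * ξ| ^ α * |2 * π * ξ| ^ 3) := by
  rcases eq_or_ne ξ 0 with rfl | hξ
  · simp [symbol, Real.zero_rpow (by linarith : α ≠ 0)]
  set y := π * (h * ξ) with hy
  have hy0 : y ≠ 0 := by positivity
  have key := abs_sinc_rpow_sub_le hα hα2 hy0
  have hya : |y| = h / 2 * |2 * π * ξ| := by
    rw [hy, abs_mul, abs_mul, abs_mul, abs_mul, abs_of_pos hh, abs_of_pos pi_pos, abs_two]
    ring
  set w := |2 * π * ξ| with hw
  have hw0 : 0 < w := by positivity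
  have e1 : 1 / h ^ α * symbol α (h * ξ) = w ^ α * (|Real.sin y| / |y|) ^ α := by
    rw [symbol, ← hy, abs_mul, abs_two, one_div, inv_mul_eq_div,
      ← Real.div_rpow (by positivity) hh.le, ← Real.mul_rpow hw0.le (by positivity), hya]
    congr 1
    field_simp
  have e2 : 1 / h ^ α * symbol α (h * ξ) - w ^ α + α / 24 * h ^ 2 * (w ^ α * w ^ 2)
      = w ^ α * ((|Real.sin y| / |y|) ^ α - 1 + α * y ^ 2 / 6) := by
    rw [e1, ← sq_abs y, hya]; ring
  rw [e2, abs_mul, abs_of_nonneg (by positivity : 0 ≤ w ^ α)]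
  calc w ^ α * _ ≤ w ^ α * (3 * |y| ^ 3) := by gcongr
    _ = 3 / 8 * (h ^ 3 * (w ^ α * w ^ 3)) := by rw [hya]; ring
    _ ≤ _ := by nlinarith [show 0 ≤ h ^ 3 * (w ^ α * w ^ 3) by positivity]

lemma symbol_le {α : ℝ} (hα : 1 < α) {h : ℝ} (hh : 0 < h) (ξ : ℝ) :
    1 / h ^ α * symbol α (h * ξ) ≤ |2 * π * ξ| ^ α := by
  rw [symbol, one_div, inv_mul_eq_div, ← Real.div_rpow (by positivity) hh.le]
  gcongr
  rw [div_le_iff₀ hh, abs_mul, abs_two]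
  calc 2 * |Real.sin (π * (h * ξ))| ≤ 2 * |π * (h * ξ)| :=
        mul_le_mul_of_nonneg_left Real.abs_sin_le_abs (by norm_num)
    _ = _ := by rw [abs_mul, abs_mul, abs_mul, abs_mul, abs_of_pos hh, abs_two]; ring

/-- `F 0` is a function on the line that vanishes outside `(a, b)`; the functions `F 1, …, F 8`
are its successive derivatives, and all are bounded by `B`. -/
structure LineChain (a b B : ℝ) (F : ℕ → ℝ → ℂ) : Prop where
  deriv : ∀ i < 8, ∀ x, HasDerivAt (F i) (F (i + 1) x) x
  bound : ∀ i ≤ 8, ∀ x, ‖F i x‖ ≤ B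
  zero : ∀ i ≤ 8, ∀ x, x ∉ Ioo a b → F i x = 0

namespace LineChain

variable {a b B : ℝ} {F : ℕ → ℝ → ℂ}

lemma continuous (hF : LineChain a b B F) {i : ℕ} (hi : i < 8) : Continuous (F i) :=
  continuous_iff_continuousAt.2 fun x => (hF.deriv i hi x).continuousAt

lemma hasCompactSupport (hF : LineChain a b B F) {i : ℕ} (hi : i ≤ 8) :
    HasCompactSupport (F i) :=
  HasCompactSupport.intro (isCompact_Icc (a := a) (b := b)) fun x hx =>
    hF.zero i hi x fun h => hx (Ioo_subset_Icc_self h)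

lemma integrable (hF : LineChain a b B F) {i : ℕ} (hi : i < 8) : Integrable (F i) :=
  (hF.continuous hi).integrable_of_hasCompactSupport (hF.hasCompactSupport hi.le)

lemma bound_nonneg (hF : LineChain a b B F) : 0 ≤ B :=
  (norm_nonneg _).trans (hF.bound 0 (by norm_num) 0)

lemma integral_norm_le (hF : LineChain a b B F) (hab : a < b) {i : ℕ} (hi : i < 8) :
    ∫ x, ‖F i x‖ ≤ (b - a) * B := by
  have h0 : ∀ x, x ∉ Icc a b → ‖F i x‖ = 0 := fun x hx => by
    rw [hF.zero i hi.le x fun h => hx (Ioo_subset_Icc_self h), norm_zero]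
  rw [← setIntegral_eq_integral_of_forall_compl_eq_zero h0]
  have := norm_setIntegral_le_of_norm_le_const (μ := volume) (s := Icc a b) (C := B)
    (f := fun x => ‖F i x‖) (by simp) (fun x _ => by simpa using hF.bound i hi.le x)
  rw [Measure.real, Real.volume_Icc, ENNReal.toReal_ofReal (by linarith)] at this
  calc _ ≤ ‖∫ x in Icc a b, ‖F i x‖‖ := le_norm_self _
    _ ≤ _ := this
    _ = _ := by ring

lemma fourier_eq_pow (hF : LineChain a b B F) {i : ℕ} (hi : i < 8) (ξ : ℝ) :
    𝓕 (F i) ξ = (2 * π * Complex.I * ξ) ^ i * 𝓕 (F 0) ξ := by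
  induction i with
  | zero => simp
  | succ i ih =>
    have hd : _root_.deriv (F i) = F (i + 1) := funext fun x => (hF.deriv i (by omega) x).deriv
    have := Real.fourier_deriv (hF.integrable (i := i) (by omega))
      (fun x => (hF.deriv i (by omega) x).differentiableAt) (by rw [hd]; exact hF.integrable hi)
    rw [hd] at this
    rw [this]
    simp only [smul_eq_mul]
    rw [ih (by omega)]
    ring

lemma norm_fourier_le (hF : LineChain a b B F) (hab : a < b) {i : ℕ} (hi : i < 8) (ξ : ℝ) :
    ‖𝓕 (F i) ξ‖ ≤ (b - a) * B := by
  refine le_trans ?_ (hF.integral_norm_le hab hi)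
  exact VectorFourier.norm_fourierIntegral_le_integral_norm 𝐞 volume _ (F i) ξ

/-- Decay of the Fourier transform, weighted with a power of the frequency. -/
lemma rpow_mul_norm_fourier_le (hF : LineChain a b B F) (hab : a < b) {q : ℝ} (hq0 : 0 ≤ q)
    (hq5 : q ≤ 5) (ξ : ℝ) :
    |2 * π * ξ| ^ q * ‖𝓕 (F 0) ξ‖ ≤ 2 * ((b - a) * B) * (1 + ξ ^ 2)⁻¹ := by
  have hB := hF.bound_nonneg
  set w := |2 * π * ξ| with hw
  have hw0 : 0 ≤ w := abs_nonneg _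
  have h0 := hF.norm_fourier_le hab (i := 0) (by norm_num) ξ
  have h7 := hF.norm_fourier_le hab (i := 7) (by norm_num) ξ
  rw [hF.fourier_eq_pow (by norm_num), norm_mul, norm_pow] at h7
  have hnw : ‖(2 * π * Complex.I * ξ : ℂ)‖ = w := by
    simp [hw, abs_mul]
  rw [hnw] at h7
  have hK : 0 ≤ (b - a) * B := mul_nonneg (by linarith) hB
  have hξw : ξ ^ 2 ≤ w ^ 2 := by
    rw [hw, sq_abs]
    nlinarith [sq_nonneg ξ, pi_gt_three, mul_nonneg (sq_nonneg ξ) (by nlinarith [pi_gt_three] : 0 ≤ 4 * π ^ 2 - 1)]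
  rw [← div_eq_mul_inv, le_div_iff₀ (by positivity)]
  rcases le_total w 1 with h1 | h1
  · have : w ^ q ≤ 1 := Real.rpow_le_one hw0 h1 hq0
    have hw2 : w ^ 2 ≤ 1 := pow_le_one₀ hw0 h1
    calc w ^ q * ‖𝓕 (F 0) ξ‖ * (1 + ξ ^ 2) ≤ 1 * ((b - a) * B) * (1 + 1) := by
          gcongr
          linarith
      _ = _ := by ring
  · have : w ^ q ≤ w ^ 5 := by
      calc w ^ q ≤ w ^ (5 : ℝ) := Real.rpow_le_rpow_of_exponent_le h1 hq5
        _ = w ^ 5 := by norm_cast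
    have hw2 : 1 ≤ w ^ 2 := one_le_pow₀ h1
    calc w ^ q * ‖𝓕 (F 0) ξ‖ * (1 + ξ ^ 2) ≤ w ^ 5 * ‖𝓕 (F 0) ξ‖ * (w ^ 2 + w ^ 2) := by
          gcongr
      _ = 2 * (w ^ 7 * ‖𝓕 (F 0) ξ‖) := by ring
      _ ≤ _ := by gcongr

lemma continuous_fourier (hF : LineChain a b B F) : Continuous (𝓕 (F 0)) :=
  VectorFourier.fourierIntegral_continuous Real.continuous_fourierChar
    (by exact continuous_inner) (hF.integrable (by norm_num))

/-- A multiplier of order at most five can be applied to the Fourier transform. -/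
lemma integrable_mul (hF : LineChain a b B F) (hab : a < b) {q A : ℝ} (hq0 : 0 ≤ q)
    (hq5 : q ≤ 5) {m : ℝ → ℂ} (hm : AEStronglyMeasurable m)
    (hmb : ∀ ξ, ‖m ξ‖ ≤ A * |2 * π * ξ| ^ q) : Integrable (fun ξ => m ξ * 𝓕 (F 0) ξ) := by
  have hA : 0 ≤ A := by
    have h := (norm_nonneg _).trans (hmb (1 / (2 * π)))
    have e : 2 * π * (1 / (2 * π)) = 1 := by field_simp
    rw [e, abs_one, Real.one_rpow, mul_one] at h
    exact h
  refine Integrable.mono' ((integrable_inv_one_add_sq).const_mul (A * (2 * ((b - a) * B))))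
    (hm.mul hF.continuous_fourier.aestronglyMeasurable) (Eventually.of_forall fun ξ => ?_)
  rw [norm_mul]
  calc ‖m ξ‖ * ‖𝓕 (F 0) ξ‖ ≤ A * |2 * π * ξ| ^ q * ‖𝓕 (F 0) ξ‖ := by gcongr; exact hmb ξ
    _ = A * (|2 * π * ξ| ^ q * ‖𝓕 (F 0) ξ‖) := by ring
    _ ≤ A * (2 * ((b - a) * B) * (1 + ξ ^ 2)⁻¹) :=
        mul_le_mul_of_nonneg_left (hF.rpow_mul_norm_fourier_le hab hq0 hq5 ξ) hA
    _ = _ := by ring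

lemma norm_integral_mul_le (hF : LineChain a b B F) (hab : a < b) {q A : ℝ} (hq0 : 0 ≤ q)
    (hq5 : q ≤ 5) (hA : 0 ≤ A) {m : ℝ → ℂ} (hmb : ∀ ξ, ‖m ξ‖ ≤ A * |2 * π * ξ| ^ q) :
    ‖∫ ξ, m ξ * 𝓕 (F 0) ξ‖ ≤ A * (2 * π * (b - a) * B) := by
  have := norm_integral_le_of_norm_le (f := fun ξ => m ξ * 𝓕 (F 0) ξ)
    ((integrable_inv_one_add_sq).const_mul (A * (2 * ((b - a) * B))))
    (Eventually.of_forall fun ξ => by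
      rw [norm_mul]
      calc ‖m ξ‖ * ‖𝓕 (F 0) ξ‖ ≤ A * |2 * π * ξ| ^ q * ‖𝓕 (F 0) ξ‖ := by gcongr; exact hmb ξ
        _ = A * (|2 * π * ξ| ^ q * ‖𝓕 (F 0) ξ‖) := by ring
        _ ≤ A * (2 * ((b - a) * B) * (1 + ξ ^ 2)⁻¹) :=
            mul_le_mul_of_nonneg_left (hF.rpow_mul_norm_fourier_le hab hq0 hq5 ξ) hA
        _ = A * (2 * ((b - a) * B)) * (1 + ξ ^ 2)⁻¹ := by ring)
  refine this.trans (le_of_eq ?_)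
  rw [integral_const_mul, integral_univ_inv_one_add_sq]
  ring

lemma integrable_fourier (hF : LineChain a b B F) (hab : a < b) : Integrable (𝓕 (F 0)) := by
  have := hF.integrable_mul hab (q := 0) (A := 1) le_rfl (by norm_num) (m := fun _ => 1)
    aestronglyMeasurable_const (fun ξ => by simp)
  simpa using this

/-- Fourier inversion. -/
lemma eq_integral_fourier (hF : LineChain a b B F) (hab : a < b) (x : ℝ) :
    F 0 x = ∫ ξ : ℝ, Complex.exp (2 * π * Complex.I * ξ * x) * 𝓕 (F 0) ξ := by
  have h := congrFun (Continuous.fourierInv_fourier_eq (hF.continuous (i := 0) (by norm_num))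
    (hF.integrable (by norm_num)) (hF.integrable_fourier hab)) x
  rw [← h, Real.fourierInv_eq']
  congr 1; ext ξ
  rw [smul_eq_mul]
  congr 2
  simp only [RCLike.inner_apply, conj_trivial]
  push_cast
  ring

end LineChain

lemma norm_exp_two_pi_mul (ξ x : ℝ) : ‖Complex.exp (2 * π * Complex.I * ξ * x)‖ = 1 := by
  rw [show (2 * π * Complex.I * ξ * x : ℂ) = ((2 * π * ξ * x : ℝ) : ℂ) * Complex.I by
    push_cast; ring, Complex.norm_exp_ofReal_mul_I]

/-- The `p`-th derivative of the image of `f` under the multiplier `|2 π ξ| ^ α`. -/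
noncomputable def multiplier (α : ℝ) (p : ℕ) (f : ℝ → ℂ) (x : ℝ) : ℂ :=
  ∫ ξ : ℝ, (((|2 * π * ξ| ^ α : ℝ) : ℂ) * (2 * π * Complex.I * ξ) ^ p
    * Complex.exp (2 * π * Complex.I * ξ * x)) * 𝓕 f ξ

namespace LineChain

variable {a b B : ℝ} {F : ℕ → ℝ → ℂ}

lemma norm_multiplier_kernel {α : ℝ} (hα : 1 < α) (p : ℕ) (x ξ : ℝ) :
    ‖((|2 * π * ξ| ^ α : ℝ) : ℂ) * (2 * π * Complex.I * ξ) ^ p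
      * Complex.exp (2 * π * Complex.I * ξ * x)‖ = 1 * |2 * π * ξ| ^ (α + p) := by
  rw [norm_mul, norm_mul, norm_exp_two_pi_mul, norm_pow, Complex.norm_real,
    Real.norm_of_nonneg (by positivity), mul_one, one_mul,
    Real.rpow_add_natCast' (abs_nonneg _) (by positivity)]
  congr 2
  simp [abs_mul]

lemma continuous_multiplier_kernel {α : ℝ} (hα : 1 < α) (p : ℕ) (x : ℝ) :
    Continuous fun ξ : ℝ => ((|2 * π * ξ| ^ α : ℝ) : ℂ) * (2 * π * Complex.I * ξ) ^ p
      * Complex.exp (2 * π * Complex.I * ξ * x) := by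
  have : Continuous fun ξ : ℝ => |2 * π * ξ| ^ α :=
    Continuous.rpow_const (by fun_prop) fun _ => Or.inr (by linarith)
  fun_prop

lemma integrable_multiplier (hF : LineChain a b B F) (hab : a < b) {α : ℝ} (hα : 1 < α)
    (hα2 : α ≤ 2) {p : ℕ} (hp : p ≤ 3) (x : ℝ) :
    Integrable fun ξ : ℝ => (((|2 * π * ξ| ^ α : ℝ) : ℂ) * (2 * π * Complex.I * ξ) ^ p
      * Complex.exp (2 * π * Complex.I * ξ * x)) * 𝓕 (F 0) ξ := by
  have hp' : (p : ℝ) ≤ 3 := by exact_mod_cast hp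
  exact hF.integrable_mul hab (q := α + p) (by positivity) (by linarith)
    (continuous_multiplier_kernel hα p x).aestronglyMeasurable
    (fun ξ => (norm_multiplier_kernel hα p x ξ).le)

lemma norm_multiplier_le (hF : LineChain a b B F) (hab : a < b) {α : ℝ} (hα : 1 < α)
    (hα2 : α ≤ 2) {p : ℕ} (hp : p ≤ 3) (x : ℝ) :
    ‖multiplier α p (F 0) x‖ ≤ 2 * π * (b - a) * B := by
  have hp' : (p : ℝ) ≤ 3 := by exact_mod_cast hp
  have := hF.norm_integral_mul_le hab (q := α + p) (by positivity) (by linarith) zero_le_one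
    (fun ξ => (norm_multiplier_kernel hα p x ξ).le)
  simpa [multiplier] using this

lemma hasDerivAt_multiplier (hF : LineChain a b B F) (hab : a < b) {α : ℝ} (hα : 1 < α)
    (hα2 : α ≤ 2) {p : ℕ} (hp : p < 3) (x : ℝ) :
    HasDerivAt (multiplier α p (F 0)) (multiplier α (p + 1) (F 0) x) x := by
  have hb := (hF.integrable_multiplier hab hα hα2 (p := p + 1) (by omega) 0).norm
  have h := hasDerivAt_integral_of_dominated_loc_of_deriv_le (μ := volume) (𝕜 := ℝ) (s := univ)
    (x₀ := x)
    (F := fun (x ξ : ℝ) => (((|2 * π * ξ| ^ α : ℝ) : ℂ) * (2 * π * Complex.I * ξ) ^ p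
      * Complex.exp (2 * π * Complex.I * ξ * x)) * 𝓕 (F 0) ξ)
    (F' := fun (x ξ : ℝ) => (((|2 * π * ξ| ^ α : ℝ) : ℂ) * (2 * π * Complex.I * ξ) ^ (p + 1)
      * Complex.exp (2 * π * Complex.I * ξ * x)) * 𝓕 (F 0) ξ)
    univ_mem
    (Eventually.of_forall fun y => (hF.integrable_multiplier hab hα hα2 hp.le y).1)
    (hF.integrable_multiplier hab hα hα2 hp.le x)
    (hF.integrable_multiplier hab hα hα2 (by omega) x).1
    (Eventually.of_forall fun ξ y _ => by
      simp only [norm_mul _ (𝓕 (F 0) ξ)]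
      rw [norm_multiplier_kernel hα, norm_multiplier_kernel hα])
    hb
    (Eventually.of_forall fun ξ y _ => by
      have h1 : HasDerivAt (fun y : ℝ => (2 * π * Complex.I * ξ * y : ℂ))
          (2 * π * Complex.I * ξ) y := by
        simpa using (Complex.ofRealCLM.hasDerivAt (x := y)).const_mul (2 * π * Complex.I * ξ : ℂ)
      have h2 := (h1.cexp.const_mul (((|2 * π * ξ| ^ α : ℝ) : ℂ)
        * (2 * π * Complex.I * ξ) ^ p)).mul_const (𝓕 (F 0) ξ)
      refine h2.congr_deriv ?_
      ring)
  exact h.2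

end LineChain

/-- The one-dimensional fractional centred difference of a grid function. -/
noncomputable def diff1 (α h : ℝ) (M : ℕ) (v : ℕ → ℂ) (j : ℕ) : ℂ :=
  -(((1 / h ^ α : ℝ) : ℂ) * ∑ s ∈ Finset.Ioo 0 M, ((coeff α ((j : ℤ) - (s : ℤ)) : ℝ) : ℂ) * v s)

lemma grid_mem_Ioo {a b h : ℝ} {M : ℕ} (hM : 0 < M) (hab : a < b) (hh : h = (b - a) / M) {j : ℕ}
    (hj : j ∈ Finset.Ioo 0 M) : a + j * h ∈ Ioo a b := by
  rw [Finset.mem_Ioo] at hj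
  have hM' : (0 : ℝ) < M := by exact_mod_cast hM
  have hh0 : 0 < h := by rw [hh]; apply div_pos <;> linarith
  have hb : b = a + M * h := by rw [hh]; field_simp; ring
  have h1 : (0 : ℝ) < j := by exact_mod_cast hj.1
  have h2 : (j : ℝ) < M := by exact_mod_cast hj.2
  constructor
  · nlinarith
  · rw [hb]; nlinarith

/-- The difference operator as a Fourier multiplier. The finite sum is a sum over all integers,
since the function vanishes off the interval. -/
lemma LineChain.diff1_eq {a b B : ℝ} {F : ℕ → ℝ → ℂ} (hF : LineChain a b B F) (hab : a < b)
    {α : ℝ} (hα : 1 < α) (hα2 : α ≤ 2) {h : ℝ} {M : ℕ} (hM : 0 < M) (hh : h = (b - a) / M)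
    (j : ℕ) :
    diff1 α h M (fun s => F 0 (a + s * h)) j
      = -∫ ξ : ℝ, (((1 / h ^ α * symbol α (h * ξ) : ℝ) : ℂ)
          * Complex.exp (2 * π * Complex.I * ξ * ((a + j * h : ℝ) : ℂ))) * 𝓕 (F 0) ξ := by
  have hM' : (0 : ℝ) < M := by exact_mod_cast hM
  have hh0 : 0 < h := by rw [hh]; apply div_pos <;> linarith
  have hb : b = a + M * h := by rw [hh]; field_simp; ring
  set x : ℝ := a + j * h with hx
  -- the full series
  have hterm : ∀ m : ℤ, ∫ ξ : ℝ, (((coeff α m : ℝ) : ℂ)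
      * Complex.exp (2 * π * Complex.I * ξ * ((x - m * h : ℝ) : ℂ))) * 𝓕 (F 0) ξ
      = ((coeff α m : ℝ) : ℂ) * F 0 (x - m * h) := by
    intro m
    rw [hF.eq_integral_fourier hab, ← integral_const_mul]
    simp only [mul_assoc]
  have hnorm : ∀ (m : ℤ) (ξ : ℝ), ‖(((coeff α m : ℝ) : ℂ)
      * Complex.exp (2 * π * Complex.I * ξ * ((x - m * h : ℝ) : ℂ))) * 𝓕 (F 0) ξ‖
      = ‖coeff α m‖ * ‖𝓕 (F 0) ξ‖ := by
    intro m ξ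
    rw [norm_mul, norm_mul, norm_exp_two_pi_mul, Complex.norm_real, mul_one]
  have hint : ∀ m : ℤ, Integrable fun ξ : ℝ => (((coeff α m : ℝ) : ℂ)
      * Complex.exp (2 * π * Complex.I * ξ * ((x - m * h : ℝ) : ℂ))) * 𝓕 (F 0) ξ := by
    intro m
    refine ((hF.integrable_fourier hab).norm.const_mul ‖coeff α m‖).mono' ?_
      (Eventually.of_forall fun ξ => (hnorm m ξ).le)
    exact (Continuous.mul (by fun_prop) hF.continuous_fourier).aestronglyMeasurable
  have hs := hasSum_integral_of_summable_integral_norm hint (by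
    simp only [hnorm, integral_const_mul]
    exact (summable_coeff hα hα2).norm.mul_right _)
  simp only [hterm] at hs
  have htsum : ∀ ξ : ℝ, ∑' m : ℤ, (((coeff α m : ℝ) : ℂ)
      * Complex.exp (2 * π * Complex.I * ξ * ((x - m * h : ℝ) : ℂ))) * 𝓕 (F 0) ξ
      = (((symbol α (h * ξ) : ℝ) : ℂ) * Complex.exp (2 * π * Complex.I * ξ * (x : ℂ)))
        * 𝓕 (F 0) ξ := by
    intro ξ
    have h1 := ((hasSum_symbol hα hα2 (h * ξ)).mul_right
      (Complex.exp (2 * π * Complex.I * ξ * (x : ℂ)))).mul_right (𝓕 (F 0) ξ)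
    rw [← h1.tsum_eq]
    congr 1; ext m
    rw [mul_assoc ((coeff α m : ℝ) : ℂ) (Complex.exp _) (Complex.exp _), ← Complex.exp_add]
    congr 3
    push_cast; ring
  simp only [htsum] at hs
  -- only finitely many terms survive
  have hfin : HasSum (fun m : ℤ => ((coeff α m : ℝ) : ℂ) * F 0 (x - m * h))
      (∑ s ∈ Finset.Ioo 0 M, ((coeff α ((j : ℤ) - (s : ℤ)) : ℝ) : ℂ) * F 0 (a + s * h)) := by
    have e : ∑ s ∈ Finset.Ioo 0 M, ((coeff α ((j : ℤ) - (s : ℤ)) : ℝ) : ℂ) * F 0 (a + s * h)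
        = ∑ m ∈ (Finset.Ioo 0 M).image (fun s : ℕ => (j : ℤ) - (s : ℤ)),
          ((coeff α m : ℝ) : ℂ) * F 0 (x - m * h) := by
      rw [Finset.sum_image (fun s _ s' _ hss => by simpa using hss)]
      refine Finset.sum_congr rfl fun s _ => ?_
      congr 2
      rw [hx]; push_cast; ring
    rw [e]
    refine hasSum_sum_of_ne_finset_zero fun m hm => ?_
    rw [hF.zero 0 (by norm_num), mul_zero]
    intro hmem
    apply hm
    rw [Finset.mem_image]
    have h1 : 0 < ((j : ℝ) - m) * h := by have := hmem.1; rw [hx] at this; linarith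
    have h2 : ((j : ℝ) - m) * h < M * h := by have := hmem.2; rw [hx, hb] at this; linarith
    have h1' : (0 : ℝ) < (j : ℝ) - m := (mul_pos_iff_of_pos_right hh0).1 h1
    have h2' : (j : ℝ) - m < M := lt_of_mul_lt_mul_right h2 hh0.le
    have h3 : 0 < (j : ℤ) - m := by exact_mod_cast h1'
    have h4 : (j : ℤ) - m < M := by exact_mod_cast h2'
    refine ⟨((j : ℤ) - m).toNat, ?_, ?_⟩
    · rw [Finset.mem_Ioo]; omega
    · rw [Int.toNat_of_nonneg h3.le]; ring
  have hfinal := hfin.unique hs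
  rw [diff1, hfinal, ← integral_const_mul]
  congr 2; ext ξ
  push_cast
  ring

/-- Third order consistency expansion of the difference operator. -/
lemma LineChain.norm_diff1_sub_le {a b B : ℝ} {F : ℕ → ℝ → ℂ} (hF : LineChain a b B F)
    (hab : a < b) {α : ℝ} (hα : 1 < α) (hα2 : α ≤ 2) {h : ℝ} {M : ℕ} (hM : 0 < M)
    (hh : h = (b - a) / M) (j : ℕ) :
    ‖diff1 α h M (fun s => F 0 (a + s * h)) j - -multiplier α 0 (F 0) (a + j * h)
        - ((α / 24 * h ^ 2 : ℝ) : ℂ) * -multiplier α 2 (F 0) (a + j * h)‖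
      ≤ h ^ 3 * (2 * π * (b - a) * B) := by
  have hM' : (0 : ℝ) < M := by exact_mod_cast hM
  have hh0 : 0 < h := by rw [hh]; apply div_pos <;> linarith
  set x : ℝ := a + j * h with hx
  set m : ℝ → ℂ := fun ξ => ((-(1 / h ^ α * symbol α (h * ξ) - |2 * π * ξ| ^ α
    + α / 24 * h ^ 2 * (|2 * π * ξ| ^ α * |2 * π * ξ| ^ 2)) : ℝ) : ℂ)
    * Complex.exp (2 * π * Complex.I * ξ * (x : ℂ)) with hm
  have hmb : ∀ ξ, ‖m ξ‖ ≤ h ^ 3 * |2 * π * ξ| ^ (α + (3 : ℕ)) := by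
    intro ξ
    rw [hm, norm_mul, norm_exp_two_pi_mul, mul_one, Complex.norm_real, norm_neg, Real.norm_eq_abs,
      Real.rpow_add_natCast' (abs_nonneg _) (by positivity)]
    exact abs_symbol_sub_le hα hα2 hh0 ξ
  have hle := hF.norm_integral_mul_le hab (q := α + (3 : ℕ)) (by positivity)
    (by push_cast; linarith) (by positivity) hmb
  refine le_trans (le_of_eq ?_) hle
  congr 1
  have i0 := hF.integrable_multiplier hab hα hα2 (p := 0) (by norm_num) x
  have i2 := (hF.integrable_multiplier hab hα hα2 (p := 2) (by norm_num) x).const_mul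
    ((α / 24 * h ^ 2 : ℝ) : ℂ)
  have hsc := continuous_symbol (α := α) (by linarith)
  have i1 : Integrable fun ξ : ℝ => (((1 / h ^ α * symbol α (h * ξ) : ℝ) : ℂ)
      * Complex.exp (2 * π * Complex.I * ξ * (x : ℂ))) * 𝓕 (F 0) ξ := by
    refine hF.integrable_mul hab (q := α) (A := 1) (by linarith) (by linarith)
      (Continuous.aestronglyMeasurable (by fun_prop)) fun ξ => ?_
    rw [norm_mul, norm_exp_two_pi_mul, mul_one, one_mul, Complex.norm_real, Real.norm_of_nonneg
      (mul_nonneg (by positivity) (symbol_nonneg _ _))]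
    exact symbol_le hα hh0 ξ
  have hsq : ∀ ξ : ℝ, (2 * π * Complex.I * ξ : ℂ) ^ 2 = -((|2 * π * ξ| ^ 2 : ℝ) : ℂ) := by
    intro ξ
    rw [sq_abs]; push_cast
    calc (2 * π * Complex.I * ξ : ℂ) ^ 2 = (2 * π * ξ) ^ 2 * Complex.I ^ 2 := by ring
      _ = _ := by rw [Complex.I_sq]; ring
  have hsplit : ∀ ξ : ℝ, m ξ * 𝓕 (F 0) ξ = (-((((1 / h ^ α * symbol α (h * ξ) : ℝ) : ℂ)
      * Complex.exp (2 * π * Complex.I * ξ * (x : ℂ))) * 𝓕 (F 0) ξ)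
      + (((|2 * π * ξ| ^ α : ℝ) : ℂ) * (2 * π * Complex.I * ξ) ^ 0
        * Complex.exp (2 * π * Complex.I * ξ * x)) * 𝓕 (F 0) ξ)
      + ((α / 24 * h ^ 2 : ℝ) : ℂ) * ((((|2 * π * ξ| ^ α : ℝ) : ℂ) * (2 * π * Complex.I * ξ) ^ 2
        * Complex.exp (2 * π * Complex.I * ξ * x)) * 𝓕 (F 0) ξ) := by
    intro ξ
    simp only [hm, hsq]
    push_cast
    ring
  simp only [hsplit]
  have s1 := integral_add (i1.neg.add i0) i2
  have s2 := integral_add i1.neg i0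
  simp only [Pi.add_apply, Pi.neg_apply] at s1 s2
  rw [hF.diff1_eq hab hα hα2 hM hh j, ← hx, s1, s2, integral_neg, integral_const_mul]
  unfold multiplier
  ring

end

section

open scoped FourierTransform

/-! ### The Riesz derivative as a Fourier multiplier -/

lemma integrableOn_rpow_mul_exp_neg {s ε : ℝ} (hs : -1 < s) (hε : 0 < ε) :
    IntegrableOn (fun t : ℝ => t ^ s * Real.exp (-ε * t)) (Ioi 0) := by
  have := integrableOn_rpow_mul_exp_neg_mul_rpow (p := 1) hs one_pos hε
  simpa using this

lemma norm_cexp_neg_mul (r : ℂ) (t : ℝ) : ‖Complex.exp (-(r * t))‖ = Real.exp (-r.re * t) := by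
  rw [Complex.norm_exp]; simp

/-- The Gamma integral with a complex parameter in the right half plane, by analytic
continuation from the positive reals. -/
lemma integral_rpow_mul_cexp {s : ℝ} (hs : 0 < s) {r : ℂ} (hr : 0 < r.re) :
    ∫ t in Ioi (0 : ℝ), ((t ^ (s - 1) : ℝ) : ℂ) * Complex.exp (-(r * t))
      = ((Real.Gamma s : ℝ) : ℂ) * r ^ (-(s : ℂ)) := by
  set U : Set ℂ := {z | 0 < z.re} with hU
  have hUo : IsOpen U := isOpen_lt continuous_const Complex.continuous_re
  have hUp : IsPreconnected U := (convex_halfSpace_re_gt 0).isPreconnected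
  have hmeas : ∀ (p : ℝ) (z : ℂ), AEStronglyMeasurable
      (fun t : ℝ => ((t ^ p : ℝ) : ℂ) * Complex.exp (-(z * t))) (volume.restrict (Ioi 0)) := by
    intro p z
    refine ContinuousOn.aestronglyMeasurable (fun t ht => ?_) measurableSet_Ioi
    have : ContinuousAt (fun t : ℝ => t ^ p) t :=
      Real.continuousAt_rpow_const t p (Or.inl (ne_of_gt ht))
    exact ((Complex.continuous_ofReal.continuousAt.comp this).mul
      (Continuous.continuousAt (by fun_prop))).continuousWithinAt
  have hint : ∀ (p : ℝ), -1 < p → ∀ z ∈ U, IntegrableOn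
      (fun t : ℝ => ((t ^ p : ℝ) : ℂ) * Complex.exp (-(z * t))) (Ioi 0) := by
    intro p hp z hz
    refine Integrable.mono' (integrableOn_rpow_mul_exp_neg hp hz) (hmeas p z) ?_
    refine (ae_restrict_iff' measurableSet_Ioi).2 (Eventually.of_forall fun t ht => ?_)
    rw [norm_mul, norm_cexp_neg_mul, Complex.norm_real,
      Real.norm_of_nonneg (Real.rpow_nonneg (le_of_lt ht) _)]
  have hf : AnalyticOnNhd ℂ (fun z : ℂ =>
      ∫ t in Ioi (0 : ℝ), ((t ^ (s - 1) : ℝ) : ℂ) * Complex.exp (-(z * t))) U := by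
    refine DifferentiableOn.analyticOnNhd (fun z hz => ?_) hUo
    have hz' : 0 < z.re := hz
    set V : Set ℂ := {y | z.re / 2 < y.re} with hV
    have hVn : V ∈ 𝓝 z := (isOpen_lt continuous_const Complex.continuous_re).mem_nhds
      (by change z.re / 2 < z.re; linarith)
    have h := hasDerivAt_integral_of_dominated_loc_of_deriv_le (μ := volume.restrict (Ioi (0:ℝ)))
      (𝕜 := ℂ) (s := V) (x₀ := z)
      (F := fun (y : ℂ) (t : ℝ) => ((t ^ (s - 1) : ℝ) : ℂ) * Complex.exp (-(y * t)))
      (F' := fun (y : ℂ) (t : ℝ) => ((t ^ s : ℝ) : ℂ) * -Complex.exp (-(y * t)))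
      (bound := fun t => t ^ s * Real.exp (-(z.re / 2) * t))
      hVn (Eventually.of_forall fun y => hmeas _ y) (hint _ (by linarith) z hz)
      ((hmeas s z).neg.congr (Eventually.of_forall fun t => by simp))
      ((ae_restrict_iff' measurableSet_Ioi).2 (Eventually.of_forall fun t ht y hy => by
        have ht' : (0 : ℝ) < t := ht
        rw [norm_mul, norm_neg, norm_cexp_neg_mul, Complex.norm_real,
          Real.norm_of_nonneg (Real.rpow_nonneg ht'.le _)]
        have : z.re / 2 < y.re := hy
        gcongr))
      (integrableOn_rpow_mul_exp_neg (by linarith) (by linarith))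
      ((ae_restrict_iff' measurableSet_Ioi).2 (Eventually.of_forall fun t ht y hy => by
        have ht' : (0 : ℝ) < t := ht
        have h1 : HasDerivAt (fun y : ℂ => -(y * t)) (-(t : ℂ)) y := by
          simpa using ((hasDerivAt_id y).mul_const (t : ℂ)).fun_neg
        have h2 := h1.cexp.const_mul (((t ^ (s - 1) : ℝ) : ℂ))
        refine h2.congr_deriv ?_
        have e : t ^ s = t ^ (s - 1) * t := by
          rw [← Real.rpow_add_one ht'.ne', sub_add_cancel]
        rw [e]
        push_cast
        ring))
    exact h.2.differentiableAt.differentiableWithinAt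
  have hg : AnalyticOnNhd ℂ (fun z : ℂ => ((Real.Gamma s : ℝ) : ℂ) * z ^ (-(s : ℂ))) U := by
    refine DifferentiableOn.analyticOnNhd (fun z hz => ?_) hUo
    have hz' : z ∈ Complex.slitPlane := Or.inl hz
    exact (((hasDerivAt_id z).cpow_const (c := -(s : ℂ)) hz').const_mul
      (((Real.Gamma s : ℝ) : ℂ))).differentiableAt.differentiableWithinAt
  have hreal : ∀ x : ℝ, 0 < x → (∫ t in Ioi (0 : ℝ), ((t ^ (s - 1) : ℝ) : ℂ)
      * Complex.exp (-((x : ℂ) * t))) = ((Real.Gamma s : ℝ) : ℂ) * (x : ℂ) ^ (-(s : ℂ)) := by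
    intro x hx
    have h := Real.integral_rpow_mul_exp_neg_mul_Ioi hs hx
    have e : ∀ t : ℝ, ((t ^ (s - 1) : ℝ) : ℂ) * Complex.exp (-((x : ℂ) * t))
        = ((t ^ (s - 1) * Real.exp (-(x * t)) : ℝ) : ℂ) := by intro t; push_cast; rfl
    simp only [e]
    rw [integral_complex_ofReal, h, one_div, Real.inv_rpow hx.le, ← Real.rpow_neg hx.le, mul_comm]
    push_cast
    rw [Complex.ofReal_cpow hx.le]
    push_cast
    rfl
  refine hf.eqOn_of_preconnected_of_frequently_eq hg hUp (z₀ := 1) (by simp [hU]) ?_ hr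
  have htend : Tendsto (fun n : ℕ => (((1 + 1 / ((n : ℝ) + 1) : ℝ)) : ℂ)) atTop (𝓝[≠] 1) := by
    refine tendsto_nhdsWithin_iff.2 ⟨?_, Eventually.of_forall fun n => ?_⟩
    · have h1 : Tendsto (fun n : ℕ => (1 + 1 / ((n : ℝ) + 1) : ℝ)) atTop (𝓝 (1 + 0)) :=
        tendsto_const_nhds.add tendsto_one_div_add_atTop_nhds_zero_nat
      have := (Complex.continuous_ofReal.tendsto _).comp h1
      simpa [Function.comp_def] using this
    · have hp : (0:ℝ) < 1 / ((n : ℝ) + 1) := by positivity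
      intro h
      have h' : ((1 + 1 / ((n : ℝ) + 1) : ℝ) : ℂ) = ((1 : ℝ) : ℂ) := by rw [h]; simp
      have := Complex.ofReal_injective h'
      linarith
  exact htend.frequently (Frequently.of_forall fun n => hreal _ (by positivity))

namespace LineChain

variable {a b B : ℝ} {F : ℕ → ℝ → ℂ}

/-- A locally uniform integrable majorant for the fractional integrals. -/
lemma norm_mul_rpow_le (hF : LineChain a b B F) {i : ℕ} (hi : i ≤ 8) {σ : ℝ} (hσ : |σ| = 1)
    {s x z t : ℝ} (hz : |z - x| ≤ 1) (ht : 0 < t) :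
    ‖F i (z + σ * t) * ((t ^ (s - 1) : ℝ) : ℂ)‖
      ≤ (Ioc 0 (|x| + |a| + |b| + 1)).indicator (fun t => B * t ^ (s - 1)) t := by
  have hpow : 0 ≤ t ^ (s - 1) := Real.rpow_nonneg ht.le _
  by_cases hR : t ≤ |x| + |a| + |b| + 1
  · rw [indicator_of_mem (show t ∈ Ioc 0 (|x| + |a| + |b| + 1) from ⟨ht, hR⟩), norm_mul, Complex.norm_real, Real.norm_of_nonneg hpow]
    gcongr
    exact hF.bound i hi _
  · rw [indicator_of_notMem (fun h => hR h.2), hF.zero i hi, zero_mul, norm_zero]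
    intro hmem
    push Not at hR
    have h1 : |σ * t| = t := by rw [abs_mul, hσ, one_mul, abs_of_pos ht]
    have h2 : |z + σ * t| ≤ |a| + |b| := by
      rw [abs_le]
      constructor
      · linarith [hmem.1, neg_abs_le a, abs_nonneg b]
      · linarith [hmem.2, le_abs_self b, abs_nonneg a]
    have h3 : |σ * t| ≤ |z + σ * t| + |z| := by
      have := abs_sub (z + σ * t) z
      rwa [add_sub_cancel_left] at this
    have h4 : |z| ≤ |x| + 1 := by
      have := abs_add_le (z - x) x
      rw [sub_add_cancel] at this
      linarith
    linarith

lemma integrable_majorant {s : ℝ} (hs : 0 < s) (B R : ℝ) :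
    Integrable ((Ioc 0 R).indicator (fun t : ℝ => B * t ^ (s - 1)))
      (volume.restrict (Ioi 0)) := by
  refine Integrable.restrict ?_
  rw [integrable_indicator_iff measurableSet_Ioc]
  rcases le_or_gt 0 R with hR | hR
  · have := (intervalIntegral.intervalIntegrable_rpow' (a := 0) (b := R) (r := s - 1)
      (by linarith)).const_mul B
    rwa [intervalIntegrable_iff_integrableOn_Ioc_of_le hR] at this
  · rw [Ioc_eq_empty (by linarith)]; exact integrableOn_empty

lemma aestronglyMeasurable_mul_rpow (hF : LineChain a b B F) {i : ℕ} (hi : i < 8) (σ s z : ℝ) :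
    AEStronglyMeasurable (fun t : ℝ => F i (z + σ * t) * ((t ^ (s - 1) : ℝ) : ℂ))
      (volume.restrict (Ioi 0)) := by
  have hc := hF.continuous hi
  refine ContinuousOn.aestronglyMeasurable (fun t ht => ?_) measurableSet_Ioi
  have : ContinuousAt (fun t : ℝ => t ^ (s - 1)) t :=
    Real.continuousAt_rpow_const t _ (Or.inl (ne_of_gt ht))
  exact ((Continuous.continuousAt (by fun_prop)).mul
    (Complex.continuous_ofReal.continuousAt.comp this)).continuousWithinAt

lemma integrable_mul_rpow (hF : LineChain a b B F) {i : ℕ} (hi : i < 8) {σ : ℝ} (hσ : |σ| = 1)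
    {s : ℝ} (hs : 0 < s) (z : ℝ) :
    Integrable (fun t : ℝ => F i (z + σ * t) * ((t ^ (s - 1) : ℝ) : ℂ))
      (volume.restrict (Ioi 0)) :=
  Integrable.mono' (integrable_majorant hs B (|z| + |a| + |b| + 1))
    (hF.aestronglyMeasurable_mul_rpow hi σ s z)
    ((ae_restrict_iff' measurableSet_Ioi).2 (Eventually.of_forall fun _ ht =>
      hF.norm_mul_rpow_le hi.le hσ (by simp) ht))

/-- The one-sided fractional integrals may be differentiated under the integral sign. -/
lemma hasDerivAt_fracIntegral (hF : LineChain a b B F) {i : ℕ} (hi : i < 7) {σ : ℝ}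
    (hσ : |σ| = 1) {s : ℝ} (hs : 0 < s) (x : ℝ) :
    HasDerivAt (fun z => ∫ t in Ioi (0 : ℝ), F i (z + σ * t) * ((t ^ (s - 1) : ℝ) : ℂ))
      (∫ t in Ioi (0 : ℝ), F (i + 1) (x + σ * t) * ((t ^ (s - 1) : ℝ) : ℂ)) x := by
  refine (hasDerivAt_integral_of_dominated_loc_of_deriv_le (μ := volume.restrict (Ioi (0:ℝ)))
    (𝕜 := ℝ) (s := Metric.closedBall x 1) (x₀ := x)
    (F := fun z t => F i (z + σ * t) * ((t ^ (s - 1) : ℝ) : ℂ))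
    (F' := fun z t => F (i + 1) (z + σ * t) * ((t ^ (s - 1) : ℝ) : ℂ))
    (Metric.closedBall_mem_nhds x one_pos)
    (Eventually.of_forall fun z => hF.aestronglyMeasurable_mul_rpow (by omega) σ s z)
    (hF.integrable_mul_rpow (by omega) hσ hs x)
    (hF.aestronglyMeasurable_mul_rpow (by omega) σ s x)
    ((ae_restrict_iff' measurableSet_Ioi).2 (Eventually.of_forall fun t ht z hz =>
      hF.norm_mul_rpow_le (by omega) hσ (by simpa [Real.dist_eq] using hz) ht))
    (integrable_majorant hs B _)
    (Eventually.of_forall fun t z _ => ?_)).2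
  have h1 := (hF.deriv i (by omega) (z + σ * t)).scomp z ((hasDerivAt_id z).add_const (σ * t))
  simp only [one_smul] at h1
  exact h1.mul_const _

lemma iteratedDeriv_fracIntegral (hF : LineChain a b B F) {σ : ℝ}
    (hσ : |σ| = 1) {s : ℝ} (hs : 0 < s) (x : ℝ) :
    iteratedDeriv 2 (fun z => ∫ t in Ioi (0 : ℝ), F 0 (z + σ * t) * ((t ^ (s - 1) : ℝ) : ℂ)) x
      = ∫ t in Ioi (0 : ℝ), F 2 (x + σ * t) * ((t ^ (s - 1) : ℝ) : ℂ) := by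
  rw [iteratedDeriv_succ, iteratedDeriv_one]
  have : _root_.deriv (fun z => ∫ t in Ioi (0 : ℝ), F 0 (z + σ * t) * ((t ^ (s - 1) : ℝ) : ℂ))
      = fun z => ∫ t in Ioi (0 : ℝ), F 1 (z + σ * t) * ((t ^ (s - 1) : ℝ) : ℂ) :=
    funext fun z => (hF.hasDerivAt_fracIntegral (i := 0) (by norm_num) hσ hs z).deriv
  rw [this]
  exact (hF.hasDerivAt_fracIntegral (i := 1) (by norm_num) hσ hs x).deriv

end LineChain

lemma setIntegral_Iio_eq (f : ℝ → ℂ) (β z : ℝ) :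
    ∫ ξ in Iio z, f ξ / (((z - ξ) ^ β : ℝ) : ℂ)
      = ∫ t in Ioi (0 : ℝ), f (z + (-1) * t) * ((t ^ (-β) : ℝ) : ℂ) := by
  rw [← integral_indicator measurableSet_Iio, ← integral_indicator measurableSet_Ioi,
    ← integral_sub_left_eq_self _ volume z]
  congr 1; ext t
  by_cases ht : 0 < t
  · rw [indicator_of_mem (show t ∈ Ioi (0:ℝ) from ht),
      indicator_of_mem (show z - t ∈ Iio z by simpa using ht), sub_sub_cancel,
      Real.rpow_neg ht.le, neg_one_mul, ← sub_eq_add_neg, div_eq_mul_inv]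
    push_cast
    rfl
  · rw [indicator_of_notMem (show t ∉ Ioi (0:ℝ) from ht),
      indicator_of_notMem (show z - t ∉ Iio z by simpa using ht)]

lemma setIntegral_Ioi_eq (f : ℝ → ℂ) (β z : ℝ) :
    ∫ ξ in Ioi z, f ξ / (((ξ - z) ^ β : ℝ) : ℂ)
      = ∫ t in Ioi (0 : ℝ), f (z + 1 * t) * ((t ^ (-β) : ℝ) : ℂ) := by
  rw [← integral_indicator measurableSet_Ioi, ← integral_indicator measurableSet_Ioi,
    ← integral_add_left_eq_self _ z]
  congr 1; ext t
  by_cases ht : 0 < t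
  · rw [indicator_of_mem (show t ∈ Ioi (0:ℝ) from ht),
      indicator_of_mem (show z + t ∈ Ioi z by simpa using ht), add_sub_cancel_left,
      Real.rpow_neg ht.le, one_mul, div_eq_mul_inv]
    push_cast
    rfl
  · rw [indicator_of_notMem (show t ∉ Ioi (0:ℝ) from ht),
      indicator_of_notMem (show z + t ∉ Ioi z by simpa using ht)]

/-- The boundary value of the two-sided Gamma integral on the imaginary axis. -/
lemma cpow_I_add_cpow_neg_I {ω : ℝ} (hω : ω ≠ 0) (s : ℝ) :
    (-(ω * Complex.I)) ^ (-(s : ℂ)) + ((ω : ℂ) * Complex.I) ^ (-(s : ℂ))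
      = ((2 * Real.cos (π * s / 2) * |ω| ^ (-s) : ℝ) : ℂ) := by
  have key : ∀ y : ℝ, 0 < y → (-(y * Complex.I)) ^ (-(s : ℂ)) + ((y : ℂ) * Complex.I) ^ (-(s : ℂ))
      = ((2 * Real.cos (π * s / 2) * y ^ (-s) : ℝ) : ℂ) := by
    intro y hy
    have hy' : (y : ℂ) ≠ 0 := by exact_mod_cast hy.ne'
    have e0 : Complex.exp (((Real.log y : ℝ) : ℂ) * -(s : ℂ)) = ((y ^ (-s) : ℝ) : ℂ) := by
      rw [Real.rpow_def_of_pos hy]; push_cast; rfl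
    have h1 : ((y : ℂ) * Complex.I) ^ (-(s : ℂ))
        = ((y ^ (-s) : ℝ) : ℂ) * Complex.exp (-((π * s / 2 : ℝ) : ℂ) * Complex.I) := by
      rw [Complex.cpow_def_of_ne_zero (mul_ne_zero hy' Complex.I_ne_zero),
        Complex.log_ofReal_mul hy Complex.I_ne_zero, Complex.log_I, add_mul, Complex.exp_add, e0]
      congr 2; push_cast; ring
    have h2 : (-((y : ℂ) * Complex.I)) ^ (-(s : ℂ))
        = ((y ^ (-s) : ℝ) : ℂ) * Complex.exp (((π * s / 2 : ℝ) : ℂ) * Complex.I) := by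
      rw [← mul_neg, Complex.cpow_def_of_ne_zero (mul_ne_zero hy' (neg_ne_zero.2 Complex.I_ne_zero)),
        Complex.log_ofReal_mul hy (neg_ne_zero.2 Complex.I_ne_zero), Complex.log_neg_I, add_mul,
        Complex.exp_add, e0]
      congr 2; push_cast; ring
    rw [h1, h2, ← mul_add, ← Complex.two_cos]
    push_cast
    ring
  rcases lt_or_gt_of_ne hω with h | h
  · have h' := key (-ω) (by linarith)
    rw [abs_of_neg h, ← h', add_comm]
    push_cast
    simp
  · rw [abs_of_pos h]; exact key ω h

/-- Superposition of the two one-sided fractional integrals as a Fourier multiplier, obtained from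
the regularisation `exp (-ε t)` of the kernel as `ε → 0`. -/
lemma LineChain.fracIntegral_add_eq {a b B : ℝ} {F : ℕ → ℝ → ℂ} (hF : LineChain a b B F)
    (hab : a < b) {s : ℝ} (hs0 : 0 < s) (hs1 : s < 1) (x : ℝ) :
    (∫ t in Ioi (0 : ℝ), F 2 (x + (-1) * t) * ((t ^ (s - 1) : ℝ) : ℂ))
      + (∫ t in Ioi (0 : ℝ), F 2 (x + 1 * t) * ((t ^ (s - 1) : ℝ) : ℂ))
      = -((2 * Real.Gamma s * Real.cos (π * s / 2) : ℝ) : ℂ) * multiplier (2 - s) 0 (F 0) x := by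
  set G : ℝ → ℂ := fun ξ => 𝓕 (F 2) ξ with hG
  have hGe : ∀ ξ, G ξ = -((|2 * π * ξ| ^ 2 : ℝ) : ℂ) * 𝓕 (F 0) ξ := by
    intro ξ
    simp only [hG]
    rw [hF.fourier_eq_pow (by norm_num), sq_abs]
    congr 1
    push_cast
    calc (2 * π * Complex.I * ξ : ℂ) ^ 2 = (2 * π * ξ) ^ 2 * Complex.I ^ 2 := by ring
      _ = _ := by rw [Complex.I_sq]; ring
  have hGi : Integrable G := by
    have : G = fun ξ => -((|2 * π * ξ| ^ 2 : ℝ) : ℂ) * 𝓕 (F 0) ξ := funext hGe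
    rw [this]
    refine hF.integrable_mul hab (q := 2) (A := 1) (by norm_num) (by norm_num)
      (Continuous.aestronglyMeasurable (by fun_prop)) fun ξ => ?_
    rw [norm_neg, Complex.norm_real, Real.norm_of_nonneg (by positivity), one_mul]
    norm_cast
  have hinv : ∀ y : ℝ, F 2 y = ∫ ξ : ℝ, Complex.exp (2 * π * Complex.I * ξ * y) * G ξ := by
    intro y
    have h := congrFun (Continuous.fourierInv_fourier_eq (hF.continuous (i := 2) (by norm_num))
      (hF.integrable (by norm_num)) hGi) y
    rw [← h, Real.fourierInv_eq']
    congr 1; ext ξ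
    rw [smul_eq_mul]
    congr 2
    simp only [RCLike.inner_apply, conj_trivial]
    push_cast
    ring
  -- the regularised integrals
  set reg : ℝ → ℝ → ℂ := fun σ ε => ∫ t in Ioi (0 : ℝ),
    F 2 (x + σ * t) * ((t ^ (s - 1) : ℝ) : ℂ) * ((Real.exp (-ε * t) : ℝ) : ℂ) with hreg
  have hlim : ∀ σ : ℝ, |σ| = 1 → Tendsto (reg σ) (𝓝[>] 0)
      (𝓝 (∫ t in Ioi (0 : ℝ), F 2 (x + σ * t) * ((t ^ (s - 1) : ℝ) : ℂ))) := by
    intro σ hσ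
    refine tendsto_integral_filter_of_dominated_convergence
      (fun t => ‖F 2 (x + σ * t) * ((t ^ (s - 1) : ℝ) : ℂ)‖) ?_ ?_
      (hF.integrable_mul_rpow (by norm_num) hσ hs0 x).norm ?_
    · refine Eventually.of_forall fun ε => ?_
      exact (hF.aestronglyMeasurable_mul_rpow (by norm_num) σ s x).mul
        (Continuous.aestronglyMeasurable (by fun_prop))
    · filter_upwards [self_mem_nhdsWithin] with ε hε
      refine (ae_restrict_iff' measurableSet_Ioi).2 (Eventually.of_forall fun t ht => ?_)
      rw [norm_mul _ ((Real.exp (-ε * t) : ℝ) : ℂ), Complex.norm_real,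
        Real.norm_of_nonneg (Real.exp_pos _).le]
      refine mul_le_of_le_one_right (norm_nonneg _) (Real.exp_le_one_iff.2 ?_)
      have h1 : (0:ℝ) < ε := hε
      have h2 : (0:ℝ) < t := ht
      nlinarith
    · refine Eventually.of_forall fun t => ?_
      have h1 : Tendsto (fun ε : ℝ => ((Real.exp (-ε * t) : ℝ) : ℂ)) (𝓝[>] 0) (𝓝 1) := by
        have : Continuous fun ε : ℝ => ((Real.exp (-ε * t) : ℝ) : ℂ) := by fun_prop
        have h := (this.tendsto 0).mono_left (nhdsWithin_le_nhds (s := Ioi 0))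
        simpa using h
      simpa using h1.const_mul (F 2 (x + σ * t) * ((t ^ (s - 1) : ℝ) : ℂ))
  have hswap : ∀ σ : ℝ, ∀ ε : ℝ, 0 < ε → reg σ ε = ∫ ξ : ℝ,
      Complex.exp (2 * π * Complex.I * ξ * x) * G ξ
        * (((Real.Gamma s : ℝ) : ℂ)
          * ((ε : ℂ) - ((σ * (2 * π * ξ) : ℝ) : ℂ) * Complex.I) ^ (-(s : ℂ))) := by
    intro σ ε hε
    have hker : IntegrableOn (fun t : ℝ => t ^ (s - 1) * Real.exp (-ε * t)) (Ioi 0) :=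
      integrableOn_rpow_mul_exp_neg (by linarith) hε
    have hprod : Integrable (fun z : ℝ × ℝ => (((z.1 ^ (s - 1) * Real.exp (-ε * z.1) : ℝ) : ℂ))
        * G z.2) ((volume.restrict (Ioi (0:ℝ))).prod volume) :=
      Integrable.mul_prod (f := fun t : ℝ => (((t ^ (s - 1) * Real.exp (-ε * t) : ℝ) : ℂ)))
        hker.ofReal hGi
    have hprod2 : Integrable (Function.uncurry fun t ξ : ℝ =>
        Complex.exp (2 * π * Complex.I * ξ * ((x + σ * t : ℝ) : ℂ))
          * ((((t ^ (s - 1) * Real.exp (-ε * t) : ℝ) : ℂ)) * G ξ))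
        ((volume.restrict (Ioi (0:ℝ))).prod volume) := by
      refine Integrable.mono' hprod.norm ?_ (Eventually.of_forall fun z => ?_)
      · refine AEStronglyMeasurable.mul (Continuous.aestronglyMeasurable ?_) hprod.1
        fun_prop
      · simp only [Function.uncurry]
        rw [norm_mul, norm_exp_two_pi_mul, one_mul]
    have e1 : reg σ ε = ∫ t in Ioi (0 : ℝ), ∫ ξ : ℝ,
        Complex.exp (2 * π * Complex.I * ξ * ((x + σ * t : ℝ) : ℂ))
          * ((((t ^ (s - 1) * Real.exp (-ε * t) : ℝ) : ℂ)) * G ξ) := by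
      simp only [hreg]
      congr 1; ext t
      rw [hinv, mul_assoc, ← integral_mul_const]
      congr 1; ext ξ
      push_cast
      ring
    rw [e1, integral_integral_swap hprod2]
    congr 1; ext ξ
    have hre : 0 < ((ε : ℂ) - ((σ * (2 * π * ξ) : ℝ) : ℂ) * Complex.I).re := by
      simp [hε]
    rw [← integral_rpow_mul_cexp hs0 hre, ← integral_const_mul]
    congr 1; ext t
    have e2 : Complex.exp (2 * π * Complex.I * ξ * ((x + σ * t : ℝ) : ℂ))
        * ((Real.exp (-ε * t) : ℝ) : ℂ)
        = Complex.exp (2 * π * Complex.I * ξ * x)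
          * Complex.exp (-(((ε : ℂ) - ((σ * (2 * π * ξ) : ℝ) : ℂ) * Complex.I) * t)) := by
      rw [Complex.ofReal_exp, ← Complex.exp_add, ← Complex.exp_add]
      congr 1
      push_cast
      ring
    calc _ = (Complex.exp (2 * π * Complex.I * ξ * ((x + σ * t : ℝ) : ℂ))
        * ((Real.exp (-ε * t) : ℝ) : ℂ)) * (((t ^ (s - 1) : ℝ) : ℂ) * G ξ) := by
          push_cast; ring
      _ = _ := by rw [e2]; ring
  -- the limit on the Fourier side
  set K : ℝ → ℝ → ℂ := fun ε ξ => Complex.exp (2 * π * Complex.I * ξ * x) * G ξ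
      * (((Real.Gamma s : ℝ) : ℂ)
        * ((ε : ℂ) - ((1 * (2 * π * ξ) : ℝ) : ℂ) * Complex.I) ^ (-(s : ℂ)))
    + Complex.exp (2 * π * Complex.I * ξ * x) * G ξ
      * (((Real.Gamma s : ℝ) : ℂ)
        * ((ε : ℂ) - ((-1 * (2 * π * ξ) : ℝ) : ℂ) * Complex.I) ^ (-(s : ℂ))) with hK
  have hGam : 0 < Real.Gamma s := Real.Gamma_pos_of_pos hs0
  have hbase : Integrable fun ξ : ℝ => ‖((|2 * π * ξ| ^ (2 - s) : ℝ) : ℂ) * 𝓕 (F 0) ξ‖ := by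
    refine (hF.integrable_mul hab (q := 2 - s) (A := 1) (by linarith) (by linarith)
      (Continuous.aestronglyMeasurable ?_) fun ξ => ?_).norm
    · have : Continuous fun ξ : ℝ => |2 * π * ξ| ^ (2 - s) :=
        Continuous.rpow_const (by fun_prop) fun _ => Or.inr (by linarith)
      fun_prop
    · rw [Complex.norm_real, Real.norm_of_nonneg (by positivity), one_mul]
  have hKb : ∀ σ : ℝ, |σ| = 1 → ∀ ε : ℝ, 0 < ε → ∀ ξ : ℝ,
      ‖Complex.exp (2 * π * Complex.I * ξ * x) * G ξ * (((Real.Gamma s : ℝ) : ℂ)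
        * ((ε : ℂ) - ((σ * (2 * π * ξ) : ℝ) : ℂ) * Complex.I) ^ (-(s : ℂ)))‖
      ≤ Real.Gamma s * ‖((|2 * π * ξ| ^ (2 - s) : ℝ) : ℂ) * 𝓕 (F 0) ξ‖ := by
    intro σ hσ ε hε ξ
    rw [norm_mul, norm_mul, norm_exp_two_pi_mul, one_mul, norm_mul, Complex.norm_real,
      Real.norm_of_nonneg hGam.le, hGe, norm_mul, norm_neg, Complex.norm_real,
      Real.norm_of_nonneg (by positivity), norm_mul, Complex.norm_real,
      Real.norm_of_nonneg (by positivity)]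
    rcases eq_or_ne ξ 0 with rfl | hξ
    · simp only [mul_zero, abs_zero]
      rw [zero_pow (by norm_num), zero_mul, zero_mul]
      positivity
    have hw : 0 < |2 * π * ξ| := by positivity
    have hn : ‖((ε : ℂ) - ((σ * (2 * π * ξ) : ℝ) : ℂ) * Complex.I) ^ (-(s : ℂ))‖
        ≤ |2 * π * ξ| ^ (-s) := by
      rw [← Complex.ofReal_neg, Complex.norm_cpow_real]
      refine Real.rpow_le_rpow_of_nonpos hw ?_ (by linarith)
      have := Complex.abs_im_le_norm ((ε : ℂ) - ((σ * (2 * π * ξ) : ℝ) : ℂ) * Complex.I)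
      have e : ((ε : ℂ) - ((σ * (2 * π * ξ) : ℝ) : ℂ) * Complex.I).im = -(σ * (2 * π * ξ)) := by
        simp
      rw [e, abs_neg, abs_mul, hσ, one_mul] at this
      exact this
    have e : |2 * π * ξ| ^ (2 - s) = |2 * π * ξ| ^ 2 * |2 * π * ξ| ^ (-s) := by
      rw [sub_eq_add_neg, Real.rpow_add hw]; norm_cast
    rw [e]
    calc |2 * π * ξ| ^ 2 * ‖𝓕 (F 0) ξ‖ * (Real.Gamma s * _)
        ≤ |2 * π * ξ| ^ 2 * ‖𝓕 (F 0) ξ‖ * (Real.Gamma s * |2 * π * ξ| ^ (-s)) := by gcongr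
      _ = _ := by ring
  have hKm : ∀ σ ε : ℝ, 0 < ε → AEStronglyMeasurable (fun ξ : ℝ =>
      Complex.exp (2 * π * Complex.I * ξ * x) * G ξ * (((Real.Gamma s : ℝ) : ℂ)
        * ((ε : ℂ) - ((σ * (2 * π * ξ) : ℝ) : ℂ) * Complex.I) ^ (-(s : ℂ)))) volume := by
    intro σ ε hε
    refine ((Continuous.aestronglyMeasurable (by fun_prop)).mul hGi.1).mul
      (Continuous.aestronglyMeasurable (continuous_const.mul ?_))
    refine Continuous.cpow (by fun_prop) continuous_const fun ξ => Or.inl ?_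
    simp [hε]
  have hKi : ∀ σ : ℝ, |σ| = 1 → ∀ ε : ℝ, 0 < ε → Integrable (fun ξ : ℝ =>
      Complex.exp (2 * π * Complex.I * ξ * x) * G ξ * (((Real.Gamma s : ℝ) : ℂ)
        * ((ε : ℂ) - ((σ * (2 * π * ξ) : ℝ) : ℂ) * Complex.I) ^ (-(s : ℂ)))) := fun σ hσ ε hε =>
    (hbase.const_mul (Real.Gamma s)).mono' (hKm σ ε hε) (Eventually.of_forall (hKb σ hσ ε hε))
  have hKlim : Tendsto (fun ε => ∫ ξ, K ε ξ) (𝓝[>] 0)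
      (𝓝 (∫ ξ, -((2 * Real.Gamma s * Real.cos (π * s / 2) : ℝ) : ℂ)
        * ((((|2 * π * ξ| ^ (2 - s) : ℝ) : ℂ) * (2 * π * Complex.I * ξ) ^ 0
          * Complex.exp (2 * π * Complex.I * ξ * x)) * 𝓕 (F 0) ξ))) := by
    refine tendsto_integral_filter_of_dominated_convergence
      (fun ξ => Real.Gamma s * ‖((|2 * π * ξ| ^ (2 - s) : ℝ) : ℂ) * 𝓕 (F 0) ξ‖
        + Real.Gamma s * ‖((|2 * π * ξ| ^ (2 - s) : ℝ) : ℂ) * 𝓕 (F 0) ξ‖) ?_ ?_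
      ((hbase.const_mul _).add (hbase.const_mul _)) ?_
    · filter_upwards [self_mem_nhdsWithin] with ε hε
      exact (hKm 1 ε hε).add (hKm (-1) ε hε)
    · filter_upwards [self_mem_nhdsWithin] with ε hε
      exact Eventually.of_forall fun ξ => (norm_add_le _ _).trans
        (add_le_add (hKb 1 (by simp) ε hε ξ) (hKb (-1) (by simp) ε hε ξ))
    · have hne : ∀ᵐ ξ : ℝ, ξ ≠ 0 := by
        simp [ae_iff, measure_singleton]
      filter_upwards [hne] with ξ hξ
      have hω : 2 * π * ξ ≠ 0 := by positivity
      have hw : 0 < |2 * π * ξ| := by positivity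
      have hc : ∀ σ : ℝ, |σ| = 1 → Tendsto (fun ε : ℝ =>
          ((ε : ℂ) - ((σ * (2 * π * ξ) : ℝ) : ℂ) * Complex.I) ^ (-(s : ℂ))) (𝓝[>] 0)
          (𝓝 ((-(((σ * (2 * π * ξ) : ℝ) : ℂ) * Complex.I)) ^ (-(s : ℂ)))) := by
        intro σ hσ
        have hσ0 : σ ≠ 0 := by intro h; rw [h] at hσ; simp at hσ
        have h1 : Tendsto (fun ε : ℝ => ((ε : ℂ) - ((σ * (2 * π * ξ) : ℝ) : ℂ) * Complex.I))
            (𝓝[>] 0) (𝓝 (-(((σ * (2 * π * ξ) : ℝ) : ℂ) * Complex.I))) := by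
          have : Continuous fun ε : ℝ => ((ε : ℂ) - ((σ * (2 * π * ξ) : ℝ) : ℂ) * Complex.I) := by
            fun_prop
          have h := (this.tendsto 0).mono_left (nhdsWithin_le_nhds (s := Ioi 0))
          simpa using h
        refine Tendsto.cpow h1 tendsto_const_nhds (Or.inr ?_)
        simp [hσ0, pi_ne_zero, hξ]
      have h2 := ((hc 1 (by simp)).add (hc (-1) (by simp))).const_mul
        (Complex.exp (2 * π * Complex.I * ξ * x) * G ξ * ((Real.Gamma s : ℝ) : ℂ))
      have e3 := cpow_I_add_cpow_neg_I hω s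
      convert h2 using 1
      · ext ε
        simp only [hK]
        ring
      · have e4 : (-(((1 * (2 * π * ξ) : ℝ) : ℂ) * Complex.I)) ^ (-(s : ℂ))
            + (-(((-1 * (2 * π * ξ) : ℝ) : ℂ) * Complex.I)) ^ (-(s : ℂ))
            = ((2 * Real.cos (π * s / 2) * |2 * π * ξ| ^ (-s) : ℝ) : ℂ) := by
          rw [← e3, one_mul]
          congr 2
          push_cast; ring
        rw [e4, hGe, pow_zero, mul_one]
        have e5 : |2 * π * ξ| ^ (2 - s) = |2 * π * ξ| ^ 2 * |2 * π * ξ| ^ (-s) := by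
          rw [sub_eq_add_neg, Real.rpow_add hw]; norm_cast
        rw [e5]
        congr 1
        push_cast
        ring
  have hfin := tendsto_nhds_unique ((hlim (-1) (by simp)).add (hlim 1 (by simp)))
    (hKlim.congr' (by
      filter_upwards [self_mem_nhdsWithin] with ε hε
      rw [hswap (-1) ε hε, hswap 1 ε hε, add_comm,
        ← integral_add (hKi 1 (by simp) ε hε) (hKi (-1) (by simp) ε hε)]))
  rw [hfin, integral_const_mul]
  rfl

/-- For `α < 2` the Riesz derivative is the Fourier multiplier `-|2 π ξ| ^ α`. -/
lemma LineChain.riesz_eq {a b B : ℝ} {F : ℕ → ℝ → ℂ} (hF : LineChain a b B F)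
    (hab : a < b) {α : ℝ} (hα : 1 < α) (hα2 : α < 2) (x : ℝ) :
    riesz α (F 0) x = -multiplier α 0 (F 0) x := by
  have hs0 : 0 < 2 - α := by linarith
  have hs1 : 2 - α < 1 := by linarith
  have hexp : -(α - 1) = 2 - α - 1 := by ring
  have hl : leftRL α (F 0) x = ((1 / Real.Gamma (2 - α) : ℝ) : ℂ)
      * ∫ t in Ioi (0 : ℝ), F 2 (x + (-1) * t) * ((t ^ (2 - α - 1) : ℝ) : ℂ) := by
    rw [leftRL, if_neg hα2.ne]
    simp only [setIntegral_Iio_eq, hexp]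
    rw [hF.iteratedDeriv_fracIntegral (by simp) hs0]
  have hr : rightRL α (F 0) x = ((1 / Real.Gamma (2 - α) : ℝ) : ℂ)
      * ∫ t in Ioi (0 : ℝ), F 2 (x + 1 * t) * ((t ^ (2 - α - 1) : ℝ) : ℂ) := by
    rw [rightRL, if_neg hα2.ne]
    simp only [setIntegral_Ioi_eq, hexp]
    rw [hF.iteratedDeriv_fracIntegral (by simp) hs0]
  rw [riesz, hl, hr, ← mul_add, hF.fracIntegral_add_eq hab hs0 hs1, sub_sub_cancel]
  have hcos : Real.cos (π * (2 - α) / 2) = -Real.cos (α * π / 2) := by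
    rw [show π * (2 - α) / 2 = π - α * π / 2 by ring, Real.cos_pi_sub]
  have hc0 : Real.cos (α * π / 2) ≠ 0 := by
    apply ne_of_lt
    apply Real.cos_neg_of_pi_div_two_lt_of_lt <;> nlinarith [pi_pos]
  have hG0 : Real.Gamma (2 - α) ≠ 0 := (Real.Gamma_pos_of_pos hs0).ne'
  rw [hcos]
  have e : (-(1 / (2 * Real.cos (α * π / 2)))) * ((1 / Real.Gamma (2 - α))
      * (-(2 * Real.Gamma (2 - α) * -Real.cos (α * π / 2)))) = -1 := by
    field_simp
  rw [← mul_assoc, ← mul_assoc, ← Complex.ofReal_neg, ← Complex.ofReal_mul, ← Complex.ofReal_mul,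
    mul_assoc, e]
  push_cast
  ring

end

/-! ### Taylor expansions and discrete Lipschitz functions -/

/-- Taylor's formula within a convex set, with a crude constant, for a sequence of functions each
of which is the derivative of its predecessor. -/
lemma norm_sub_taylor_le {s : Set ℝ} (hs : Convex ℝ s) {B p : ℝ} (hp : p ∈ s) (n : ℕ) :
    ∀ (F : ℕ → ℝ → ℂ), (∀ i < n, ∀ x ∈ s, HasDerivWithinAt (F i) (F (i + 1) x) s x) →
      (∀ x ∈ s, ‖F n x‖ ≤ B) → ∀ x ∈ s,
      ‖F 0 x - ∑ i ∈ Finset.range n, (((x - p) ^ i / i.factorial : ℝ) : ℂ) * F i p‖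
        ≤ B * |x - p| ^ n := by
  induction n with
  | zero =>
    intro F _ hb x hx
    simpa using hb x hx
  | succ n ih =>
    intro F hd hb x hx
    have hsub : uIcc p x ⊆ s := hs.ordConnected.uIcc_subset hp hx
    have hder : ∀ z ∈ uIcc p x, HasDerivWithinAt
        (fun z => F 0 z - ∑ i ∈ Finset.range (n + 1), (((z - p) ^ i / i.factorial : ℝ) : ℂ) * F i p)
        (F 1 z - ∑ i ∈ Finset.range n, (((z - p) ^ i / i.factorial : ℝ) : ℂ) * F (i + 1) p)
        (uIcc p x) z := by
      intro z hz
      refine ((hd 0 (by omega) z (hsub hz)).mono hsub).sub ?_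
      have hg : ∀ i : ℕ, HasDerivAt (fun z : ℝ => (((z - p) ^ (i + 1) / (i + 1).factorial : ℝ) : ℂ))
          (((z - p) ^ i / i.factorial : ℝ) : ℂ) z := by
        intro i
        have h1 := ((((hasDerivAt_id z).sub_const p).pow (i + 1)).div_const
          ((i + 1).factorial : ℝ)).ofReal_comp
        refine h1.congr_deriv ?_
        congr 1
        have h2 : (i.factorial : ℝ) ≠ 0 := by positivity
        rw [Nat.factorial_succ]
        push_cast
        field_simp
        simp
      have h2 := HasDerivAt.fun_sum (u := Finset.range n) (x := z)
        fun i _ => (hg i).mul_const (F (i + 1) p)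
      simp only [Finset.sum_range_succ' _ n]
      refine HasDerivWithinAt.congr_deriv (h2.hasDerivWithinAt.add
        (hasDerivWithinAt_const z (uIcc p x) ((((z - p) ^ 0 / (0).factorial : ℝ) : ℂ) * F 0 p))) ?_
      rw [add_zero]
    have hbd : ∀ z ∈ uIcc p x,
        ‖F 1 z - ∑ i ∈ Finset.range n, (((z - p) ^ i / i.factorial : ℝ) : ℂ) * F (i + 1) p‖
          ≤ B * |x - p| ^ n := by
      intro z hz
      refine (ih (fun i => F (i + 1)) (fun i hi => hd (i + 1) (by omega)) hb z (hsub hz)).trans ?_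
      have hB : 0 ≤ B := (norm_nonneg _).trans (hb x hx)
      have := abs_sub_left_of_mem_uIcc hz
      gcongr
    have h := (convex_uIcc p x).norm_image_sub_le_of_norm_hasDerivWithin_le hder hbd
      left_mem_uIcc right_mem_uIcc
    have h0 : ∑ i ∈ Finset.range (n + 1), (((p - p) ^ i / i.factorial : ℝ) : ℂ) * F i p = F 0 p := by
      rw [Finset.sum_range_succ', Finset.sum_eq_zero]
      · simp
      · intro i _; simp
    rw [h0, sub_self, sub_zero, Real.norm_eq_abs] at h
    calc _ ≤ _ := h
      _ = _ := by ring

lemma coeff_two_of_two_le {m : ℤ} (hm : 2 ≤ |m|) : coeff 2 m = 0 := by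
  have key : ∀ n : ℕ, 2 ≤ n → coeff 2 n = 0 := by
    intro n hn
    unfold coeff
    have : (2 : ℝ) / 2 - ((n : ℤ) : ℝ) + 1 = -((n - 2 : ℕ) : ℝ) := by
      push_cast [Nat.cast_sub hn]; ring
    rw [this, Real.Gamma_neg_nat_eq_zero]
    simp
  rcases abs_choice m with h | h
  · lift m to ℕ using by rw [← h]; exact abs_nonneg m
    exact key m (by omega)
  · have h0 : 0 ≤ -m := by rw [← h]; exact abs_nonneg m
    rw [← coeff_neg]
    generalize -m = k at *
    lift k to ℕ using h0
    exact key k (by omega)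

lemma coeff_two_zero : coeff 2 0 = 2 := by
  have h3 : Real.Gamma (2 + 1) = 2 := by
    have := Real.Gamma_nat_eq_factorial 2
    simpa using this
  have h2 : Real.Gamma (2 / 2 + 1) = 1 := by norm_num [Real.Gamma_two]
  rw [coeff_zero, h3, h2]; norm_num

lemma coeff_two_one : coeff 2 1 = -1 := by
  have := coeff_succ (α := 2) (by norm_num) 0
  simp only [Nat.cast_zero, zero_add] at this
  have h0 := coeff_two_zero
  norm_num at this h0 ⊢
  linarith

lemma diff1_two {h : ℝ} {M : ℕ} {v : ℕ → ℂ} (h0 : v 0 = 0) (hM : v M = 0) {j : ℕ}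
    (hj : j ∈ Finset.Ioo 0 M) :
    diff1 2 h M v j = 1 / (h : ℂ) ^ 2 * (v (j + 1) - 2 * v j + v (j - 1)) := by
  rw [Finset.mem_Ioo] at hj
  have e : ∑ s ∈ Finset.Ioo 0 M, ((coeff 2 ((j : ℤ) - (s : ℤ)) : ℝ) : ℂ) * v s
      = ∑ s ∈ ({j - 1, j, j + 1} : Finset ℕ), ((coeff 2 ((j : ℤ) - (s : ℤ)) : ℝ) : ℂ) * v s := by
    rw [Finset.sum_subset (s₁ := Finset.Ioo 0 M) (s₂ := Finset.Icc 0 M)]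
    · symm
      refine Finset.sum_subset ?_ ?_
      · intro s hs
        simp only [Finset.mem_insert, Finset.mem_singleton] at hs
        rw [Finset.mem_Icc]; omega
      · intro s _ hs
        simp only [Finset.mem_insert, Finset.mem_singleton, not_or] at hs
        rw [coeff_two_of_two_le (by rw [le_abs]; omega)]
        simp
    · exact Finset.Ioo_subset_Icc_self
    · intro s hs hs'
      simp only [Finset.mem_Icc, Finset.mem_Ioo] at hs hs'
      have : s = 0 ∨ s = M := by omega
      rcases this with rfl | rfl <;> simp [*]
  unfold diff1
  rw [e, Finset.sum_insert (by simp; omega), Finset.sum_insert (by simp), Finset.sum_singleton]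
  have e1 : (j : ℤ) - ((j - 1 : ℕ) : ℤ) = 1 := by omega
  have e2 : (j : ℤ) - ((j + 1 : ℕ) : ℤ) = -1 := by omega
  rw [e1, e2, sub_self, coeff_neg, coeff_two_one, coeff_two_zero]
  rw [Real.rpow_two]
  push_cast
  ring

/-- A grid function with Lipschitz constant `A` that vanishes at both ends has a fractional
difference of size `h ^ (-α) A`: the coefficients have sum zero and a first moment. -/
lemma exists_norm_diff1_le_of_lipschitz {α : ℝ} (hα : 1 < α) (hα2 : α ≤ 2) :
    ∃ C, 0 < C ∧ ∀ (h A : ℝ) (M : ℕ) (v : ℕ → ℂ), 0 < h → 0 ≤ A → v 0 = 0 → v M = 0 →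
      (∀ j ≤ M, ∀ k ≤ M, ‖v j - v k‖ ≤ A * |(j : ℝ) - k|) →
      ∀ j ∈ Finset.Ioo 0 M, ‖diff1 α h M v j‖ ≤ C * (1 / h ^ α * A) := by
  have hs := summable_abs_mul_coeff hα hα2
  refine ⟨∑' m : ℤ, |(m : ℝ)| * |coeff α m| + 1, by positivity, ?_⟩
  intro h A M v hh hA h0 hM hv j hj
  rw [Finset.mem_Ioo] at hj
  -- the extension of `v` by zero to the integers
  set w : ℤ → ℂ := fun s => if s ∈ Finset.Ioo (0 : ℤ) M then v s.toNat else 0 with hw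
  have hwn : ∀ s : ℕ, s ≤ M → w s = v s := by
    intro s hsM
    simp only [hw, Finset.mem_Ioo]
    split_ifs with h1
    · simp
    · have : s = 0 ∨ s = M := by omega
      rcases this with rfl | rfl <;> simp [*]
  have hw0 : ∀ s : ℤ, s ∉ Finset.Ioo (0 : ℤ) M → w s = 0 := fun s hs' => by simp only [hw, if_neg hs']
  have hlip : ∀ s : ℤ, ‖w s - w j‖ ≤ A * |((j - s : ℤ) : ℝ)| := by
    intro s
    rw [hwn j hj.2.le]
    rcases lt_or_ge s 0 with h1 | h1
    · rw [hw0 s (by simp; omega), ← h0]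
      refine (hv 0 (by omega) j hj.2.le).trans ?_
      gcongr A * ?_
      push_cast
      have : (s : ℝ) < 0 := by exact_mod_cast h1
      have hj0 : (0 : ℝ) ≤ j := by positivity
      rw [zero_sub, abs_neg, abs_of_nonneg hj0]
      exact (by linarith : (j : ℝ) ≤ j - s).trans (le_abs_self _)
    rcases le_or_gt s M with h2 | h2
    · lift s to ℕ using h1
      rw [hwn s (by omega)]
      refine (hv s (by omega) j hj.2.le).trans (le_of_eq ?_)
      rw [abs_sub_comm]; push_cast; rfl
    · rw [hw0 s (by simp; omega), ← hM]
      refine (hv M le_rfl j hj.2.le).trans ?_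
      gcongr A * ?_
      push_cast
      have h3 : (M : ℝ) < s := by exact_mod_cast h2
      have h4 : (j : ℝ) ≤ M := by exact_mod_cast hj.2.le
      rw [abs_of_nonneg (by linarith), abs_of_nonpos (by linarith)]
      linarith
  have hz : HasSum (fun s : ℤ => (coeff α (j - s) : ℂ) * (w s - w j))
      (∑ s ∈ Finset.Ioo 0 M, ((coeff α ((j : ℤ) - (s : ℤ)) : ℝ) : ℂ) * v s) := by
    have h1 : HasSum (fun s : ℤ => (coeff α (j - s) : ℂ) * w s)
        (∑ s ∈ Finset.Ioo (0 : ℤ) M, (coeff α (j - s) : ℂ) * w s) :=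
      hasSum_sum_of_ne_finset_zero fun s hs' => by rw [hw0 s hs', mul_zero]
    have h2 : HasSum (fun s : ℤ => (coeff α (j - s) : ℂ) * w j) 0 := by
      have := (((Equiv.subLeft (j : ℤ)).hasSum_iff).2 (hasSum_coeff hα hα2)).mul_right (w j)
      simpa [Function.comp_def] using this
    have h3 := h1.sub h2
    rw [sub_zero] at h3
    have h4 : ∑ s ∈ Finset.Ioo 0 M, ((coeff α ((j : ℤ) - (s : ℤ)) : ℝ) : ℂ) * v s
        = ∑ s ∈ Finset.Ioo (0 : ℤ) M, (coeff α (j - s) : ℂ) * w s := by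
      symm
      refine Finset.sum_bij (fun (s : ℤ) _ => s.toNat) ?_ ?_ ?_ ?_
      · intro s; simp only [Finset.mem_Ioo]; omega
      · intro s hs' t ht'; simp only [Finset.mem_Ioo] at hs' ht'; omega
      · intro s hs'
        rw [Finset.mem_Ioo] at hs'
        exact ⟨s, by rw [Finset.mem_Ioo]; omega, by simp⟩
      · intro s hs'
        rw [Finset.mem_Ioo] at hs'
        lift s to ℕ using hs'.1.le
        rw [hwn s (by omega), Int.toNat_natCast]
    rw [h4]
    simpa only [mul_sub] using h3
  have hsum : Summable fun s : ℤ => |((j - s : ℤ) : ℝ)| * |coeff α (j - s)| :=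
    ((Equiv.subLeft (j : ℤ)).summable_iff).2 hs
  have hts : ∑' s : ℤ, |((j - s : ℤ) : ℝ)| * |coeff α (j - s)| = ∑' m : ℤ, |(m : ℝ)| * |coeff α m| :=
    (Equiv.subLeft (j : ℤ)).tsum_eq (fun m : ℤ => |(m : ℝ)| * |coeff α m|)
  have hle : ‖∑ s ∈ Finset.Ioo 0 M, ((coeff α ((j : ℤ) - (s : ℤ)) : ℝ) : ℂ) * v s‖
      ≤ A * ∑' m : ℤ, |(m : ℝ)| * |coeff α m| := by
    rw [← hz.tsum_eq, ← hts, ← tsum_mul_left]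
    refine tsum_of_norm_bounded (hsum.mul_left A).hasSum fun s => ?_
    rw [norm_mul, Complex.norm_real, Real.norm_eq_abs]
    calc _ ≤ |coeff α (j - s)| * (A * |((j - s : ℤ) : ℝ)|) := by gcongr; exact hlip s
      _ = _ := by ring
  unfold diff1
  rw [norm_neg, norm_mul, Complex.norm_real, Real.norm_of_nonneg (by positivity)]
  calc _ ≤ 1 / h ^ α * (A * ∑' m : ℤ, |(m : ℝ)| * |coeff α m|) := by gcongr
    _ ≤ 1 / h ^ α * (A * (∑' m : ℤ, |(m : ℝ)| * |coeff α m| + 1)) := by gcongr; linarith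
    _ = _ := by ring

section

open scoped FourierTransform

/-! ### The operator and its difference quotient on one line, for all orders in `(1, 2]` -/

/-- The set on which a smooth solution is smooth in one space variable: the whole line if the
operator is nonlocal, the closed interval for the Laplacian. -/
def dom (α a b : ℝ) : Set ℝ := if α < 2 then univ else Icc a b

lemma dom_of_lt {α : ℝ} (h : α < 2) (a b : ℝ) : dom α a b = univ := if_pos h

lemma dom_two (a b : ℝ) : dom 2 a b = Icc a b := if_neg (lt_irrefl _)

lemma convex_dom (α a b : ℝ) : Convex ℝ (dom α a b) := by
  unfold dom; split_ifs
  exacts [convex_univ, convex_Icc a b]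

lemma Icc_subset_dom (α a b : ℝ) : Icc a b ⊆ dom α a b := by
  unfold dom; split_ifs
  exacts [subset_univ _, subset_rfl]

/-- `F 0` is a function of one space variable that vanishes at the ends of `[a, b]` and, in the
nonlocal case, outside; `F 1, …, F 8` are its successive derivatives, all bounded by `B`. -/
structure Chain (α a b B : ℝ) (F : ℕ → ℝ → ℂ) : Prop where
  deriv : ∀ i < 8, ∀ x ∈ dom α a b, HasDerivWithinAt (F i) (F (i + 1) x) (dom α a b) x
  bound : ∀ i ≤ 8, ∀ x ∈ dom α a b, ‖F i x‖ ≤ B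
  zero : ∀ i ≤ 8, i = 0 ∨ α < 2 → ∀ x ∈ dom α a b, x ∉ Ioo a b → F i x = 0

/-- The `p`-th derivative of the Riesz derivative of `F 0`: a Fourier multiplier if `α < 2`, the
derivative of order `2 + p` if `α = 2`. -/
noncomputable def jet (α : ℝ) (p : ℕ) (F : ℕ → ℝ → ℂ) (x : ℝ) : ℂ :=
  if α < 2 then -multiplier α p (F 0) x else F (2 + p) x

/-- A constant that serves in all bounds for the Riesz derivative and its differences. -/
noncomputable def jetConst (a b : ℝ) : ℝ := (1 + (b - a)) ^ 3 * (2 * π * (b - a) + 2)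

lemma jetConst_pos {a b : ℝ} (hab : a < b) : 0 < jetConst a b := by
  have : 0 < b - a := by linarith
  unfold jetConst; positivity

namespace Chain

variable {α a b B : ℝ} {F : ℕ → ℝ → ℂ}

lemma lineChain (hF : Chain α a b B F) (h : α < 2) : LineChain a b B F where
  deriv i hi x := by
    have := hF.deriv i hi x (by simp [dom_of_lt h])
    rwa [dom_of_lt h, hasDerivWithinAt_univ] at this
  bound i hi x := hF.bound i hi x (by simp [dom_of_lt h])
  zero i hi x := hF.zero i hi (Or.inr h) x (by simp [dom_of_lt h])

lemma zero_left (hF : Chain α a b B F) (hab : a < b) : F 0 a = 0 :=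
  hF.zero 0 (by norm_num) (Or.inl rfl) a (Icc_subset_dom _ _ _ (left_mem_Icc.2 hab.le)) (by simp)

lemma zero_right (hF : Chain α a b B F) (hab : a < b) : F 0 b = 0 :=
  hF.zero 0 (by norm_num) (Or.inl rfl) b (Icc_subset_dom _ _ _ (right_mem_Icc.2 hab.le)) (by simp)

lemma bound_nonneg (hF : Chain α a b B F) (hab : a < b) : 0 ≤ B :=
  (norm_nonneg _).trans (hF.bound 0 (by norm_num) a (Icc_subset_dom _ _ _ (left_mem_Icc.2 hab.le)))

lemma sum {ι : Type*} {S : Finset ι} {w : ι → ℂ} {G : ι → ℕ → ℝ → ℂ}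
    (hG : ∀ s ∈ S, Chain α a b B (G s)) {B' : ℝ}
    (hB : ∀ i ≤ 8, ∀ x ∈ dom α a b, ‖∑ s ∈ S, w s * G s i x‖ ≤ B') :
    Chain α a b B' (fun i x => ∑ s ∈ S, w s * G s i x) where
  deriv i hi x hx := HasDerivWithinAt.fun_sum fun s hs => ((hG s hs).deriv i hi x hx).const_mul _
  bound := hB
  zero i hi h x hx hx' := Finset.sum_eq_zero fun s hs => by
    rw [(hG s hs).zero i hi h x hx hx', mul_zero]

lemma sub {G : ℕ → ℝ → ℂ} (hF : Chain α a b B F) {B₁ B' : ℝ} (hG : Chain α a b B₁ G)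
    (hB : ∀ i ≤ 8, ∀ x ∈ dom α a b, ‖F i x - G i x‖ ≤ B') :
    Chain α a b B' (fun i x => F i x - G i x) where
  deriv i hi x hx := (hF.deriv i hi x hx).sub (hG.deriv i hi x hx)
  bound := hB
  zero i hi h x hx hx' := by rw [hF.zero i hi h x hx hx', hG.zero i hi h x hx hx', sub_zero]

end Chain

lemma LineChain.multiplier_sum {ι : Type*} {S : Finset ι} {α a b B : ℝ} (hab : a < b) (hα : 1 < α)
    (hα2 : α ≤ 2) {w : ι → ℂ} {G : ι → ℕ → ℝ → ℂ} (hG : ∀ s ∈ S, LineChain a b B (G s)) (x : ℝ) :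
    multiplier α 0 (fun x => ∑ s ∈ S, w s * G s 0 x) x = ∑ s ∈ S, w s * multiplier α 0 (G s 0) x := by
  have h1 : ∀ ξ, 𝓕 (fun x => ∑ s ∈ S, w s * G s 0 x) ξ = ∑ s ∈ S, w s * 𝓕 (G s 0) ξ := by
    intro ξ
    simp only [Real.fourier_real_eq_integral_exp_smul, smul_eq_mul, Finset.mul_sum]
    rw [integral_finsetSum]
    · refine Finset.sum_congr rfl fun s _ => ?_
      rw [← integral_const_mul]
      congr 1; ext v; ring
    · intro s hs
      have := (((Real.fourierIntegral_convergent_iff ξ).2 ((hG s hs).integrable (i := 0)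
        (by norm_num))).const_mul (w s))
      refine this.congr (Eventually.of_forall fun v => ?_)
      simp only [Circle.smul_def, Real.fourierChar_apply, smul_eq_mul]
      have e : (inner ℝ v ξ : ℝ) = v * ξ := by simp [mul_comm]
      rw [e]
      have e2 : (2 * π * -(v * ξ) : ℝ) = (-2 * π * v * ξ : ℝ) := by ring
      rw [e2]; ring
  unfold multiplier
  simp only [h1, Finset.mul_sum]
  rw [integral_finsetSum]
  · refine Finset.sum_congr rfl fun s _ => ?_
    rw [← integral_const_mul]
    congr 1; ext v; ring
  · intro s hs
    refine (((hG s hs).integrable_multiplier hab hα hα2 (p := 0) (by norm_num) x).const_mul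
      (w s)).congr (Eventually.of_forall fun v => ?_)
    simp only; ring

lemma jet_sum {ι : Type*} {S : Finset ι} {α a b B : ℝ} (hab : a < b) (hα : 1 < α)
    (hα2 : α ≤ 2) {w : ι → ℂ} {G : ι → ℕ → ℝ → ℂ} (hG : ∀ s ∈ S, Chain α a b B (G s)) (x : ℝ) :
    jet α 0 (fun i x => ∑ s ∈ S, w s * G s i x) x = ∑ s ∈ S, w s * jet α 0 (G s) x := by
  unfold jet
  split_ifs with h
  · rw [LineChain.multiplier_sum hab hα hα2 (fun s hs => (hG s hs).lineChain h), ← Finset.sum_neg_distrib]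
    exact Finset.sum_congr rfl fun s _ => by ring
  · rfl

lemma jet_sub {α a b B : ℝ} (hab : a < b) (hα : 1 < α) (hα2 : α ≤ 2) {F G : ℕ → ℝ → ℂ}
    (hF : Chain α a b B F) (hG : Chain α a b B G) (x : ℝ) :
    jet α 0 (fun i x => F i x - G i x) x = jet α 0 F x - jet α 0 G x := by
  have := jet_sum (S := Finset.univ) (B := B) hab hα hα2 (w := ![1, -1]) (G := ![F, G])
    (by
      intro s _
      fin_cases s
      exacts [hF, hG]) x
  simpa [Fin.sum_univ_two, ← sub_eq_add_neg] using this

namespace Chain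

variable {α a b B : ℝ} {F : ℕ → ℝ → ℂ}

lemma norm_jet_le (hF : Chain α a b B F) (hab : a < b) (hα : 1 < α) (hα2 : α ≤ 2) {p : ℕ}
    (hp : p ≤ 3) {x : ℝ} (hx : x ∈ dom α a b) : ‖jet α p F x‖ ≤ jetConst a b * B := by
  have hB := hF.bound_nonneg hab
  have hd : 0 < b - a := by linarith
  have h1 : 1 ≤ (1 + (b - a)) ^ 3 := one_le_pow₀ (by linarith)
  have h0 : 0 ≤ 2 * π * (b - a) := by positivity
  unfold jet jetConst
  generalize (1 + (b - a)) ^ 3 = P at h1 ⊢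
  split_ifs with h
  · rw [norm_neg]
    refine ((hF.lineChain h).norm_multiplier_le hab hα hα2 hp x).trans ?_
    refine mul_le_mul_of_nonneg_right ?_ hB
    nlinarith [mul_nonneg (sub_nonneg.2 h1) h0]
  · refine (hF.bound _ (by omega) x hx).trans (le_mul_of_one_le_left hB ?_)
    nlinarith

lemma hasDerivWithinAt_jet (hF : Chain α a b B F) (hab : a < b) (hα : 1 < α) (hα2 : α ≤ 2) {p : ℕ}
    (hp : p < 3) {x : ℝ} (hx : x ∈ Icc a b) :
    HasDerivWithinAt (jet α p F) (jet α (p + 1) F x) (Icc a b) x := by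
  unfold jet
  split_ifs with h
  · exact ((hF.lineChain h).hasDerivAt_multiplier hab hα hα2 hp x).neg.hasDerivWithinAt
  · exact (hF.deriv (2 + p) (by omega) x (Icc_subset_dom _ _ _ hx)).mono (Icc_subset_dom _ _ _)

lemma riesz_eq_jet (hF : Chain α a b B F) (hab : a < b) (hα : 1 < α) (hα2 : α ≤ 2) {x : ℝ}
    (hx : x ∈ Ioo a b) : riesz α (F 0) x = jet α 0 F x := by
  unfold jet
  split_ifs with h
  · exact (hF.lineChain h).riesz_eq hab hα h x
  obtain rfl : α = 2 := by linarith
  have hd : ∀ i < 8, ∀ z ∈ Ioo a b, HasDerivAt (F i) (F (i + 1) z) z := fun i hi z hz => by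
    have := hF.deriv i hi z (Icc_subset_dom _ _ _ (Ioo_subset_Icc_self hz))
    rw [dom_two] at this
    exact this.hasDerivAt (Icc_mem_nhds hz.1 hz.2)
  have h1 : _root_.deriv (F 0) =ᶠ[𝓝 x] F 1 := by
    filter_upwards [Ioo_mem_nhds hx.1 hx.2] with z hz
    exact (hd 0 (by norm_num) z hz).deriv
  have h2 : iteratedDeriv 2 (F 0) x = F 2 x := by
    rw [iteratedDeriv_succ, iteratedDeriv_one, h1.deriv_eq]
    exact (hd 1 (by norm_num) x hx).deriv
  have hc : Real.cos (2 * π / 2) = -1 := by rw [mul_div_cancel_left₀ _ two_ne_zero, Real.cos_pi]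
  simp only [riesz, leftRL, rightRL, if_true, h2, hc]
  push_cast
  ring

/-- Third order consistency, with the leading term of the truncation error. -/
lemma norm_diff1_sub_jet_sub_le (hF : Chain α a b B F) (hab : a < b) (hα : 1 < α) (hα2 : α ≤ 2)
    {h : ℝ} {M : ℕ} (hh : h = (b - a) / M) {j : ℕ} (hj : j ∈ Finset.Ioo 0 M) :
    ‖diff1 α h M (fun s => F 0 (a + s * h)) j - jet α 0 F (a + j * h)
        - ((α / 24 * h ^ 2 : ℝ) : ℂ) * jet α 2 F (a + j * h)‖
      ≤ h ^ 3 * ((2 * π * (b - a) + 2) * B) := by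
  have hj' := Finset.mem_Ioo.1 hj
  have hM : 0 < M := by omega
  have hM' : (0 : ℝ) < M := by exact_mod_cast hM
  have hh0 : 0 < h := by rw [hh]; apply div_pos <;> linarith
  have hB := hF.bound_nonneg hab
  have hd : 0 < b - a := by linarith
  unfold jet
  split_ifs with h2
  · refine ((hF.lineChain h2).norm_diff1_sub_le hab hα hα2 hM hh j).trans ?_
    gcongr
    linarith
  obtain rfl : α = 2 := by linarith
  have hend : a + M * h = b := by rw [hh]; field_simp; ring
  have hmem : ∀ s ≤ M, a + (s : ℝ) * h ∈ Icc a b := by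
    intro s hs
    have : (s : ℝ) ≤ M := by exact_mod_cast hs
    constructor
    · have : 0 ≤ (s : ℝ) * h := by positivity
      linarith
    · rw [← hend]; gcongr
  rw [diff1_two (by simp [hF.zero_left hab]) (by simp only [hend]; exact hF.zero_right hab) hj]
  have hx := hmem j hj'.2.le
  have tay := fun z hz => norm_sub_taylor_le (convex_Icc a b) (B := B) hx 5 F
    (fun i hi z hz => by
      have := hF.deriv i (by omega) z (Icc_subset_dom _ _ _ hz)
      rwa [dom_two] at this)
    (fun z hz => hF.bound 5 (by norm_num) z (Icc_subset_dom _ _ _ hz)) z hz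
  set x := a + (j : ℝ) * h with hxd
  have e1 : a + ((j + 1 : ℕ) : ℝ) * h = x + h := by push_cast; ring
  have e2 : a + ((j - 1 : ℕ) : ℝ) * h = x - h := by
    rw [Nat.cast_sub (by omega)]; push_cast; ring
  have t1 := tay (x + h) (e1 ▸ hmem (j + 1) (by omega))
  have t2 := tay (x - h) (e2 ▸ hmem (j - 1) (by omega))
  simp only [e1, e2]
  have n1 : x + h - x = h := by ring
  have n2 : x - h - x = -h := by ring
  rw [n1, abs_of_pos hh0] at t1
  rw [n2, abs_neg, abs_of_pos hh0] at t2
  simp only [Finset.sum_range_succ, Finset.sum_range_zero, Nat.factorial] at t1 t2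
  have hhc : (h : ℂ) ≠ 0 := by exact_mod_cast hh0.ne'
  set X := F 0 (x + h) with hX
  set Y := F 0 (x - h) with hY
  have key : 1 / (h : ℂ) ^ 2 * (X - 2 * F 0 x + Y) - F 2 x - ((2 / 24 * h ^ 2 : ℝ) : ℂ) * F 4 x
      = 1 / (h : ℂ) ^ 2 * ((X - (0 + ((h ^ 0 / (1 : ℕ) : ℝ) : ℂ) * F 0 x
          + ((h ^ 1 / ((0 + 1) * 1 : ℕ) : ℝ) : ℂ) * F 1 x
          + ((h ^ 2 / ((1 + 1) * ((0 + 1) * 1) : ℕ) : ℝ) : ℂ) * F 2 x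
          + ((h ^ 3 / ((2 + 1) * ((1 + 1) * ((0 + 1) * 1)) : ℕ) : ℝ) : ℂ) * F 3 x
          + ((h ^ 4 / ((3 + 1) * ((2 + 1) * ((1 + 1) * ((0 + 1) * 1))) : ℕ) : ℝ) : ℂ) * F 4 x))
        + (Y - (0 + (((-h) ^ 0 / (1 : ℕ) : ℝ) : ℂ) * F 0 x
          + (((-h) ^ 1 / ((0 + 1) * 1 : ℕ) : ℝ) : ℂ) * F 1 x
          + (((-h) ^ 2 / ((1 + 1) * ((0 + 1) * 1) : ℕ) : ℝ) : ℂ) * F 2 x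
          + (((-h) ^ 3 / ((2 + 1) * ((1 + 1) * ((0 + 1) * 1)) : ℕ) : ℝ) : ℂ) * F 3 x
          + (((-h) ^ 4 / ((3 + 1) * ((2 + 1) * ((1 + 1) * ((0 + 1) * 1))) : ℕ) : ℝ) : ℂ) * F 4 x))) := by
    push_cast
    field_simp
    ring
  rw [key, norm_mul]
  have n3 : ‖1 / (h : ℂ) ^ 2‖ = 1 / h ^ 2 := by
    rw [norm_div, norm_pow, Complex.norm_real, Real.norm_of_nonneg hh0.le, norm_one]
  rw [n3]
  calc _ ≤ 1 / h ^ 2 * (B * h ^ 5 + B * h ^ 5) := by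
        gcongr
        exact (norm_add_le _ _).trans (add_le_add t1 t2)
    _ = h ^ 3 * (2 * B) := by field_simp; ring
    _ ≤ _ := by
      have : 0 ≤ 2 * π * (b - a) := by positivity
      gcongr; linarith

lemma norm_diff1_sub_jet_le (hF : Chain α a b B F) (hab : a < b) (hα : 1 < α) (hα2 : α ≤ 2)
    {h : ℝ} {M : ℕ} (hh : h = (b - a) / M) {j : ℕ} (hj : j ∈ Finset.Ioo 0 M) :
    ‖diff1 α h M (fun s => F 0 (a + s * h)) j - jet α 0 F (a + j * h)‖
      ≤ (2 + (b - a)) * jetConst a b * B * h ^ 2 := by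
  have hj' := Finset.mem_Ioo.1 hj
  have hM' : (1 : ℝ) ≤ M := by exact_mod_cast (by omega : 1 ≤ M)
  have hd : 0 < b - a := by linarith
  have hh0 : 0 < h := by rw [hh]; apply div_pos <;> linarith
  have hh1 : h ≤ b - a := by rw [hh]; exact div_le_self hd.le hM'
  have hB := hF.bound_nonneg hab
  have h3 := hF.norm_diff1_sub_jet_sub_le hab hα hα2 hh hj
  have hx : a + j * h ∈ dom α a b :=
    Icc_subset_dom _ _ _ (Ioo_subset_Icc_self (grid_mem_Ioo (by omega) hab hh hj))
  have h2 := hF.norm_jet_le hab hα hα2 (p := 2) (by norm_num) hx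
  have hle : (2 * π * (b - a) + 2) * B ≤ jetConst a b * B := by
    unfold jetConst
    gcongr
    exact le_mul_of_one_le_left (by positivity) (one_le_pow₀ (by linarith))
  set D := diff1 α h M (fun s => F 0 (a + s * h)) j - jet α 0 F (a + j * h)
  have hJ : 0 ≤ jetConst a b * B := mul_nonneg (jetConst_pos hab).le hB
  have hn : ‖((α / 24 * h ^ 2 : ℝ) : ℂ) * jet α 2 F (a + j * h)‖ ≤ h ^ 2 * (jetConst a b * B) := by
    rw [norm_mul, Complex.norm_real, Real.norm_of_nonneg (by positivity)]
    gcongr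
    nlinarith [sq_nonneg h]
  calc ‖D‖ ≤ ‖D - ((α / 24 * h ^ 2 : ℝ) : ℂ) * jet α 2 F (a + j * h)‖
        + ‖((α / 24 * h ^ 2 : ℝ) : ℂ) * jet α 2 F (a + j * h)‖ := by
        exact norm_le_norm_sub_add _ _
    _ ≤ h ^ 3 * (jetConst a b * B) + h ^ 2 * (jetConst a b * B) :=
        add_le_add (h3.trans (by gcongr)) hn
    _ = h ^ 2 * (h + 1) * (jetConst a b * B) := by ring
    _ ≤ h ^ 2 * (2 + (b - a)) * (jetConst a b * B) := by gcongr ?_ * ?_ * _; linarith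
    _ = _ := by ring

lemma norm_diff1_le (hF : Chain α a b B F) (hab : a < b) (hα : 1 < α) (hα2 : α ≤ 2)
    {h : ℝ} {M : ℕ} (hh : h = (b - a) / M) (h1 : h ≤ 1) {j : ℕ} (hj : j ∈ Finset.Ioo 0 M) :
    ‖diff1 α h M (fun s => F 0 (a + s * h)) j‖ ≤ (3 + (b - a)) * jetConst a b * B := by
  have hj' := Finset.mem_Ioo.1 hj
  have hM' : (1 : ℝ) ≤ M := by exact_mod_cast (by omega : 1 ≤ M)
  have hd : 0 < b - a := by linarith
  have hh0 : 0 < h := by rw [hh]; apply div_pos <;> linarith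
  have hB := hF.bound_nonneg hab
  have hJ : 0 ≤ jetConst a b * B := mul_nonneg (jetConst_pos hab).le hB
  have h3 := hF.norm_diff1_sub_jet_le hab hα hα2 hh hj
  have hx : a + j * h ∈ dom α a b :=
    Icc_subset_dom _ _ _ (Ioo_subset_Icc_self (grid_mem_Ioo (by omega) hab hh hj))
  have h2 := hF.norm_jet_le hab hα hα2 (p := 0) (by norm_num) hx
  have h4 : (2 + (b - a)) * (jetConst a b * B) * h ^ 2 ≤ (2 + (b - a)) * (jetConst a b * B) * 1 := by
    gcongr
    exact pow_le_one₀ hh0.le h1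
  have h5 := norm_add_le (diff1 α h M (fun s => F 0 (a + s * h)) j - jet α 0 F (a + j * h))
    (jet α 0 F (a + j * h))
  rw [sub_add_cancel] at h5
  nlinarith

end Chain

/-- A function that is linear up to a cubic error near an endpoint has second derivative zero
there. -/
lemma second_deriv_eq_zero {a b B C : ℝ} (hab : a < b) {ψ : ℕ → ℝ → ℂ} {l : ℂ} {p : ℝ}
    (hp : p = a ∨ p = b)
    (hd : ∀ i < 3, ∀ x ∈ Icc a b, HasDerivWithinAt (ψ i) (ψ (i + 1) x) (Icc a b) x)
    (hb : ∀ x ∈ Icc a b, ‖ψ 3 x‖ ≤ B)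
    (hl : ∀ x ∈ Ioo a b, ‖ψ 0 x - l * (x - p)‖ ≤ C * |x - p| ^ 3) : ψ 2 p = 0 := by
  have hpm : p ∈ Icc a b := by
    rcases hp with rfl | rfl
    exacts [left_mem_Icc.2 hab.le, right_mem_Icc.2 hab.le]
  have hquad : ∀ x ∈ Ioo a b, ‖ψ 0 p + (x - p) * (ψ 1 p - l) + (x - p) ^ 2 / 2 * ψ 2 p‖
      ≤ (B + C) * |x - p| ^ 3 := by
    intro x hx
    have h1 := norm_sub_taylor_le (convex_Icc a b) hpm 3 ψ hd hb x (Ioo_subset_Icc_self hx)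
    have h2 := norm_sub_le (ψ 0 x - l * (x - p))
      (ψ 0 x - ∑ i ∈ Finset.range 3, (((x - p) ^ i / i.factorial : ℝ) : ℂ) * ψ i p)
    have h3 := hl x hx
    refine le_trans (le_of_eq ?_) (h2.trans ((add_le_add h3 h1).trans (le_of_eq (by ring))))
    congr 1
    simp only [Finset.sum_range_succ, Finset.sum_range_zero, Nat.factorial]
    push_cast
    ring
  obtain ⟨σ, hσ, hσm⟩ : ∃ σ : ℝ, |σ| = 1 ∧ ∀ δ, 0 < δ → δ < b - a → p + σ * δ ∈ Ioo a b := by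
    rcases hp with rfl | rfl
    · exact ⟨1, by simp, fun δ h1 h2 => by constructor <;> linarith⟩
    · exact ⟨-1, by simp, fun δ h1 h2 => by constructor <;> linarith⟩
  have hσ2 : σ ^ 2 = 1 := by rw [← sq_abs, hσ, one_pow]
  -- the second difference of the quadratic polynomial isolates its leading coefficient
  have hsmall : ∀ δ, 0 < δ → 3 * δ < b - a → ‖ψ 2 p‖ ≤ 44 * (B + C) * δ := by
    intro δ h1 h2
    have q : ∀ k : ℕ, 1 ≤ k → k ≤ 3 →
        ‖ψ 0 p + (σ * (k * δ)) * (ψ 1 p - l) + (k * δ) ^ 2 / 2 * ψ 2 p‖ ≤ (B + C) * (k * δ) ^ 3 := by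
      intro k hk hk3
      have hk' : (1 : ℝ) ≤ k := by exact_mod_cast hk
      have hk3' : (k : ℝ) ≤ 3 := by exact_mod_cast hk3
      have := hquad _ (hσm (k * δ) (by positivity) (by nlinarith))
      have e : p + σ * (k * δ) - p = σ * (k * δ) := by ring
      have e' : ((p + σ * (k * δ) : ℝ) : ℂ) - p = σ * (k * δ) := by push_cast; ring
      rw [e, abs_mul, hσ, one_mul, abs_of_nonneg (by positivity), e'] at this
      have e2 : ((σ : ℂ) * (k * δ)) ^ 2 = (k * δ) ^ 2 := by
        rw [mul_pow, ← Complex.ofReal_pow, hσ2]; simp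
      rwa [e2] at this
    have q1 := q 1 (by norm_num) (by norm_num)
    have q2 := q 2 (by norm_num) (by norm_num)
    have q3 := q 3 (by norm_num) (by norm_num)
    push_cast at q1 q2 q3
    have e : (δ : ℂ) ^ 2 * ψ 2 p
        = (ψ 0 p + (σ * (1 * δ)) * (ψ 1 p - l) + (1 * δ) ^ 2 / 2 * ψ 2 p)
          - (ψ 0 p + (σ * (2 * δ)) * (ψ 1 p - l) + (2 * δ) ^ 2 / 2 * ψ 2 p)
          - (ψ 0 p + (σ * (2 * δ)) * (ψ 1 p - l) + (2 * δ) ^ 2 / 2 * ψ 2 p)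
          + (ψ 0 p + (σ * (3 * δ)) * (ψ 1 p - l) + (3 * δ) ^ 2 / 2 * ψ 2 p) := by ring
    have h3 : δ ^ 2 * ‖ψ 2 p‖ ≤ 44 * (B + C) * δ ^ 3 := by
      have : δ ^ 2 * ‖ψ 2 p‖ = ‖(δ : ℂ) ^ 2 * ψ 2 p‖ := by
        rw [norm_mul, norm_pow, Complex.norm_real, Real.norm_of_nonneg h1.le]
      rw [this, e]
      refine (norm_add_le _ _).trans ?_
      refine (add_le_add_left (norm_sub_le _ _) _).trans ?_
      refine (add_le_add_left (add_le_add_left (norm_sub_le _ _) _) _).trans ?_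
      linarith
    have hδ2 : 0 < δ ^ 2 := by positivity
    rw [← mul_le_mul_iff_right₀ hδ2]
    linarith
  have hlim : Tendsto (fun δ : ℝ => 44 * (B + C) * δ) (𝓝[>] 0) (𝓝 0) := by
    have : Tendsto (fun δ : ℝ => 44 * (B + C) * δ) (𝓝 0) (𝓝 (44 * (B + C) * 0)) :=
      (continuous_const.mul continuous_id).tendsto 0
    rw [mul_zero] at this
    exact this.mono_left nhdsWithin_le_nhds
  have hle : ‖ψ 2 p‖ ≤ 0 := by
    refine ge_of_tendsto hlim ?_
    have hpos : 0 < (b - a) / 3 := by linarith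
    filter_upwards [Ioo_mem_nhdsGT hpos] with δ hδ
    exact hsmall δ hδ.1 (by linarith [hδ.2])
  exact norm_le_zero_iff.1 hle

lemma diff1_congr {α h : ℝ} {M : ℕ} {v w : ℕ → ℂ} (hvw : ∀ s ∈ Finset.Ioo 0 M, v s = w s) (j : ℕ) :
    diff1 α h M v j = diff1 α h M w j := by
  unfold diff1
  rw [Finset.sum_congr rfl fun s hs => by rw [hvw s hs]]

lemma diff1_eq_sum (α h : ℝ) (M : ℕ) (v : ℕ → ℂ) (j : ℕ) :
    diff1 α h M v j = ∑ s ∈ Finset.Ioo 0 M,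
      ((-(1 / h ^ α * coeff α ((j : ℤ) - (s : ℤ))) : ℝ) : ℂ) * v s := by
  unfold diff1
  rw [Finset.mul_sum, ← Finset.sum_neg_distrib]
  refine Finset.sum_congr rfl fun s _ => ?_
  push_cast; ring

/-- If the second derivative of the Riesz derivative vanishes at both ends, the difference operator
applied to the truncation error is small: that error is, on the grid and continued by zero to the
endpoints, Lipschitz with constant of order `h ^ 3` per step. -/
lemma exists_norm_diff1_truncation_le {α a b : ℝ} (hab : a < b) (hα : 1 < α) (hα2 : α ≤ 2) :
    ∃ C, 0 < C ∧ ∀ (B : ℝ) (F : ℕ → ℝ → ℂ), Chain α a b B F → jet α 2 F a = 0 → jet α 2 F b = 0 →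
      ∀ (h : ℝ) (M : ℕ), h = (b - a) / M → h ≤ 1 → ∀ j ∈ Finset.Ioo 0 M,
      ‖diff1 α h M (fun s => diff1 α h M (fun s => F 0 (a + s * h)) s - jet α 0 F (a + s * h)) j‖
        ≤ C * B * h := by
  obtain ⟨C, hC, hlip⟩ := exists_norm_diff1_le_of_lipschitz hα hα2
  have hJ := jetConst_pos hab
  refine ⟨C * (3 * jetConst a b), by positivity, ?_⟩
  intro B F hF ha hb h M hh h1 j hj
  have hj' := Finset.mem_Ioo.1 hj
  have hB := hF.bound_nonneg hab
  have hd : 0 < b - a := by linarith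
  have hM' : (0 : ℝ) < M := by exact_mod_cast (by omega : 0 < M)
  have hh0 : 0 < h := by rw [hh]; positivity
  have hend : a + M * h = b := by rw [hh]; field_simp; ring
  have hmem : ∀ s ≤ M, a + (s : ℝ) * h ∈ Icc a b := by
    intro s hs
    have : (s : ℝ) ≤ M := by exact_mod_cast hs
    constructor
    · have : 0 ≤ (s : ℝ) * h := by positivity
      linarith
    · rw [← hend]; gcongr
  set r : ℕ → ℂ := fun s => diff1 α h M (fun s => F 0 (a + s * h)) s - jet α 0 F (a + s * h) with hr
  set v : ℕ → ℂ := fun s => if s ∈ Finset.Ioo 0 M then r s else 0 with hv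
  rw [diff1_congr (w := v) (fun s hs => by simp only [hv, if_pos hs])]
  have hclose : ∀ s ≤ M, ‖v s - ((α / 24 * h ^ 2 : ℝ) : ℂ) * jet α 2 F (a + s * h)‖
      ≤ h ^ 3 * (jetConst a b * B) := by
    intro s hs
    by_cases hs' : s ∈ Finset.Ioo 0 M
    · simp only [hv, if_pos hs']
      refine (hF.norm_diff1_sub_jet_sub_le hab hα hα2 hh hs').trans ?_
      unfold jetConst
      gcongr
      exact le_mul_of_one_le_left (by positivity) (one_le_pow₀ (by linarith))
    · simp only [hv, if_neg hs']
      have : jet α 2 F (a + s * h) = 0 := by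
        rw [Finset.mem_Ioo] at hs'
        have : s = 0 ∨ s = M := by omega
        rcases this with rfl | rfl
        · simpa using ha
        · rwa [hend]
      rw [this, mul_zero, sub_zero, norm_zero]
      positivity
  have hjet : ∀ x ∈ Icc a b, ∀ y ∈ Icc a b, ‖jet α 2 F x - jet α 2 F y‖ ≤ jetConst a b * B * |x - y| := by
    intro x hx y hy
    have := (convex_Icc a b).norm_image_sub_le_of_norm_hasDerivWithin_le
      (fun z hz => hF.hasDerivWithinAt_jet hab hα hα2 (p := 2) (by norm_num) hz)
      (fun z hz => hF.norm_jet_le hab hα hα2 le_rfl (Icc_subset_dom _ _ _ hz)) hy hx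
    simpa [Real.norm_eq_abs] using this
  have hfin := hlip h (h ^ 3 * (3 * jetConst a b * B)) M v hh0 (by positivity)
    (by simp [hv]) (by simp [hv]) (by
      intro s hs t ht
      rcases eq_or_ne s t with rfl | hst
      · simp
      have h4 := hclose s hs
      have h5 := hclose t ht
      have h6 := hjet _ (hmem s hs) _ (hmem t ht)
      have h7 : |a + (s : ℝ) * h - (a + t * h)| = h * |(s : ℝ) - t| := by
        rw [← abs_of_pos hh0, ← abs_mul, abs_of_pos hh0]; congr 1; ring
      rw [h7] at h6
      have h8 : 1 ≤ |(s : ℝ) - t| := by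
        have : (1 : ℤ) ≤ |(s : ℤ) - t| := Int.one_le_abs (by omega)
        exact_mod_cast this
      set c : ℂ := ((α / 24 * h ^ 2 : ℝ) : ℂ) with hc
      have hcn : ‖c‖ ≤ h ^ 2 := by
        rw [hc, Complex.norm_real, Real.norm_of_nonneg (by positivity)]
        nlinarith [sq_nonneg h]
      set X := jet α 2 F (a + s * h)
      set Y := jet α 2 F (a + t * h)
      have e : v s - v t = (v s - c * X) - (v t - c * Y) + c * (X - Y) := by ring
      rw [e]
      have h9 : ‖c * (X - Y)‖ ≤ h ^ 2 * (jetConst a b * B * (h * |(s : ℝ) - t|)) := by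
        rw [norm_mul]; gcongr
      have h10 := norm_add_le ((v s - c * X) - (v t - c * Y)) (c * (X - Y))
      have h11 := norm_sub_le (v s - c * X) (v t - c * Y)
      have h12 : 0 ≤ h ^ 3 * (jetConst a b * B) := by positivity
      nlinarith [mul_le_mul_of_nonneg_left h8 h12]) j hj
  refine hfin.trans ?_
  have hp : 1 / h ^ α * h ^ 3 ≤ h := by
    have h13 : h ^ 2 ≤ h ^ α := by
      rw [← Real.rpow_two]
      exact Real.rpow_le_rpow_of_exponent_ge hh0 h1 hα2
    rw [one_div_mul_eq_div, div_le_iff₀ (by positivity)]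
    calc h ^ 3 = h * h ^ 2 := by ring
      _ ≤ _ := by gcongr
  calc _ = C * (3 * jetConst a b * B) * (1 / h ^ α * h ^ 3) := by ring
    _ ≤ C * (3 * jetConst a b * B) * h := by gcongr
    _ = _ := by ring

end

/-! ### Mixed partial derivatives of the solution -/

/-- The derivative of `f` within `S` in the direction `v`. -/
noncomputable def partialWithin (S : Set (ℝ × ℝ × ℝ)) (v : ℝ × ℝ × ℝ) (f : ℝ × ℝ × ℝ → ℂ) :
    ℝ × ℝ × ℝ → ℂ :=
  fun p => fderivWithin ℝ f S p v

section partialWithin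

variable {S : Set (ℝ × ℝ × ℝ)} (hS : UniqueDiffOn ℝ S) {v w : ℝ × ℝ × ℝ} {f g : ℝ × ℝ × ℝ → ℂ}

lemma eqOn_partialWithin (hfg : EqOn f g S) : EqOn (partialWithin S v f) (partialWithin S v g) S :=
  fun p hp => by unfold partialWithin; rw [fderivWithin_congr hfg (hfg hp)]

lemma eqOn_partialWithin_iterate (hfg : EqOn f g S) (n : ℕ) :
    EqOn ((partialWithin S v)^[n] f) ((partialWithin S v)^[n] g) S := by
  induction n with
  | zero => exact hfg
  | succ n ih =>
    rw [Function.iterate_succ_apply', Function.iterate_succ_apply']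
    exact eqOn_partialWithin ih

include hS

lemma contDiffOn_partialWithin {n : ℕ} (hf : ContDiffOn ℝ ((n + 1 : ℕ) : WithTop ℕ∞) f S) :
    ContDiffOn ℝ (n : WithTop ℕ∞) (partialWithin S v f) S :=
  (hf.fderivWithin hS (by exact_mod_cast le_rfl)).clm_apply contDiffOn_const

lemma contDiffOn_partialWithin_iterate (m : ℕ) {n : ℕ}
    (hf : ContDiffOn ℝ ((n + m : ℕ) : WithTop ℕ∞) f S) :
    ContDiffOn ℝ (n : WithTop ℕ∞) ((partialWithin S v)^[m] f) S := by
  induction m generalizing n with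
  | zero => exact hf
  | succ m ih =>
    rw [Function.iterate_succ_apply']
    exact contDiffOn_partialWithin hS (ih (by rwa [show n + 1 + m = n + (m + 1) by ring]))

lemma partialWithin_comm (hSi : S ⊆ closure (interior S))
    (hf : ContDiffOn ℝ ((2 : ℕ) : WithTop ℕ∞) f S) :
    EqOn (partialWithin S v (partialWithin S w f)) (partialWithin S w (partialWithin S v f)) S := by
  intro p hp
  have hd : DifferentiableWithinAt ℝ (fun q => fderivWithin ℝ f S q) S p :=
    ((hf.fderivWithin hS (m := 1) (by norm_num)).differentiableOn (by norm_num)) p hp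
  have e : ∀ v w : ℝ × ℝ × ℝ, partialWithin S v (partialWithin S w f) p
      = fderivWithin ℝ (fun q => fderivWithin ℝ f S q) S p v w := by
    intro v w
    unfold partialWithin
    rw [fderivWithin_clm_apply (hS p hp) hd (differentiableWithinAt_const w)]
    simp
  rw [e, e]
  exact (hf p hp).isSymmSndFDerivWithinAt (by simp) hS (hSi hp) hp v w

lemma partialWithin_iterate_comm (hSi : S ⊆ closure (interior S)) (n : ℕ)
    (hf : ContDiffOn ℝ ((n + 1 : ℕ) : WithTop ℕ∞) f S) :
    EqOn (partialWithin S w ((partialWithin S v)^[n] f))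
      ((partialWithin S v)^[n] (partialWithin S w f)) S := by
  induction n with
  | zero => exact fun _ _ => rfl
  | succ n ih =>
    have h1 := ih (hf.of_le (by exact_mod_cast Nat.le_succ _))
    have h2 : ContDiffOn ℝ ((2 : ℕ) : WithTop ℕ∞) ((partialWithin S v)^[n] f) S :=
      contDiffOn_partialWithin_iterate hS n (by rwa [show 2 + n = n + 1 + 1 by ring])
    rw [Function.iterate_succ_apply', Function.iterate_succ_apply']
    exact (partialWithin_comm hS hSi h2).trans (eqOn_partialWithin h1)

end partialWithin

/-- `D i j k` plays the role of `∂ₓ^i ∂_y^j ∂ₜ^k` of a function that vanishes on the boundary of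
the box and outside, for `i + j + k ≤ K`; all these derivatives are bounded by `B`. They are taken
up to the boundary, on the domains that matter for the order `α`. -/
structure Family (K : ℕ) (α a b c d T B : ℝ) (D : ℕ → ℕ → ℕ → ℝ → ℝ → ℝ → ℂ) : Prop where
  deriv_x : ∀ i j k, i + j + k < K → ∀ x ∈ dom α a b, ∀ y ∈ dom α c d, ∀ t ∈ Icc 0 T,
    HasDerivWithinAt (fun x => D i j k x y t) (D (i + 1) j k x y t) (dom α a b) x
  deriv_y : ∀ i j k, i + j + k < K → ∀ x ∈ dom α a b, ∀ y ∈ dom α c d, ∀ t ∈ Icc 0 T,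
    HasDerivWithinAt (fun y => D i j k x y t) (D i (j + 1) k x y t) (dom α c d) y
  deriv_t : ∀ i j k, i + j + k < K → ∀ x ∈ dom α a b, ∀ y ∈ dom α c d, ∀ t ∈ Icc 0 T,
    HasDerivWithinAt (fun t => D i j k x y t) (D i j (k + 1) x y t) (Icc 0 T) t
  bound : ∀ i j k, i + j + k ≤ K → ∀ x ∈ dom α a b, ∀ y ∈ dom α c d, ∀ t ∈ Icc 0 T,
    ‖D i j k x y t‖ ≤ B
  zero_x : ∀ i j k, i + j + k ≤ K → i = 0 ∨ α < 2 → ∀ x ∈ dom α a b, x ∉ Ioo a b →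
    ∀ y ∈ dom α c d, ∀ t ∈ Icc 0 T, D i j k x y t = 0
  zero_y : ∀ i j k, i + j + k ≤ K → j = 0 ∨ α < 2 → ∀ x ∈ dom α a b, ∀ y ∈ dom α c d,
    y ∉ Ioo c d → ∀ t ∈ Icc 0 T, D i j k x y t = 0

lemma Family.swap {K : ℕ} {α a b c d T B : ℝ} {D : ℕ → ℕ → ℕ → ℝ → ℝ → ℝ → ℂ}
    (hD : Family K α a b c d T B D) :
    Family K α c d a b T B (fun i j k x y t => D j i k y x t) where
  deriv_x i j k h x hx y hy t ht := hD.deriv_y j i k (by omega) y hy x hx t ht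
  deriv_y i j k h x hx y hy t ht := hD.deriv_x j i k (by omega) y hy x hx t ht
  deriv_t i j k h x hx y hy t ht := hD.deriv_t j i k (by omega) y hy x hx t ht
  bound i j k h x hx y hy t ht := hD.bound j i k (by omega) y hy x hx t ht
  zero_x i j k h h' x hx hx' y hy t ht := hD.zero_y j i k (by omega) h' y hy x hx hx' t ht
  zero_y i j k h h' x hx y hy hy' t ht := hD.zero_x j i k (by omega) h' y hy hy' x hx t ht

lemma eq_zero_of_hasDerivWithinAt {f : ℝ → ℂ} {f' : ℂ} {s : Set ℝ} {x : ℝ}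
    (hs : UniqueDiffWithinAt ℝ s x) (hx : x ∈ s) (h : HasDerivWithinAt f f' s x)
    (h0 : ∀ z ∈ s, f z = 0) : f' = 0 := by
  have h1 : HasDerivWithinAt f 0 s x :=
    (hasDerivWithinAt_const x s (0 : ℂ)).congr h0 (h0 x hx)
  exact hs.eq_deriv s h h1

lemma uniqueDiffOn_dom {α a b : ℝ} (hab : a < b) : UniqueDiffOn ℝ (dom α a b) := by
  unfold dom; split_ifs
  exacts [uniqueDiffOn_univ, uniqueDiffOn_Icc hab]

/-- Vanishing in `x` outside the interval is inherited by the derivatives. -/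
lemma partial_eq_zero {K : ℕ} {α a b c d T : ℝ} (hcd : c < d) (hT : 0 < T)
    {D : ℕ → ℕ → ℕ → ℝ → ℝ → ℝ → ℂ}
    (hx' : ∀ i j k, i + j + k < K → ∀ x ∈ dom α a b, ∀ y ∈ dom α c d, ∀ t ∈ Icc 0 T,
      HasDerivWithinAt (fun x => D i j k x y t) (D (i + 1) j k x y t) (dom α a b) x)
    (hy' : ∀ i j k, i + j + k < K → ∀ x ∈ dom α a b, ∀ y ∈ dom α c d, ∀ t ∈ Icc 0 T,
      HasDerivWithinAt (fun y => D i j k x y t) (D i (j + 1) k x y t) (dom α c d) y)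
    (ht' : ∀ i j k, i + j + k < K → ∀ x ∈ dom α a b, ∀ y ∈ dom α c d, ∀ t ∈ Icc 0 T,
      HasDerivWithinAt (fun t => D i j k x y t) (D i j (k + 1) x y t) (Icc 0 T) t)
    (h0 : ∀ x, x ∉ Ioo a b → ∀ y, ∀ t ∈ Icc 0 T, D 0 0 0 x y t = 0) :
    ∀ i j k, i + j + k ≤ K → i = 0 ∨ α < 2 → ∀ x ∈ dom α a b, x ∉ Ioo a b →
      ∀ y ∈ dom α c d, ∀ t ∈ Icc 0 T, D i j k x y t = 0 := by
  have hk : ∀ k, k ≤ K → ∀ x ∈ dom α a b, x ∉ Ioo a b → ∀ y ∈ dom α c d, ∀ t ∈ Icc 0 T,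
      D 0 0 k x y t = 0 := by
    intro k
    induction k with
    | zero => exact fun _ x _ hx y _ t ht => h0 x hx y t ht
    | succ k ih =>
      intro hk x hx hxa y hy t ht
      exact eq_zero_of_hasDerivWithinAt (uniqueDiffOn_Icc hT t ht) ht
        (ht' 0 0 k (by omega) x hx y hy t ht) fun s hs => ih (by omega) x hx hxa y hy s hs
  have hj : ∀ j k, j + k ≤ K → ∀ x ∈ dom α a b, x ∉ Ioo a b → ∀ y ∈ dom α c d, ∀ t ∈ Icc 0 T,
      D 0 j k x y t = 0 := by
    intro j
    induction j with
    | zero => exact fun k h => hk k (by omega)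
    | succ j ih =>
      intro k h x hx hxa y hy t ht
      exact eq_zero_of_hasDerivWithinAt (uniqueDiffOn_dom hcd y hy) hy
        (hy' 0 j k (by omega) x hx y hy t ht) fun z hz => ih k (by omega) x hx hxa z hz t ht
  intro i
  induction i with
  | zero => exact fun j k h _ => hj j k (by omega)
  | succ i ih =>
    intro j k h h2 x hx hxa y hy t ht
    have hα : α < 2 := by simpa using h2
    have hd := hx' i j k (by omega) x hx y hy t ht
    have hz : ∀ z, z ∉ Ioo a b → D i j k z y t = 0 := fun z hz =>
      ih j k (by omega) (Or.inr hα) z (by simp [dom_of_lt hα]) hz y hy t ht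
    rw [dom_of_lt hα] at hd
    rcases le_or_gt x a with hxl | hxl
    · exact eq_zero_of_hasDerivWithinAt (uniqueDiffOn_Iic a x hxl) hxl (hd.mono (subset_univ _))
        fun z hz' => hz z fun h => not_lt.2 hz' h.1
    · have hxb : b ≤ x := by
        by_contra hcon
        exact hxa ⟨hxl, not_le.1 hcon⟩
      exact eq_zero_of_hasDerivWithinAt (uniqueDiffOn_Ici b x hxb) hxb (hd.mono (subset_univ _))
        fun z hz' => hz z fun h => not_lt.2 hz' h.2

lemma interior_dom_nonempty {α a b : ℝ} (hab : a < b) : (interior (dom α a b)).Nonempty :=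
  ⟨(a + b) / 2, interior_mono (Icc_subset_dom α a b) (by
    rw [interior_Icc]; constructor <;> linarith)⟩

/-- The derivatives of a smooth solution form a family. -/
lemma exists_family (K : ℕ) {α a b c d T : ℝ} {u₀ : ℝ → ℝ → ℂ} {u : ℝ → ℝ → ℝ → ℂ}
    (hα2 : α ≤ 2) (hab : a < b) (hcd : c < d) (hT : 0 < T) (hu : IsSolution α a b c d T u₀ u)
    (hs : IsSmoothOfOrder (K + 1) α a b c d T u) :
    ∃ B D, Family K α a b c d T B D ∧ ∀ x y t, D 0 0 0 x y t = u x y t := by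
  set S : Set (ℝ × ℝ × ℝ) := dom α a b ×ˢ dom α c d ×ˢ Icc 0 T with hSdef
  set g : ℝ × ℝ × ℝ → ℂ := fun p => u p.1 p.2.1 p.2.2 with hg
  have hgS : ContDiffOn ℝ ((K + 1 : ℕ) : WithTop ℕ∞) g S := by
    rcases hα2.lt_or_eq with h | h
    · simpa only [hSdef, dom_of_lt h] using hs.on_plane h
    · have := hs.on_box
      rw [hSdef, h, dom_two, dom_two]; exact this
  have hS : UniqueDiffOn ℝ S :=
    (uniqueDiffOn_dom hab).prod ((uniqueDiffOn_dom hcd).prod (uniqueDiffOn_Icc hT))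
  have hSi : S ⊆ closure (interior S) := by
    have hconv : Convex ℝ S := (convex_dom α a b).prod ((convex_dom α c d).prod (convex_Icc 0 T))
    have hne : (interior S).Nonempty := by
      rw [hSdef, interior_prod_eq, interior_prod_eq]
      refine (interior_dom_nonempty hab).prod ((interior_dom_nonempty hcd).prod ?_)
      rw [interior_Icc]; exact nonempty_Ioo.2 hT
    rw [hconv.closure_interior_eq_closure_of_nonempty_interior hne]
    exact subset_closure
  set X : ℝ × ℝ × ℝ := (1, 0, 0)
  set Y : ℝ × ℝ × ℝ := (0, 1, 0)
  set Z : ℝ × ℝ × ℝ := (0, 0, 1)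
  set E : ℕ → ℕ → ℕ → ℝ × ℝ × ℝ → ℂ := fun i j k =>
    (partialWithin S X)^[i] ((partialWithin S Y)^[j] ((partialWithin S Z)^[k] g)) with hE
  have hEc : ∀ (i j k n : ℕ), n + i + j + k ≤ K + 1 → ContDiffOn ℝ (n : WithTop ℕ∞) (E i j k) S := by
    intro i j k n h
    refine contDiffOn_partialWithin_iterate hS i (contDiffOn_partialWithin_iterate hS j
      (contDiffOn_partialWithin_iterate hS k (hgS.of_le ?_)))
    exact_mod_cast h
  have hEx : ∀ i j k, E (i + 1) j k = partialWithin S X (E i j k) := fun i j k => by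
    simp only [hE, Function.iterate_succ_apply']
  have hEy : ∀ i j k, i + j + k < K → EqOn (E i (j + 1) k) (partialWithin S Y (E i j k)) S := by
    intro i j k h
    have := partialWithin_iterate_comm hS hSi (v := X) (w := Y) i
      (f := (partialWithin S Y)^[j] ((partialWithin S Z)^[k] g)) (by
        refine contDiffOn_partialWithin_iterate hS j
          (contDiffOn_partialWithin_iterate hS k (hgS.of_le ?_))
        exact_mod_cast (by omega : i + 1 + j + k ≤ K + 1))
    simp only [hE, Function.iterate_succ_apply']
    exact this.symm
  have hEz : ∀ i j k, i + j + k < K → EqOn (E i j (k + 1)) (partialWithin S Z (E i j k)) S := by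
    intro i j k h
    have h1 := partialWithin_iterate_comm hS hSi (v := X) (w := Z) i
      (f := (partialWithin S Y)^[j] ((partialWithin S Z)^[k] g)) (by
        refine contDiffOn_partialWithin_iterate hS j
          (contDiffOn_partialWithin_iterate hS k (hgS.of_le ?_))
        exact_mod_cast (by omega : i + 1 + j + k ≤ K + 1))
    have h2 := partialWithin_iterate_comm hS hSi (v := Y) (w := Z) j
      (f := (partialWithin S Z)^[k] g) (by
        refine contDiffOn_partialWithin_iterate hS k (hgS.of_le ?_)
        exact_mod_cast (by omega : j + 1 + k ≤ K + 1))
    simp only [hE, Function.iterate_succ_apply' _ k]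
    exact ((eqOn_partialWithin_iterate h2 i).symm).trans h1.symm
  have hfd : ∀ i j k, i + j + k < K → ∀ p ∈ S,
      HasFDerivWithinAt (E i j k) (fderivWithin ℝ (E i j k) S p) S p := fun i j k h p hp =>
    (((hEc i j k 1 (by omega)).differentiableOn (by norm_num)) p hp).hasFDerivWithinAt
  set D : ℕ → ℕ → ℕ → ℝ → ℝ → ℝ → ℂ := fun i j k x y t => E i j k (x, y, t) with hD
  have hx' : ∀ i j k, i + j + k < K → ∀ x ∈ dom α a b, ∀ y ∈ dom α c d, ∀ t ∈ Icc 0 T,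
      HasDerivWithinAt (fun x => D i j k x y t) (D (i + 1) j k x y t) (dom α a b) x := by
    intro i j k h x hx y hy t ht
    have hc : HasDerivWithinAt (fun x : ℝ => ((x, y, t) : ℝ × ℝ × ℝ)) X (dom α a b) x :=
      (hasDerivWithinAt_id x _).prodMk (hasDerivWithinAt_const x _ _)
    have := (hfd i j k h (x, y, t) ⟨hx, hy, ht⟩).comp_hasDerivWithinAt x hc
      (fun z hz => (⟨hz, hy, ht⟩ : (z, y, t) ∈ S))
    simp only [hD, hEx]
    exact this
  have hy' : ∀ i j k, i + j + k < K → ∀ x ∈ dom α a b, ∀ y ∈ dom α c d, ∀ t ∈ Icc 0 T,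
      HasDerivWithinAt (fun y => D i j k x y t) (D i (j + 1) k x y t) (dom α c d) y := by
    intro i j k h x hx y hy t ht
    have hc : HasDerivWithinAt (fun y : ℝ => ((x, y, t) : ℝ × ℝ × ℝ)) Y (dom α c d) y :=
      (hasDerivWithinAt_const y _ _).prodMk
        ((hasDerivWithinAt_id y _).prodMk (hasDerivWithinAt_const y _ _))
    have := (hfd i j k h (x, y, t) ⟨hx, hy, ht⟩).comp_hasDerivWithinAt y hc
      (fun z hz => (⟨hx, hz, ht⟩ : (x, z, t) ∈ S))
    simp only [hD]
    rw [hEy i j k h ⟨hx, hy, ht⟩]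
    exact this
  have ht' : ∀ i j k, i + j + k < K → ∀ x ∈ dom α a b, ∀ y ∈ dom α c d, ∀ t ∈ Icc 0 T,
      HasDerivWithinAt (fun t => D i j k x y t) (D i j (k + 1) x y t) (Icc 0 T) t := by
    intro i j k h x hx y hy t ht
    have hc : HasDerivWithinAt (fun t : ℝ => ((x, y, t) : ℝ × ℝ × ℝ)) Z (Icc 0 T) t :=
      (hasDerivWithinAt_const t _ _).prodMk
        ((hasDerivWithinAt_const t _ _).prodMk (hasDerivWithinAt_id t _))
    have := (hfd i j k h (x, y, t) ⟨hx, hy, ht⟩).comp_hasDerivWithinAt t hc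
      (fun z hz => (⟨hx, hy, hz⟩ : (x, y, z) ∈ S))
    simp only [hD]
    rw [hEz i j k h ⟨hx, hy, ht⟩]
    exact this
  have hzx := partial_eq_zero hcd hT hx' hy' ht' (fun x hx y t ht =>
    hu.zero_outside x y (fun h => hx h.1) t ht)
  have hzy := partial_eq_zero (K := K) (α := α) (a := c) (b := d) (c := a) (d := b) hab hT
    (D := fun i j k x y t => D j i k y x t)
    (fun i j k h x hx y hy t ht => hy' j i k (by omega) y hy x hx t ht)
    (fun i j k h x hx y hy t ht => hx' j i k (by omega) y hy x hx t ht)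
    (fun i j k h x hx y hy t ht => ht' j i k (by omega) y hy x hx t ht)
    (fun x hx y t ht => hu.zero_outside y x (fun h => hx h.2) t ht)
  obtain ⟨B, hB⟩ : ∃ B, ∀ i j k, i + j + k ≤ K → ∀ x ∈ Icc a b, ∀ y ∈ Icc c d, ∀ t ∈ Icc 0 T,
      ‖D i j k x y t‖ ≤ B := by
    set I := (Finset.range (K + 1) ×ˢ Finset.range (K + 1) ×ˢ Finset.range (K + 1)).filter
      (fun q => q.1 + q.2.1 + q.2.2 ≤ K) with hI
    have hsub : Icc a b ×ˢ Icc c d ×ˢ Icc 0 T ⊆ S :=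
      prod_mono (Icc_subset_dom _ _ _) (prod_mono (Icc_subset_dom _ _ _) subset_rfl)
    have hcont : ContinuousOn (fun p => ∑ q ∈ I, ‖E q.1 q.2.1 q.2.2 p‖)
        (Icc a b ×ˢ Icc c d ×ˢ Icc 0 T) := by
      refine continuousOn_finsetSum _ fun q hq => ContinuousOn.norm ?_
      have hq' : q.1 + q.2.1 + q.2.2 ≤ K := (Finset.mem_filter.1 hq).2
      exact ((hEc q.1 q.2.1 q.2.2 0 (by omega)).continuousOn).mono hsub
    obtain ⟨B, hB⟩ := (isCompact_Icc.prod (isCompact_Icc.prod isCompact_Icc)).exists_bound_of_continuousOn hcont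
    refine ⟨B, fun i j k h x hx y hy t ht => ?_⟩
    have h1 := (le_abs_self _).trans (hB (x, y, t) ⟨hx, hy, ht⟩)
    refine le_trans ?_ h1
    exact Finset.single_le_sum (f := fun q : ℕ × ℕ × ℕ => ‖E q.1 q.2.1 q.2.2 (x, y, t)‖)
      (fun _ _ => norm_nonneg _) (a := (i, j, k))
      (by simp only [hI, Finset.mem_filter, Finset.mem_product, Finset.mem_range]; omega)
  have hB0 : 0 ≤ B := (norm_nonneg _).trans (hB 0 0 0 (by omega) a (left_mem_Icc.2 hab.le) c
    (left_mem_Icc.2 hcd.le) 0 (left_mem_Icc.2 hT.le))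
  refine ⟨B, D, ⟨hx', hy', ht', ?_, hzx, ?_⟩, fun x y t => rfl⟩
  · intro i j k h x hx y hy t ht
    rcases hα2.lt_or_eq with h2 | h2
    · by_cases hx1 : x ∈ Ioo a b
      · by_cases hy1 : y ∈ Ioo c d
        · exact hB i j k h x (Ioo_subset_Icc_self hx1) y (Ioo_subset_Icc_self hy1) t ht
        · have := hzy j i k (by omega) (Or.inr h2) y hy hy1 x hx t ht
          rw [this, norm_zero]; exact hB0
      · rw [hzx i j k h (Or.inr h2) x hx hx1 y hy t ht, norm_zero]; exact hB0
    · rw [h2, dom_two] at hx hy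
      exact hB i j k h x hx y hy t ht
  · intro i j k h h' x hx y hy hy1 t ht
    exact hzy j i k (by omega) h' y hy hy1 x hx t ht

/-! ### Consistency of the scheme -/

lemma diff1_add (α h : ℝ) (M : ℕ) (v w : ℕ → ℂ) (j : ℕ) :
    diff1 α h M (fun s => v s + w s) j = diff1 α h M v j + diff1 α h M w j := by
  simp only [diff1_eq_sum, mul_add, Finset.sum_add_distrib]

lemma diff1_sub (α h : ℝ) (M : ℕ) (v w : ℕ → ℂ) (j : ℕ) :
    diff1 α h M (fun s => v s - w s) j = diff1 α h M v j - diff1 α h M w j := by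
  simp only [diff1_eq_sum, mul_sub, Finset.sum_sub_distrib]

lemma diff1_const_mul (α h : ℝ) (M : ℕ) (r : ℂ) (v : ℕ → ℂ) (j : ℕ) :
    diff1 α h M (fun s => r * v s) j = r * diff1 α h M v j := by
  simp only [diff1_eq_sum, Finset.mul_sum]
  exact Finset.sum_congr rfl fun s _ => by ring

/-- The constant in the bounds for the difference operator. -/
noncomputable def diffConst (a b : ℝ) : ℝ := (3 + (b - a)) * jetConst a b

lemma diffConst_pos {a b : ℝ} (hab : a < b) : 0 < diffConst a b :=
  mul_pos (by linarith) (jetConst_pos hab)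

namespace Family

variable {K : ℕ} {α a b c d T B : ℝ} {D : ℕ → ℕ → ℕ → ℝ → ℝ → ℝ → ℂ}

lemma chain (hD : Family K α a b c d T B D) {j k : ℕ} (hK : 8 + j + k ≤ K) {y t : ℝ}
    (hy : y ∈ dom α c d) (ht : t ∈ Icc 0 T) : Chain α a b B (fun i x => D i j k x y t) where
  deriv i hi x hx := hD.deriv_x i j k (by omega) x hx y hy t ht
  bound i hi x hx := hD.bound i j k (by omega) x hx y hy t ht
  zero i hi h x hx hx' := hD.zero_x i j k (by omega) h x hx hx' y hy t ht

lemma bound_nonneg (hD : Family K α a b c d T B D) (hab : a < b) (hcd : c < d) (hT : 0 ≤ T) :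
    0 ≤ B :=
  (norm_nonneg _).trans (hD.bound 0 0 0 (by omega) a (Icc_subset_dom _ _ _ (left_mem_Icc.2 hab.le))
    c (Icc_subset_dom _ _ _ (left_mem_Icc.2 hcd.le)) 0 (left_mem_Icc.2 hT))

lemma norm_sub_taylor_t_le (hD : Family K α a b c d T B D) {i j k : ℕ} (n : ℕ)
    (hK : i + j + k + n ≤ K) {x y t s : ℝ} (hx : x ∈ dom α a b) (hy : y ∈ dom α c d)
    (ht : t ∈ Icc 0 T) (hs : s ∈ Icc 0 T) :
    ‖D i j k x y s - ∑ l ∈ Finset.range n, (((s - t) ^ l / l.factorial : ℝ) : ℂ) * D i j (k + l) x y t‖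
      ≤ B * |s - t| ^ n :=
  norm_sub_taylor_le (convex_Icc 0 T) ht n (fun l s => D i j (k + l) x y s)
    (fun l hl z hz => hD.deriv_t i j (k + l) (by omega) x hx y hy z hz)
    (fun z hz => hD.bound i j (k + n) (by omega) x hx y hy z hz) s hs

lemma norm_sub_taylor_x_le (hD : Family K α a b c d T B D) {j k : ℕ} (n : ℕ)
    (hK : j + k + n ≤ K) {x p y t : ℝ} (hx : x ∈ dom α a b) (hp : p ∈ dom α a b)
    (hy : y ∈ dom α c d) (ht : t ∈ Icc 0 T) :
    ‖D 0 j k x y t - ∑ l ∈ Finset.range n, (((x - p) ^ l / l.factorial : ℝ) : ℂ) * D l j k p y t‖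
      ≤ B * |x - p| ^ n :=
  norm_sub_taylor_le (convex_dom α a b) hp n (fun l x => D l j k x y t)
    (fun l hl z hz => hD.deriv_x l j k (by omega) z hz y hy t ht)
    (fun z hz => hD.bound n j k (by omega) z hz y hy t ht) x hx

lemma norm_sub_le (hD : Family K α a b c d T B D) {i j k : ℕ}
    (hK : i + j + k + 1 ≤ K) {x y t s : ℝ} (hx : x ∈ dom α a b) (hy : y ∈ dom α c d)
    (ht : t ∈ Icc 0 T) (hs : s ∈ Icc 0 T) :
    ‖D i j k x y s - D i j k x y t‖ ≤ B * |s - t| := by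
  simpa using hD.norm_sub_taylor_t_le 1 hK hx hy ht hs

lemma norm_second_diff_le (hD : Family K α a b c d T B D) {i j k : ℕ}
    (hK : i + j + k + 2 ≤ K) {x y t τ : ℝ} (hx : x ∈ dom α a b) (hy : y ∈ dom α c d)
    (hτ : 0 < τ) (h0 : 0 ≤ t - τ) (h1 : t + τ ≤ T) :
    ‖D i j k x y (t + τ) + D i j k x y (t - τ) - 2 * D i j k x y t‖ ≤ 2 * B * τ ^ 2 := by
  have ht : t ∈ Icc 0 T := ⟨by linarith, by linarith⟩
  have e1 := hD.norm_sub_taylor_t_le 2 hK hx hy ht (s := t + τ) ⟨by linarith, by linarith⟩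
  have e2 := hD.norm_sub_taylor_t_le 2 hK hx hy ht (s := t - τ) ⟨by linarith, by linarith⟩
  have n1 : t + τ - t = τ := by ring
  have n2 : t - τ - t = -τ := by ring
  rw [n1, abs_of_pos hτ] at e1
  rw [n2, abs_neg, abs_of_pos hτ] at e2
  refine le_trans (le_of_eq ?_) ((norm_add_le _ _).trans ((add_le_add e1 e2).trans (by linarith)))
  congr 1
  simp only [Finset.sum_range_succ, Finset.sum_range_zero, Nat.factorial]
  push_cast
  ring_nf

lemma norm_centered_diff_le (hD : Family K α a b c d T B D) (hK : 3 ≤ K) {x y t τ : ℝ}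
    (hx : x ∈ dom α a b) (hy : y ∈ dom α c d)
    (hτ : 0 < τ) (h0 : 0 ≤ t - τ) (h1 : t + τ ≤ T) :
    ‖(D 0 0 0 x y (t + τ) - D 0 0 0 x y (t - τ)) / (2 * τ) - D 0 0 1 x y t‖ ≤ B * τ ^ 2 := by
  have ht : t ∈ Icc 0 T := ⟨by linarith, by linarith⟩
  have e1 := hD.norm_sub_taylor_t_le (i := 0) (j := 0) (k := 0) 3 (by omega) hx hy ht
    (s := t + τ) ⟨by linarith, by linarith⟩
  have e2 := hD.norm_sub_taylor_t_le (i := 0) (j := 0) (k := 0) 3 (by omega) hx hy ht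
    (s := t - τ) ⟨by linarith, by linarith⟩
  have n1 : t + τ - t = τ := by ring
  have n2 : t - τ - t = -τ := by ring
  rw [n1, abs_of_pos hτ] at e1
  rw [n2, abs_neg, abs_of_pos hτ] at e2
  have hτc : (τ : ℂ) ≠ 0 := by exact_mod_cast hτ.ne'
  have e3 := (_root_.norm_sub_le _ _).trans (add_le_add e1 e2)
  have n3 : ‖1 / (2 * (τ : ℂ))‖ = 1 / (2 * τ) := by
    rw [norm_div, norm_mul, Complex.norm_real, Real.norm_of_nonneg hτ.le]; simp
  have e4 := mul_le_mul_of_nonneg_left e3 (by positivity : 0 ≤ 1 / (2 * τ))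
  rw [← n3, ← norm_mul, n3] at e4
  have r : 1 / (2 * τ) * (B * τ ^ 3 + B * τ ^ 3) = B * τ ^ 2 := by field_simp; ring
  rw [r] at e4
  refine le_trans (le_of_eq ?_) e4
  congr 1
  simp only [Finset.sum_range_succ, Finset.sum_range_zero, Nat.factorial]
  push_cast
  field_simp
  ring

/-- The field of differences over two time steps is a family whose bound has gained a factor
`2 τ`. -/
lemma shift (hD : Family (K + 1) α a b c d T B D) {τ : ℝ} (hτ : 0 < τ) :
    Family K α a b c d (T - 2 * τ) (2 * τ * B)
      (fun i j k x y t => D i j k x y (t + 2 * τ) - D i j k x y t) := by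
  have h1 : ∀ t ∈ Icc 0 (T - 2 * τ), t ∈ Icc 0 T := fun t ht => ⟨ht.1, by linarith [ht.2]⟩
  have h2 : ∀ t ∈ Icc 0 (T - 2 * τ), t + 2 * τ ∈ Icc 0 T := fun t ht =>
    ⟨by linarith [ht.1], by linarith [ht.2]⟩
  refine ⟨?_, ?_, ?_, ?_, ?_, ?_⟩
  · intro i j k h x hx y hy t ht
    exact (hD.deriv_x i j k (by omega) x hx y hy _ (h2 t ht)).sub
      (hD.deriv_x i j k (by omega) x hx y hy t (h1 t ht))
  · intro i j k h x hx y hy t ht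
    exact (hD.deriv_y i j k (by omega) x hx y hy _ (h2 t ht)).sub
      (hD.deriv_y i j k (by omega) x hx y hy t (h1 t ht))
  · intro i j k h x hx y hy t ht
    have e1 := (hD.deriv_t i j k (by omega) x hx y hy t (h1 t ht)).mono h1
    have e2 := (hD.deriv_t i j k (by omega) x hx y hy _ (h2 t ht)).scomp t
      ((hasDerivWithinAt_id t (Icc 0 (T - 2 * τ))).add_const (2 * τ)) h2
    rw [one_smul] at e2
    exact e2.sub e1
  · intro i j k h x hx y hy t ht
    refine (hD.norm_sub_le (by omega) hx hy (h1 t ht) (h2 t ht)).trans (le_of_eq ?_)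
    rw [add_sub_cancel_left, abs_of_pos (by linarith)]; ring
  · intro i j k h h' x hx hx' y hy t ht
    rw [hD.zero_x i j k (by omega) h' x hx hx' y hy t (h1 t ht),
      hD.zero_x i j k (by omega) h' x hx hx' y hy _ (h2 t ht), sub_zero]
  · intro i j k h h' x hx y hy hy' t ht
    rw [hD.zero_y i j k (by omega) h' x hx y hy hy' t (h1 t ht),
      hD.zero_y i j k (by omega) h' x hx y hy hy' _ (h2 t ht), sub_zero]

/-- Consistency in one direction: the difference operator applied to the mean of two time levels
against the Riesz derivative at the middle level. -/
lemma norm_diff1_mean_sub_jet_le (hD : Family K α a b c d T B D) (hK : 10 ≤ K) (hab : a < b)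
    (hα : 1 < α) (hα2 : α ≤ 2) {h τ t y : ℝ} {M : ℕ} (hh : h = (b - a) / M) (hh1 : h ≤ 1)
    (hy : y ∈ dom α c d) (hτ : 0 < τ) (h0 : 0 ≤ t - τ) (h1 : t + τ ≤ T) {j : ℕ}
    (hj : j ∈ Finset.Ioo 0 M) :
    ‖diff1 α h M (fun s => (D 0 0 0 (a + s * h) y (t + τ) + D 0 0 0 (a + s * h) y (t - τ)) / 2) j
        - jet α 0 (fun i x => D i 0 0 x y t) (a + j * h)‖ ≤ diffConst a b * B * (τ ^ 2 + h ^ 2) := by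
  have ht : t ∈ Icc 0 T := ⟨by linarith, by linarith⟩
  have hp : t + τ ∈ Icc 0 T := ⟨by linarith, by linarith⟩
  have hm : t - τ ∈ Icc 0 T := ⟨by linarith, by linarith⟩
  have hc := hD.chain (j := 0) (k := 0) (by omega) hy ht
  have hB := hc.bound_nonneg hab
  have hG : Chain α a b (2 * B * τ ^ 2)
      (fun i x => D i 0 0 x y (t + τ) + D i 0 0 x y (t - τ) - 2 * D i 0 0 x y t) := by
    refine ⟨fun i hi x hx => ?_, fun i hi x hx =>
      hD.norm_second_diff_le (by omega) hx hy hτ h0 h1, fun i hi h' x hx hx' => ?_⟩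
    · exact ((hD.deriv_x i 0 0 (by omega) x hx y hy _ hp).add
        (hD.deriv_x i 0 0 (by omega) x hx y hy _ hm)).sub
        ((hD.deriv_x i 0 0 (by omega) x hx y hy t ht).const_mul 2)
    · rw [hD.zero_x i 0 0 (by omega) h' x hx hx' y hy _ hp,
        hD.zero_x i 0 0 (by omega) h' x hx hx' y hy _ hm,
        hD.zero_x i 0 0 (by omega) h' x hx hx' y hy _ ht]
      simp
  have e1 := hG.norm_diff1_le hab hα hα2 hh hh1 hj
  have e2 := hc.norm_diff1_sub_jet_le hab hα hα2 hh hj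
  have e : diff1 α h M (fun s => (D 0 0 0 (a + s * h) y (t + τ) + D 0 0 0 (a + s * h) y (t - τ)) / 2) j
      = 1 / 2 * diff1 α h M (fun s => D 0 0 0 (a + s * h) y (t + τ) + D 0 0 0 (a + s * h) y (t - τ)
          - 2 * D 0 0 0 (a + s * h) y t) j + diff1 α h M (fun s => D 0 0 0 (a + s * h) y t) j := by
    rw [← diff1_const_mul, ← diff1_add]
    congr 1; ext s; ring
  rw [e, add_sub_assoc]
  refine (norm_add_le _ _).trans ?_
  have hn : ‖(1 / 2 : ℂ)‖ = 1 / 2 := by simp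
  rw [norm_mul, hn]
  have hJ := jetConst_pos hab
  have h3 : 0 ≤ jetConst a b * B * h ^ 2 := by positivity
  unfold diffConst
  have e1' := mul_le_mul_of_nonneg_left e1 (by norm_num : (0 : ℝ) ≤ 1 / 2)
  calc _ ≤ 1 / 2 * ((3 + (b - a)) * jetConst a b * (2 * B * τ ^ 2))
        + (2 + (b - a)) * jetConst a b * B * h ^ 2 := add_le_add e1' e2
    _ ≤ _ := by linarith

end Family

/-- The residual of the linear part of the scheme, minus the linear part of the equation. -/
noncomputable def linearResidual (α a c hx hy τ : ℝ) (Mx My : ℕ)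
    (D : ℕ → ℕ → ℕ → ℝ → ℝ → ℝ → ℂ) (t : ℝ) (j k : ℕ) : ℂ :=
  Complex.I * ((D 0 0 0 (a + j * hx) (c + k * hy) (t + τ)
      - D 0 0 0 (a + j * hx) (c + k * hy) (t - τ)) / (2 * τ) - D 0 0 1 (a + j * hx) (c + k * hy) t)
    + (diff2 α hx hy Mx My (onGrid a c hx hy fun x y =>
        (D 0 0 0 x y (t + τ) + D 0 0 0 x y (t - τ)) / 2) j k
      - (jet α 0 (fun i x => D i 0 0 x (c + k * hy) t) (a + j * hx)
        + jet α 0 (fun i y => D 0 i 0 (a + j * hx) y t) (c + k * hy)))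

lemma diff2_onGrid (α a c hx hy : ℝ) (Mx My : ℕ) (w : ℝ → ℝ → ℂ) (j k : ℕ) :
    diff2 α hx hy Mx My (onGrid a c hx hy w) j k
      = diff1 α hx Mx (fun s => w (a + s * hx) (c + k * hy)) j
        + diff1 α hy My (fun s => w (a + j * hx) (c + s * hy)) k := rfl

lemma mem_dom_of_grid {α a b h : ℝ} {M j : ℕ} (hab : a < b) (hh : h = (b - a) / M)
    (hj : j ∈ Finset.Ioo 0 M) : a + j * h ∈ dom α a b := by
  have := Finset.mem_Ioo.1 hj
  exact Icc_subset_dom _ _ _ (Ioo_subset_Icc_self (grid_mem_Ioo (by omega) hab hh hj))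

namespace Family

variable {K : ℕ} {α a b c d T B : ℝ} {D : ℕ → ℕ → ℕ → ℝ → ℝ → ℝ → ℂ}

lemma norm_linearResidual_le (hD : Family K α a b c d T B D) (hK : 10 ≤ K) (hab : a < b)
    (hcd : c < d) (hα : 1 < α) (hα2 : α ≤ 2) {hx hy τ t : ℝ} {Mx My : ℕ}
    (hhx : hx = (b - a) / Mx) (hhx1 : hx ≤ 1) (hhy : hy = (d - c) / My) (hhy1 : hy ≤ 1)
    (hτ : 0 < τ) (h0 : 0 ≤ t - τ) (h1 : t + τ ≤ T) {j k : ℕ}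
    (hj : j ∈ Finset.Ioo 0 Mx) (hk : k ∈ Finset.Ioo 0 My) :
    ‖linearResidual α a c hx hy τ Mx My D t j k‖
      ≤ (1 + diffConst a b + diffConst c d) * B * (τ ^ 2 + hx ^ 2 + hy ^ 2) := by
  have hxm := mem_dom_of_grid (α := α) hab hhx hj
  have hym := mem_dom_of_grid (α := α) hcd hhy hk
  have hB := hD.bound_nonneg hab hcd (by linarith)
  have e1 := hD.norm_centered_diff_le (by omega) hxm hym hτ h0 h1
  have e2 := hD.norm_diff1_mean_sub_jet_le hK hab hα hα2 hhx hhx1 hym hτ h0 h1 hj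
  have e3 := hD.swap.norm_diff1_mean_sub_jet_le hK hcd hα hα2 hhy hhy1 hxm hτ h0 h1 hk
  unfold linearResidual
  rw [diff2_onGrid, add_sub_add_comm]
  refine (norm_add_le _ _).trans ?_
  rw [norm_mul, Complex.norm_I, one_mul]
  refine (add_le_add e1 ((norm_add_le _ _).trans (add_le_add e2 e3))).trans ?_
  have p1 := mul_nonneg (diffConst_pos hab).le hB
  have p2 := mul_nonneg (diffConst_pos hcd).le hB
  have q1 := sq_nonneg τ
  have q2 := sq_nonneg hx
  have q3 := sq_nonneg hy
  nlinarith [mul_nonneg hB q2, mul_nonneg hB q3, mul_nonneg p1 q3, mul_nonneg p2 q2]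

lemma linearResidual_shift (hD : Family K α a b c d T B D) (hK : 8 ≤ K) (hab : a < b)
    (hcd : c < d) (hα : 1 < α) (hα2 : α ≤ 2) {hx hy τ t : ℝ} {Mx My : ℕ}
    (hhx : hx = (b - a) / Mx) (hhy : hy = (d - c) / My)
    (hτ : 0 < τ) (h0 : 0 ≤ t) (h1 : t + 2 * τ ≤ T) {j k : ℕ}
    (hj : j ∈ Finset.Ioo 0 Mx) (hk : k ∈ Finset.Ioo 0 My) :
    linearResidual α a c hx hy τ Mx My
        (fun i j k x y t => D i j k x y (t + 2 * τ) - D i j k x y t) t j k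
      = linearResidual α a c hx hy τ Mx My D (t + 2 * τ) j k
        - linearResidual α a c hx hy τ Mx My D t j k := by
  have hxm := mem_dom_of_grid (α := α) hab hhx hj
  have hym := mem_dom_of_grid (α := α) hcd hhy hk
  have ht : t ∈ Icc 0 T := ⟨by linarith, by linarith⟩
  have hp : t + 2 * τ ∈ Icc 0 T := ⟨by linarith, by linarith⟩
  have j1 := jet_sub hab hα hα2 (hD.chain (j := 0) (k := 0) (by omega) hym hp)
    (hD.chain (j := 0) (k := 0) (by omega) hym ht) (a + j * hx)
  have j2 := jet_sub hcd hα hα2 (hD.swap.chain (j := 0) (k := 0) (by omega) hxm hp)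
    (hD.swap.chain (j := 0) (k := 0) (by omega) hxm ht) (c + k * hy)
  have t1 : t + τ + 2 * τ = t + 2 * τ + τ := by ring
  have t2 : t - τ + 2 * τ = t + 2 * τ - τ := by ring
  have d1 : diff2 α hx hy Mx My (onGrid a c hx hy fun x y =>
      (D 0 0 0 x y (t + 2 * τ + τ) - D 0 0 0 x y (t + τ)
        + (D 0 0 0 x y (t + 2 * τ - τ) - D 0 0 0 x y (t - τ))) / 2) j k
      = diff2 α hx hy Mx My (onGrid a c hx hy fun x y =>
        (D 0 0 0 x y (t + 2 * τ + τ) + D 0 0 0 x y (t + 2 * τ - τ)) / 2) j k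
      - diff2 α hx hy Mx My (onGrid a c hx hy fun x y =>
        (D 0 0 0 x y (t + τ) + D 0 0 0 x y (t - τ)) / 2) j k := by
    rw [diff2_onGrid, diff2_onGrid, diff2_onGrid, add_sub_add_comm, ← diff1_sub, ← diff1_sub]
    congr 2 <;> (ext s; ring)
  unfold linearResidual
  simp only [t1, t2]
  rw [d1, j1, j2]
  ring

end Family

/-! ### The equation up to the initial time and the boundary -/

/-- The family satisfies the equation in the open box for `0 < t < T`. -/
def SolvesEquation (α a b c d T : ℝ) (D : ℕ → ℕ → ℕ → ℝ → ℝ → ℝ → ℂ) : Prop :=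
  ∀ x ∈ Ioo a b, ∀ y ∈ Ioo c d, ∀ t ∈ Ioo 0 T,
    Complex.I * D 0 0 1 x y t
      + (jet α 0 (fun i x => D i 0 0 x y t) x + jet α 0 (fun i y => D 0 i 0 x y t) y)
      + ((‖D 0 0 0 x y t‖ ^ 2 : ℝ) : ℂ) * D 0 0 0 x y t = 0

lemma SolvesEquation.swap {α a b c d T : ℝ} {D : ℕ → ℕ → ℕ → ℝ → ℝ → ℝ → ℂ}
    (h : SolvesEquation α a b c d T D) :
    SolvesEquation α c d a b T (fun i j k x y t => D j i k y x t) := by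
  intro x hx y hy t ht
  have := h y hy x hx t ht
  rw [add_comm (jet α 0 (fun i x_1 => D i 0 0 x_1 x t) y)] at this
  exact this

lemma continuousWithinAt_zero_of_Ioo {f : ℝ → ℂ} {T : ℝ} (hT : 0 < T)
    (hf : ContinuousWithinAt f (Icc 0 T) 0) (h0 : ∀ t ∈ Ioo 0 T, f t = 0) : f 0 = 0 := by
  have h1 : Tendsto f (𝓝[Ioo 0 T] 0) (𝓝 (f 0)) :=
    hf.mono_left (nhdsWithin_mono _ Ioo_subset_Icc_self)
  have h2 : Tendsto f (𝓝[Ioo 0 T] 0) (𝓝 0) :=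
    tendsto_const_nhds.congr' (by filter_upwards [self_mem_nhdsWithin] with t ht using (h0 t ht).symm)
  have : (𝓝[Ioo 0 T] (0 : ℝ)).NeBot := by
    rw [nhdsWithin_Ioo_eq_nhdsGT hT]; infer_instance
  exact tendsto_nhds_unique h1 h2

lemma eq_zero_on_Icc {f : ℝ → ℂ} {a b : ℝ} (hab : a < b) (hf : ContinuousOn f (Icc a b))
    (h0 : ∀ t ∈ Ioo a b, f t = 0) : ∀ t ∈ Icc a b, f t = 0 := by
  have : EqOn f 0 (Icc a b) := by
    refine EqOn.of_subset_closure (s := Ioo a b) h0 hf continuousOn_const Ioo_subset_Icc_self ?_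
    rw [closure_Ioo hab.ne]
  exact this

namespace Family

variable {K : ℕ} {α a b c d T B : ℝ} {D : ℕ → ℕ → ℕ → ℝ → ℝ → ℝ → ℂ}

lemma solvesEquation {u₀ : ℝ → ℝ → ℂ} {u : ℝ → ℝ → ℝ → ℂ} (hab : a < b) (hcd : c < d)
    (hα : 1 < α) (hα2 : α ≤ 2) (hK : 8 ≤ K)
    (hD : Family K α a b c d T B D) (hu : IsSolution α a b c d T u₀ u)
    (huD : ∀ x y t, D 0 0 0 x y t = u x y t) : SolvesEquation α a b c d T D := by
  intro x hx y hy t ht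
  have hxd := Icc_subset_dom α _ _ (Ioo_subset_Icc_self hx)
  have hyd := Icc_subset_dom α _ _ (Ioo_subset_Icc_self hy)
  have htd := Ioo_subset_Icc_self ht
  have h := hu.equation x hx y hy t ht
  have e1 := (hD.chain (j := 0) (k := 0) (by omega) hyd htd).riesz_eq_jet hab hα hα2 hx
  have e2 := (hD.swap.chain (j := 0) (k := 0) (by omega) hxd htd).riesz_eq_jet hcd hα hα2 hy
  have e3 : deriv (fun s => u x y s) t = D 0 0 1 x y t := by
    have := (hD.deriv_t 0 0 0 (by omega) x hxd y hyd t htd).hasDerivAt (Icc_mem_nhds ht.1 ht.2)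
    simp only [huD] at this
    exact this.deriv
  simp only [huD] at e1 e2
  rw [riesz2, e1, e2, e3] at h
  rw [huD]
  exact h

lemma continuousWithinAt_jet (hD : Family K α a b c d T B D) (hab : a < b) (hα : 1 < α)
    (hα2 : α ≤ 2) (hK : 9 ≤ K) {x y t : ℝ} (hx : x ∈ dom α a b) (hy : y ∈ dom α c d)
    (ht : t ∈ Icc 0 T) :
    ContinuousWithinAt (fun t => jet α 0 (fun i x => D i 0 0 x y t) x) (Icc 0 T) t := by
  have hlip : ∀ s ∈ Icc 0 T, ‖jet α 0 (fun i x => D i 0 0 x y s) x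
      - jet α 0 (fun i x => D i 0 0 x y t) x‖ ≤ jetConst a b * (B * |s - t|) := by
    intro s hs
    have c1 := hD.chain (j := 0) (k := 0) (by omega) hy hs
    have c2 := hD.chain (j := 0) (k := 0) (by omega) hy ht
    rw [← jet_sub hab hα hα2 c1 c2]
    exact (c1.sub c2 (B' := B * |s - t|) fun i hi x hx =>
      hD.norm_sub_le (by omega) hx hy ht hs).norm_jet_le hab hα hα2 (by norm_num) hx
  rw [ContinuousWithinAt, tendsto_iff_norm_sub_tendsto_zero]
  have hlim : Tendsto (fun s : ℝ => jetConst a b * (B * |s - t|)) (𝓝[Icc 0 T] t) (𝓝 0) := by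
    have : Continuous fun s : ℝ => jetConst a b * (B * |s - t|) := by fun_prop
    have h2 := this.tendsto t
    simp only [sub_self, abs_zero, mul_zero] at h2
    exact h2.mono_left nhdsWithin_le_nhds
  refine tendsto_of_tendsto_of_tendsto_of_le_of_le' tendsto_const_nhds hlim
    (Eventually.of_forall fun _ => norm_nonneg _) ?_
  filter_upwards [self_mem_nhdsWithin] with s hs using hlip s hs

/-- The equation holds at the initial time. -/
lemma equation_zero (hD : Family K α a b c d T B D) (hab : a < b) (hcd : c < d) (hT : 0 < T)
    (hα : 1 < α) (hα2 : α ≤ 2) (hK : 9 ≤ K) (hE : SolvesEquation α a b c d T D) {x y : ℝ}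
    (hx : x ∈ Ioo a b) (hy : y ∈ Ioo c d) :
    Complex.I * D 0 0 1 x y 0
      + (jet α 0 (fun i x => D i 0 0 x y 0) x + jet α 0 (fun i y => D 0 i 0 x y 0) y)
      + ((‖D 0 0 0 x y 0‖ ^ 2 : ℝ) : ℂ) * D 0 0 0 x y 0 = 0 := by
  have hxd := Icc_subset_dom α _ _ (Ioo_subset_Icc_self hx)
  have hyd := Icc_subset_dom α _ _ (Ioo_subset_Icc_self hy)
  have h0 : (0 : ℝ) ∈ Icc 0 T := left_mem_Icc.2 hT.le
  refine continuousWithinAt_zero_of_Ioo (f := fun t => Complex.I * D 0 0 1 x y t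
      + (jet α 0 (fun i x => D i 0 0 x y t) x + jet α 0 (fun i y => D 0 i 0 x y t) y)
      + ((‖D 0 0 0 x y t‖ ^ 2 : ℝ) : ℂ) * D 0 0 0 x y t) hT ?_ fun t ht => hE x hx y hy t ht
  have c1 := (hD.deriv_t 0 0 1 (by omega) x hxd y hyd 0 h0).continuousWithinAt
  have c0 := (hD.deriv_t 0 0 0 (by omega) x hxd y hyd 0 h0).continuousWithinAt
  have cx := hD.continuousWithinAt_jet hab hα hα2 hK hxd hyd h0
  have cy := hD.swap.continuousWithinAt_jet hcd hα hα2 hK hyd hxd h0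
  have cn : ContinuousWithinAt (fun t => ((‖D 0 0 0 x y t‖ ^ 2 : ℝ) : ℂ)) (Icc 0 T) 0 :=
    Complex.continuous_ofReal.continuousAt.comp_continuousWithinAt (c0.norm.pow 2)
  exact ((continuousWithinAt_const.mul c1).add (cx.add cy)).add (cn.mul c0)

/-- For the Laplacian the equation forces the second normal derivative to vanish on the
boundary. -/
lemma second_deriv_boundary (hD : Family K 2 a b c d T B D) (hab : a < b) (hcd : c < d) (hT : 0 < T)
    (hK : 4 ≤ K) (hE : SolvesEquation 2 a b c d T D) {p : ℝ} (hp : p = a ∨ p = b) :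
    ∀ y ∈ Icc c d, ∀ t ∈ Icc 0 T, D 2 0 0 p y t = 0 := by
  have hpm : p ∈ Icc a b := by
    rcases hp with rfl | rfl
    exacts [left_mem_Icc.2 hab.le, right_mem_Icc.2 hab.le]
  have hpo : p ∉ Ioo a b := by rcases hp with rfl | rfl <;> simp
  have hpd := Icc_subset_dom 2 a b hpm
  have step1 : ∀ y ∈ Ioo c d, ∀ t ∈ Ioo 0 T, D 2 0 0 p y t = 0 := by
    intro y hy t ht
    have hyd := Icc_subset_dom 2 _ _ (Ioo_subset_Icc_self hy)
    have htd := Ioo_subset_Icc_self ht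
    have cont : ∀ i j k, i + j + k < K → ContinuousOn (fun x => D i j k x y t) (Icc a b) := by
      intro i j k h x hx
      have := (hD.deriv_x i j k h x (Icc_subset_dom 2 a b hx) y hyd t htd).continuousWithinAt
      rwa [dom_two] at this
    have cn : ContinuousOn (fun x => ((‖D 0 0 0 x y t‖ ^ 2 : ℝ) : ℂ)) (Icc a b) :=
      Complex.continuous_ofReal.comp_continuousOn ((cont 0 0 0 (by omega)).norm.pow 2)
    have h := eq_zero_on_Icc hab (f := fun x => Complex.I * D 0 0 1 x y t
        + (D 2 0 0 x y t + D 0 2 0 x y t) + ((‖D 0 0 0 x y t‖ ^ 2 : ℝ) : ℂ) * D 0 0 0 x y t)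
      (((continuousOn_const.mul (cont 0 0 1 (by omega))).add ((cont 2 0 0 (by omega)).add
        (cont 0 2 0 (by omega)))).add (cn.mul (cont 0 0 0 (by omega))))
      (fun x hx => by
        have := hE x hx y hy t ht
        simpa only [jet, lt_irrefl, if_false, add_zero] using this) p hpm
    simp only [hD.zero_x 0 0 1 (by omega) (Or.inl rfl) p hpd hpo y hyd t htd,
      hD.zero_x 0 2 0 (by omega) (Or.inl rfl) p hpd hpo y hyd t htd,
      hD.zero_x 0 0 0 (by omega) (Or.inl rfl) p hpd hpo y hyd t htd, mul_zero, add_zero,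
      zero_add] at h
    exact h
  have step2 : ∀ y ∈ Ioo c d, ∀ t ∈ Icc 0 T, D 2 0 0 p y t = 0 := by
    intro y hy
    have hyd := Icc_subset_dom 2 _ _ (Ioo_subset_Icc_self hy)
    exact eq_zero_on_Icc hT (fun t ht => (hD.deriv_t 2 0 0 (by omega) p hpd y hyd t ht).continuousWithinAt)
      (step1 y hy)
  intro y hy t ht
  refine eq_zero_on_Icc hcd (f := fun y => D 2 0 0 p y t) (fun y hy => ?_)
    (fun y hy => step2 y hy t ht) y hy
  have := (hD.deriv_y 2 0 0 (by omega) p hpd y (Icc_subset_dom _ _ _ hy) t ht).continuousWithinAt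
  rwa [dom_two] at this

/-- The Riesz derivative in `x` of the initial value is linear in the distance to the boundary up to
a cubic error. By the equation it is a combination of the time derivative and the Riesz derivative
in `y`, which have this property, and of the nonlinear term, which is itself cubic. -/
lemma exists_norm_jet_sub_le (hD : Family K α a b c d T B D) (hab : a < b) (hcd : c < d) (hT : 0 < T)
    (hα : 1 < α) (hα2 : α ≤ 2) (hK : 11 ≤ K) (hE : SolvesEquation α a b c d T D) {p : ℝ}
    (hp : p = a ∨ p = b) {y : ℝ} (hy : y ∈ Ioo c d) :
    ∃ (l : ℂ) (C : ℝ), ∀ x ∈ Ioo a b,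
      ‖jet α 0 (fun i x => D i 0 0 x y 0) x - l * (x - p)‖ ≤ C * |x - p| ^ 3 := by
  have hpm : p ∈ Icc a b := by
    rcases hp with rfl | rfl
    exacts [left_mem_Icc.2 hab.le, right_mem_Icc.2 hab.le]
  have hpo : p ∉ Ioo a b := by rcases hp with rfl | rfl <;> simp
  have hpd := Icc_subset_dom α a b hpm
  have hyc := Ioo_subset_Icc_self hy
  have hyd := Icc_subset_dom α _ _ hyc
  have h0 : (0 : ℝ) ∈ Icc 0 T := left_mem_Icc.2 hT.le
  have hB := hD.bound_nonneg hab hcd hT.le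
  have hu : ∀ x ∈ Ioo a b, ‖((‖D 0 0 0 x y 0‖ ^ 2 : ℝ) : ℂ) * D 0 0 0 x y 0‖ ≤ B ^ 3 * |x - p| ^ 3 := by
    intro x hx
    have hxd := Icc_subset_dom α _ _ (Ioo_subset_Icc_self hx)
    have h1 := hD.norm_sub_taylor_x_le (j := 0) (k := 0) 1 (by omega) hxd hpd hyd h0
    simp only [Finset.sum_range_one, pow_zero, pow_one,
      hD.zero_x 0 0 0 (by omega) (Or.inl rfl) p hpd hpo y hyd 0 h0, mul_zero, sub_zero] at h1
    rw [norm_mul, Complex.norm_real, Real.norm_of_nonneg (by positivity), ← pow_succ, ← mul_pow]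
    gcongr
  have hmain : ∃ (l : ℂ) (C : ℝ), ∀ x ∈ Ioo a b, ‖Complex.I * D 0 0 1 x y 0
      + jet α 0 (fun i y => D 0 i 0 x y 0) y - l * (x - p)‖ ≤ C * |x - p| ^ 3 := by
    rcases hα2.lt_or_eq with h2 | h2
    · have hcub : ∀ j k, j + k + 3 ≤ K → ∀ x ∈ dom α a b, ∀ y ∈ dom α c d,
          ‖D 0 j k x y 0‖ ≤ B * |x - p| ^ 3 := by
        intro j k h x hx y hy
        have h1 := hD.norm_sub_taylor_x_le (j := j) (k := k) 3 (by omega) hx hpd hy h0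
        rw [Finset.sum_eq_zero, sub_zero] at h1
        · exact h1
        · intro l hl
          rw [Finset.mem_range] at hl
          rw [hD.zero_x l j k (by omega) (Or.inr h2) p hpd hpo y hy 0 h0, mul_zero]
      refine ⟨0, B + jetConst c d * B, fun x hx => ?_⟩
      have hxd := Icc_subset_dom α _ _ (Ioo_subset_Icc_self hx)
      have hc : Chain α c d (B * |x - p| ^ 3) (fun i y => D 0 i 0 x y 0) := by
        have := hD.swap.chain (j := 0) (k := 0) (by omega) hxd h0
        exact ⟨this.deriv, fun i hi z hz => hcub i 0 (by omega) x hxd z hz, this.zero⟩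
      have e1 := hcub 0 1 (by omega) x hxd y hyd
      have e2 := hc.norm_jet_le hcd hα hα2 (p := 0) (by norm_num) hyd
      rw [zero_mul, sub_zero]
      refine (norm_add_le _ _).trans ?_
      rw [norm_mul, Complex.norm_I, one_mul]
      linarith
    · subst h2
      have hz2 := hD.second_deriv_boundary hab hcd hT (by omega) hE hp
      have hz1 : ∀ t ∈ Icc 0 T, D 2 0 1 p y t = 0 := fun t ht =>
        eq_zero_of_hasDerivWithinAt (uniqueDiffOn_Icc hT t ht) ht
          (hD.deriv_t 2 0 0 (by omega) p hpd y hyd t ht) fun s hs => hz2 y hyc s hs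
      have hy1 : ∀ z ∈ Icc c d, D 2 1 0 p z 0 = 0 := by
        intro z hz
        have := hD.deriv_y 2 0 0 (by omega) p hpd z (Icc_subset_dom _ _ _ hz) 0 h0
        rw [dom_two] at this
        exact eq_zero_of_hasDerivWithinAt (uniqueDiffOn_Icc hcd z hz) hz this fun s hs =>
          hz2 s hs 0 h0
      have hy2 : D 2 2 0 p y 0 = 0 := by
        have := hD.deriv_y 2 1 0 (by omega) p hpd y hyd 0 h0
        rw [dom_two] at this
        exact eq_zero_of_hasDerivWithinAt (uniqueDiffOn_Icc hcd y hyc) hyc this hy1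
      refine ⟨Complex.I * D 1 0 1 p y 0 + D 1 2 0 p y 0, B + B, fun x hx => ?_⟩
      have hxd := Icc_subset_dom 2 _ _ (Ioo_subset_Icc_self hx)
      have e1 := hD.norm_sub_taylor_x_le (j := 0) (k := 1) 3 (by omega) hxd hpd hyd h0
      have e2 := hD.norm_sub_taylor_x_le (j := 2) (k := 0) 3 (by omega) hxd hpd hyd h0
      simp only [Finset.sum_range_succ, Finset.sum_range_zero, Nat.factorial,
        hD.zero_x 0 0 1 (by omega) (Or.inl rfl) p hpd hpo y hyd 0 h0,
        hD.zero_x 0 2 0 (by omega) (Or.inl rfl) p hpd hpo y hyd 0 h0, hz1 0 h0, hy2, mul_zero,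
        add_zero, zero_add] at e1 e2
      rw [← one_mul ‖D 0 0 1 x y 0 - _‖, ← Complex.norm_I, ← norm_mul] at e1
      have e3 := (norm_add_le _ _).trans (add_le_add e1 e2)
      rw [← add_mul] at e3
      refine le_trans (le_of_eq ?_) e3
      congr 1
      simp only [jet, lt_irrefl, if_false, add_zero]
      push_cast
      ring
  obtain ⟨l, C, hl⟩ := hmain
  refine ⟨-l, C + B ^ 3, fun x hx => ?_⟩
  have e1 := hD.equation_zero hab hcd hT hα hα2 (by omega) hE hx hy
  have e : jet α 0 (fun i x => D i 0 0 x y 0) x - -l * (x - p)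
      = -(Complex.I * D 0 0 1 x y 0 + jet α 0 (fun i y => D 0 i 0 x y 0) y - l * (x - p))
        - ((‖D 0 0 0 x y 0‖ ^ 2 : ℝ) : ℂ) * D 0 0 0 x y 0 := by
    linear_combination e1
  rw [e]
  refine (_root_.norm_sub_le _ _).trans ?_
  rw [norm_neg]
  linarith [hl x hx, hu x hx]

/-- By the equation, the second derivative of the Riesz derivative of the initial value vanishes on
the boundary. -/
lemma jet_two_boundary (hD : Family K α a b c d T B D) (hab : a < b) (hcd : c < d) (hT : 0 < T)
    (hα : 1 < α) (hα2 : α ≤ 2) (hK : 11 ≤ K) (hE : SolvesEquation α a b c d T D) {p : ℝ}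
    (hp : p = a ∨ p = b) {y : ℝ} (hy : y ∈ Ioo c d) : jet α 2 (fun i x => D i 0 0 x y 0) p = 0 := by
  obtain ⟨l, C, hl⟩ := hD.exists_norm_jet_sub_le hab hcd hT hα hα2 hK hE hp hy
  have hc := hD.chain (j := 0) (k := 0) (by omega) (Icc_subset_dom α _ _ (Ioo_subset_Icc_self hy))
    (left_mem_Icc.2 hT.le)
  exact second_deriv_eq_zero hab (ψ := fun q => jet α q (fun i x => D i 0 0 x y 0)) hp
    (fun q hq x hx => hc.hasDerivWithinAt_jet hab hα hα2 hq hx)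
    (fun x hx => hc.norm_jet_le hab hα hα2 le_rfl (Icc_subset_dom _ _ _ hx)) hl

end Family

/-! ### The error of the first step -/

/-- The truncation error at the initial time, in the first space direction. -/
noncomputable def truncation (α a h : ℝ) (M : ℕ) (D : ℕ → ℕ → ℕ → ℝ → ℝ → ℝ → ℂ) (y : ℝ)
    (j : ℕ) : ℂ :=
  diff1 α h M (fun s => D 0 0 0 (a + s * h) y 0) j - jet α 0 (fun i x => D i 0 0 x y 0) (a + j * h)

/-- The remainder of the first order Taylor expansion in time at the initial time. -/
noncomputable def timeRemainder (D : ℕ → ℕ → ℕ → ℝ → ℝ → ℝ → ℂ) (τ x y : ℝ) : ℂ :=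
  D 0 0 0 x y τ - D 0 0 0 x y 0 - τ * D 0 0 1 x y 0

/-- The error of the explicit first step of the scheme. -/
noncomputable def firstError (α a c hx hy τ : ℝ) (Mx My : ℕ)
    (D : ℕ → ℕ → ℕ → ℝ → ℝ → ℝ → ℂ) (j k : ℕ) : ℂ :=
  D 0 0 0 (a + j * hx) (c + k * hy) τ - (D 0 0 0 (a + j * hx) (c + k * hy) 0
    + τ * (Complex.I * diff2 α hx hy Mx My (onGrid a c hx hy fun x y => D 0 0 0 x y 0) j k
      + Complex.I * ((‖D 0 0 0 (a + j * hx) (c + k * hy) 0‖ ^ 2 : ℝ) : ℂ)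
        * D 0 0 0 (a + j * hx) (c + k * hy) 0))

namespace Family

variable {K : ℕ} {α a b c d T B : ℝ} {D : ℕ → ℕ → ℕ → ℝ → ℝ → ℝ → ℂ}

lemma firstError_eq (hD : Family K α a b c d T B D) (hab : a < b) (hcd : c < d) (hT : 0 < T)
    (hα : 1 < α) (hα2 : α ≤ 2) (hK : 9 ≤ K) (hE : SolvesEquation α a b c d T D)
    {hx hy : ℝ} (τ : ℝ) {Mx My : ℕ} (hhx : hx = (b - a) / Mx) (hhy : hy = (d - c) / My) {j k : ℕ}
    (hj : j ∈ Finset.Ioo 0 Mx) (hk : k ∈ Finset.Ioo 0 My) :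
    firstError α a c hx hy τ Mx My D j k
      = timeRemainder D τ (a + j * hx) (c + k * hy)
        - Complex.I * τ * (truncation α a hx Mx D (c + k * hy) j
          + truncation α c hy My (fun i j k x y t => D j i k y x t) (a + j * hx) k) := by
  have hxm := grid_mem_Ioo (by have := Finset.mem_Ioo.1 hj; omega) hab hhx hj
  have hym := grid_mem_Ioo (by have := Finset.mem_Ioo.1 hk; omega) hcd hhy hk
  have h := hD.equation_zero hab hcd hT hα hα2 hK hE hxm hym
  unfold firstError timeRemainder truncation
  rw [diff2_onGrid]
  linear_combination (-Complex.I * τ) * h + τ * D 0 0 1 (a + j * hx) (c + k * hy) 0 * Complex.I_sq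

lemma norm_timeRemainder_le (hD : Family K α a b c d T B D) (hT : 0 < T) {i : ℕ} (hK : i + 2 ≤ K)
    {τ x y : ℝ} (hτ : 0 < τ) (hτT : τ ≤ T) (hx : x ∈ dom α a b) (hy : y ∈ dom α c d) :
    ‖D i 0 0 x y τ - D i 0 0 x y 0 - τ * D i 0 1 x y 0‖ ≤ B * τ ^ 2 := by
  have := hD.norm_sub_taylor_t_le (i := i) (j := 0) (k := 0) 2 (by omega) hx hy
    (left_mem_Icc.2 hT.le) (s := τ) ⟨hτ.le, hτT⟩
  rw [sub_zero, abs_of_pos hτ] at this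
  refine le_trans (le_of_eq ?_) this
  congr 1
  simp only [Finset.sum_range_succ, Finset.sum_range_zero, Nat.factorial]
  push_cast
  ring

lemma norm_diff1_timeRemainder_le (hD : Family K α a b c d T B D) (hab : a < b) (hT : 0 < T)
    (hα : 1 < α) (hα2 : α ≤ 2) (hK : 10 ≤ K) {h τ y : ℝ} (hτ : 0 < τ) (hτT : τ ≤ T) {M : ℕ}
    (hh : h = (b - a) / M) (hh1 : h ≤ 1) (hy : y ∈ dom α c d) {j : ℕ} (hj : j ∈ Finset.Ioo 0 M) :
    ‖diff1 α h M (fun s => timeRemainder D τ (a + s * h) y) j‖ ≤ diffConst a b * (B * τ ^ 2) := by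
  have h0 : (0 : ℝ) ∈ Icc 0 T := left_mem_Icc.2 hT.le
  have ht : τ ∈ Icc 0 T := ⟨hτ.le, hτT⟩
  have hc : Chain α a b (B * τ ^ 2) (fun i x => D i 0 0 x y τ - D i 0 0 x y 0 - τ * D i 0 1 x y 0) := by
    refine ⟨fun i hi x hx => ?_, fun i hi x hx =>
      hD.norm_timeRemainder_le hT (by omega) hτ hτT hx hy, fun i hi h' x hx hx' => ?_⟩
    · exact ((hD.deriv_x i 0 0 (by omega) x hx y hy _ ht).sub
        (hD.deriv_x i 0 0 (by omega) x hx y hy _ h0)).sub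
        ((hD.deriv_x i 0 1 (by omega) x hx y hy _ h0).const_mul _)
    · rw [hD.zero_x i 0 0 (by omega) h' x hx hx' y hy _ ht,
        hD.zero_x i 0 0 (by omega) h' x hx hx' y hy _ h0,
        hD.zero_x i 0 1 (by omega) h' x hx hx' y hy _ h0]
      simp
  exact hc.norm_diff1_le hab hα hα2 hh hh1 hj

lemma norm_truncation_le (hD : Family K α a b c d T B D) (hab : a < b) (hT : 0 < T)
    (hα : 1 < α) (hα2 : α ≤ 2) (hK : 8 ≤ K) {h y : ℝ} {M : ℕ} (hh : h = (b - a) / M)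
    (hy : y ∈ dom α c d) {j : ℕ} (hj : j ∈ Finset.Ioo 0 M) :
    ‖truncation α a h M D y j‖ ≤ diffConst a b * B * h ^ 2 := by
  have hc := hD.chain (j := 0) (k := 0) (by omega) hy (left_mem_Icc.2 hT.le)
  have hB := hc.bound_nonneg hab
  refine (hc.norm_diff1_sub_jet_le hab hα hα2 hh hj).trans ?_
  have hJ := jetConst_pos hab
  unfold diffConst
  gcongr
  norm_num

/-- The difference operator in `y` acts on the truncation error in `x` as a linear combination of
functions of `x`, whose truncation error is again of second order. -/
lemma norm_diff1_truncation_cross_le (hD : Family K α a b c d T B D) (hab : a < b) (hcd : c < d)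
    (hT : 0 < T) (hα : 1 < α) (hα2 : α ≤ 2) (hK : 16 ≤ K) {hx hy : ℝ} {Mx My : ℕ}
    (hhx : hx = (b - a) / Mx) (hhy : hy = (d - c) / My) (hhy1 : hy ≤ 1) {j k : ℕ}
    (hj : j ∈ Finset.Ioo 0 Mx) (hk : k ∈ Finset.Ioo 0 My) :
    ‖diff1 α hy My (fun s => truncation α a hx Mx D (c + s * hy) j) k‖
      ≤ diffConst a b * (diffConst c d * B) * hx ^ 2 := by
  have h0 : (0 : ℝ) ∈ Icc 0 T := left_mem_Icc.2 hT.le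
  have hchains : ∀ s ∈ Finset.Ioo 0 My, Chain α a b B (fun i x => D i 0 0 x (c + s * hy) 0) :=
    fun s hs => hD.chain (j := 0) (k := 0) (by omega) (mem_dom_of_grid hcd hhy hs) h0
  set w : ℕ → ℂ := fun s => ((-(1 / hy ^ α * coeff α ((k : ℤ) - (s : ℤ))) : ℝ) : ℂ) with hw
  have hsum : Chain α a b (diffConst c d * B)
      (fun i x => ∑ s ∈ Finset.Ioo 0 My, w s * D i 0 0 x (c + s * hy) 0) := by
    refine Chain.sum hchains fun i hi x hx => ?_
    have hc := hD.swap.chain (j := i) (k := 0) (by omega) hx h0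
    have := hc.norm_diff1_le hcd hα hα2 hhy hhy1 hk
    rwa [diff1_eq_sum] at this
  have hle := hsum.norm_diff1_sub_jet_le hab hα hα2 hhx hj
  have e : diff1 α hy My (fun s => truncation α a hx Mx D (c + s * hy) j) k
      = diff1 α hx Mx (fun s => ∑ q ∈ Finset.Ioo 0 My, w q * D 0 0 0 (a + s * hx) (c + q * hy) 0) j
        - jet α 0 (fun i x => ∑ s ∈ Finset.Ioo 0 My, w s * D i 0 0 x (c + s * hy) 0) (a + j * hx) := by
    rw [jet_sum hab hα hα2 hchains]
    unfold truncation
    rw [diff1_eq_sum α hy]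
    simp only [mul_sub, Finset.sum_sub_distrib]
    congr 1
    simp only [diff1_eq_sum, Finset.mul_sum]
    rw [Finset.sum_comm]
    refine Finset.sum_congr rfl fun s _ => Finset.sum_congr rfl fun q _ => ?_
    simp only [hw]; ring
  rw [e]
  refine hle.trans ?_
  have hJ := jetConst_pos hab
  have hJ' := diffConst_pos hcd
  have hB := hD.bound_nonneg hab hcd hT.le
  unfold diffConst at hJ' ⊢
  gcongr
  norm_num

/-- One direction of the difference operator applied to the error of the first step. -/
lemma exists_norm_diff1_firstError_le (hD : Family K α a b c d T B D) (hab : a < b) (hcd : c < d)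
    (hT : 0 < T) (hα : 1 < α) (hα2 : α ≤ 2) (hK : 16 ≤ K) (hE : SolvesEquation α a b c d T D) :
    ∃ C, 0 < C ∧ ∀ (hx hy τ : ℝ) (Mx My : ℕ), hx = (b - a) / Mx → hx ≤ 1 → hy = (d - c) / My →
      hy ≤ 1 → 0 < τ → τ ≤ T → τ ≤ 1 → ∀ j ∈ Finset.Ioo 0 Mx, ∀ k ∈ Finset.Ioo 0 My,
      ‖diff1 α hx Mx (fun s => timeRemainder D τ (a + s * hx) (c + k * hy)
        - Complex.I * τ * (truncation α a hx Mx D (c + k * hy) s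
          + truncation α c hy My (fun i j k x y t => D j i k y x t) (a + s * hx) k)) j‖
        ≤ C * (τ ^ 2 + hx ^ 2 + hy ^ 2) := by
  obtain ⟨C, hC, htr⟩ := exists_norm_diff1_truncation_le hab hα hα2
  have hB := hD.bound_nonneg hab hcd hT.le
  have hda := diffConst_pos hab
  have hdc := diffConst_pos hcd
  refine ⟨diffConst a b * B + C * B + diffConst c d * (diffConst a b * B) + 1, by positivity, ?_⟩
  intro hx hy τ Mx My hhx hhx1 hhy hhy1 hτ hτT hτ1 j hj k hk
  have hym := grid_mem_Ioo (by have := Finset.mem_Ioo.1 hk; omega) hcd hhy hk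
  have hyd := mem_dom_of_grid (α := α) hcd hhy hk
  have hx0 : 0 < hx := by
    have := Finset.mem_Ioo.1 hj
    have hM' : (0 : ℝ) < Mx := by exact_mod_cast (by omega : 0 < Mx)
    rw [hhx]; apply div_pos <;> linarith
  rw [diff1_sub, diff1_const_mul, diff1_add]
  have e1 := hD.norm_diff1_timeRemainder_le hab hT hα hα2 (by omega) hτ hτT hhx hhx1 hyd hj
  have e2 := htr B _ (hD.chain (j := 0) (k := 0) (by omega) hyd (left_mem_Icc.2 hT.le))
    (hD.jet_two_boundary hab hcd hT hα hα2 (by omega) hE (Or.inl rfl) hym)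
    (hD.jet_two_boundary hab hcd hT hα hα2 (by omega) hE (Or.inr rfl) hym) hx Mx hhx hhx1 j hj
  have e3 := hD.swap.norm_diff1_truncation_cross_le hcd hab hT hα hα2 hK hhy hhx hhx1 hk hj
  refine (_root_.norm_sub_le _ _).trans ?_
  have hn : ‖Complex.I * (τ : ℂ)‖ = τ := by
    rw [norm_mul, Complex.norm_I, one_mul, Complex.norm_real, Real.norm_of_nonneg hτ.le]
  rw [norm_mul, hn]
  have e4 := mul_le_mul_of_nonneg_left ((norm_add_le _ _).trans (add_le_add e2 e3)) hτ.le
  refine (add_le_add e1 e4).trans ?_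
  set P := diffConst a b * B with hP
  set Q := C * B with hQ
  set R := diffConst c d * P with hR
  have hP0 : 0 ≤ P := by positivity
  have hQ0 : 0 ≤ Q := by positivity
  have hR0 : 0 ≤ R := by positivity
  have s1 := sq_nonneg τ
  have s2 := sq_nonneg hx
  have s3 := sq_nonneg hy
  have t1 : τ * hx ≤ τ ^ 2 + hx ^ 2 := by nlinarith [sq_nonneg (τ - hx)]
  have t2 : τ * hy ^ 2 ≤ hy ^ 2 := by nlinarith
  have u1 := mul_le_mul_of_nonneg_left t1 hQ0
  have u2 := mul_le_mul_of_nonneg_left t2 hR0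
  have v1 := mul_nonneg hP0 s2
  have v2 := mul_nonneg hP0 s3
  have v3 := mul_nonneg hQ0 s3
  have v4 := mul_nonneg hR0 s1
  have v5 := mul_nonneg hR0 s2
  have l1 : diffConst a b * (B * τ ^ 2) = P * τ ^ 2 := by rw [hP]; ring
  rw [l1]
  nlinarith

lemma exists_norm_firstError_le (hD : Family K α a b c d T B D) (hab : a < b) (hcd : c < d)
    (hT : 0 < T) (hα : 1 < α) (hα2 : α ≤ 2) (hK : 16 ≤ K) (hE : SolvesEquation α a b c d T D) :
    ∃ C, 0 < C ∧ ∀ (hx hy τ : ℝ) (Mx My : ℕ), hx = (b - a) / Mx → hx ≤ 1 → hy = (d - c) / My →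
      hy ≤ 1 → 0 < τ → τ ≤ T → τ ≤ 1 → ∀ j ∈ Finset.Ioo 0 Mx, ∀ k ∈ Finset.Ioo 0 My,
      ‖firstError α a c hx hy τ Mx My D j k‖ ≤ C * (τ ^ 2 + hx ^ 2 + hy ^ 2) ∧
      ‖diff2 α hx hy Mx My (firstError α a c hx hy τ Mx My D) j k‖
        ≤ C * (τ ^ 2 + hx ^ 2 + hy ^ 2) := by
  obtain ⟨C₁, hC₁, h₁⟩ := hD.exists_norm_diff1_firstError_le hab hcd hT hα hα2 hK hE
  obtain ⟨C₂, hC₂, h₂⟩ := hD.swap.exists_norm_diff1_firstError_le hcd hab hT hα hα2 hK hE.swap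
  have hB := hD.bound_nonneg hab hcd hT.le
  have hda := diffConst_pos hab
  have hdc := diffConst_pos hcd
  refine ⟨C₁ + C₂ + (1 + diffConst a b + diffConst c d) * B, by positivity, ?_⟩
  intro hx hy τ Mx My hhx hhx1 hhy hhy1 hτ hτT hτ1 j hj k hk
  have hxd := mem_dom_of_grid (α := α) hab hhx hj
  have hyd := mem_dom_of_grid (α := α) hcd hhy hk
  have feq := fun j hj k hk => hD.firstError_eq hab hcd hT hα hα2 (by omega) hE τ hhx hhy (j := j)
    (k := k) hj hk
  have s1 := sq_nonneg τ
  have s2 := sq_nonneg hx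
  have s3 := sq_nonneg hy
  have hε : 0 ≤ τ ^ 2 + hx ^ 2 + hy ^ 2 := by positivity
  constructor
  · rw [feq j hj k hk]
    have e1 := hD.norm_timeRemainder_le hT (i := 0) (by omega) hτ hτT hxd hyd
    have e2 := hD.norm_truncation_le hab hT hα hα2 (by omega) hhx hyd hj
    have e3 := hD.swap.norm_truncation_le hcd hT hα hα2 (by omega) hhy hxd hk
    have hn : ‖Complex.I * (τ : ℂ)‖ = τ := by
      rw [norm_mul, Complex.norm_I, one_mul, Complex.norm_real, Real.norm_of_nonneg hτ.le]
    have e4 := mul_le_mul hτ1 ((norm_add_le _ _).trans (add_le_add e2 e3)) (norm_nonneg _) zero_le_one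
    rw [← hn, ← norm_mul, one_mul] at e4
    refine (_root_.norm_sub_le _ _).trans ((add_le_add e1 e4).trans ?_)
    have hP0 : 0 ≤ diffConst a b * B := by positivity
    have hQ0 : 0 ≤ diffConst c d * B := by positivity
    have m1 : 0 ≤ (C₁ + C₂) * (τ ^ 2 + hx ^ 2 + hy ^ 2) := by positivity
    nlinarith [mul_nonneg hB s2, mul_nonneg hB s3, mul_nonneg hP0 s1, mul_nonneg hP0 s3,
      mul_nonneg hQ0 s1, mul_nonneg hQ0 s2]
  · have e1 := h₁ hx hy τ Mx My hhx hhx1 hhy hhy1 hτ hτT hτ1 j hj k hk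
    have e2 := h₂ hy hx τ My Mx hhy hhy1 hhx hhx1 hτ hτT hτ1 k hk j hj
    rw [← diff1_congr (fun s hs => feq s hs k hk)] at e1
    have e2' : ‖diff1 α hy My (fun s => firstError α a c hx hy τ Mx My D j s) k‖
        ≤ C₂ * (τ ^ 2 + hy ^ 2 + hx ^ 2) := by
      rw [diff1_congr (fun s hs => feq j hj s hs)]
      refine le_trans (le_of_eq ?_) e2
      congr 2; ext s
      rw [add_comm (truncation α a hx Mx D _ _)]
      rfl
    refine (norm_add_le _ _).trans ((add_le_add e1 e2').trans ?_)
    have : 0 ≤ (1 + diffConst a b + diffConst c d) * B * (τ ^ 2 + hx ^ 2 + hy ^ 2) := by positivity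
    nlinarith

end Family

/-! ### The residual of the nonlinear scheme -/

/-- The residual left by the exact solution in the three-level scheme. -/
noncomputable def schemeResidual (α a c hx hy τ : ℝ) (Mx My : ℕ)
    (D : ℕ → ℕ → ℕ → ℝ → ℝ → ℝ → ℂ) (t : ℝ) (j k : ℕ) : ℂ :=
  Complex.I * ((D 0 0 0 (a + j * hx) (c + k * hy) (t + τ)
      - D 0 0 0 (a + j * hx) (c + k * hy) (t - τ)) / (2 * τ))
    + diff2 α hx hy Mx My (onGrid a c hx hy fun x y =>
        (D 0 0 0 x y (t + τ) + D 0 0 0 x y (t - τ)) / 2) j k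
    + ((‖D 0 0 0 (a + j * hx) (c + k * hy) t‖ ^ 2 : ℝ) : ℂ)
      * ((D 0 0 0 (a + j * hx) (c + k * hy) (t + τ) + D 0 0 0 (a + j * hx) (c + k * hy) (t - τ)) / 2)

lemma abs_sq_norm_sub_le (z w : ℂ) : |‖z‖ ^ 2 - ‖w‖ ^ 2| ≤ (‖z‖ + ‖w‖) * ‖z - w‖ := by
  rw [sq_sub_sq, abs_mul, abs_of_nonneg (by positivity)]
  gcongr
  exact abs_norm_sub_norm_le z w

namespace Family

variable {K : ℕ} {α a b c d T B : ℝ} {D : ℕ → ℕ → ℕ → ℝ → ℝ → ℝ → ℂ}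

lemma schemeResidual_eq (hE : SolvesEquation α a b c d T D) (hab : a < b) (hcd : c < d)
    {hx hy τ t : ℝ} {Mx My : ℕ} (hhx : hx = (b - a) / Mx) (hhy : hy = (d - c) / My)
    (ht : t ∈ Ioo 0 T) {j k : ℕ} (hj : j ∈ Finset.Ioo 0 Mx) (hk : k ∈ Finset.Ioo 0 My) :
    schemeResidual α a c hx hy τ Mx My D t j k = linearResidual α a c hx hy τ Mx My D t j k
      + ((‖D 0 0 0 (a + j * hx) (c + k * hy) t‖ ^ 2 : ℝ) : ℂ)
        * ((D 0 0 0 (a + j * hx) (c + k * hy) (t + τ) + D 0 0 0 (a + j * hx) (c + k * hy) (t - τ)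
          - 2 * D 0 0 0 (a + j * hx) (c + k * hy) t) / 2) := by
  have hxm := grid_mem_Ioo (by have := Finset.mem_Ioo.1 hj; omega) hab hhx hj
  have hym := grid_mem_Ioo (by have := Finset.mem_Ioo.1 hk; omega) hcd hhy hk
  have h := hE _ hxm _ hym t ht
  unfold schemeResidual linearResidual
  linear_combination h

/-- The residual is of second order, and so, with an additional factor `τ`, are its increments over
two time steps. -/
lemma exists_norm_schemeResidual_le (hD : Family (K + 1) α a b c d T B D) (hab : a < b)
    (hcd : c < d) (hT : 0 < T) (hα : 1 < α) (hα2 : α ≤ 2) (hK : 10 ≤ K)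
    (hE : SolvesEquation α a b c d T D) :
    ∃ C, 0 < C ∧ ∀ (hx hy τ : ℝ) (Mx My : ℕ), hx = (b - a) / Mx → hx ≤ 1 → hy = (d - c) / My →
      hy ≤ 1 → 0 < τ → ∀ j ∈ Finset.Ioo 0 Mx, ∀ k ∈ Finset.Ioo 0 My,
      (∀ t, 0 ≤ t - τ → t + τ ≤ T →
        ‖schemeResidual α a c hx hy τ Mx My D t j k‖ ≤ C * (τ ^ 2 + hx ^ 2 + hy ^ 2)) ∧
      (∀ t, 0 ≤ t - τ → t + 3 * τ ≤ T →
        ‖schemeResidual α a c hx hy τ Mx My D (t + 2 * τ) j k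
          - schemeResidual α a c hx hy τ Mx My D t j k‖ ≤ C * (τ * (τ ^ 2 + hx ^ 2 + hy ^ 2))) := by
  have hB := hD.bound_nonneg hab hcd hT.le
  have hda := diffConst_pos hab
  have hdc := diffConst_pos hcd
  set L := 1 + diffConst a b + diffConst c d with hL
  have hL0 : 0 < L := by positivity
  refine ⟨2 * (L * B) + 6 * B ^ 3 + 1, by positivity, ?_⟩
  intro hx hy τ Mx My hhx hhx1 hhy hhy1 hτ j hj k hk
  have hxd := mem_dom_of_grid (α := α) hab hhx hj
  have hyd := mem_dom_of_grid (α := α) hcd hhy hk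
  set ε := τ ^ 2 + hx ^ 2 + hy ^ 2 with hε
  have hτε : τ ^ 2 ≤ ε := by rw [hε]; nlinarith [sq_nonneg hx, sq_nonneg hy]
  have hε0 : 0 ≤ ε := (sq_nonneg τ).trans hτε
  set x := a + j * hx with hxdef
  set y := c + k * hy with hydef
  have hhalf : ∀ z : ℂ, ‖z / 2‖ = ‖z‖ / 2 := fun z => by rw [norm_div]; simp
  have hB3 : 0 ≤ B ^ 3 := by positivity
  have hLB : 0 ≤ L * B := by positivity
  constructor
  · intro t h0 h1
    rw [schemeResidual_eq hE hab hcd hhx hhy ⟨by linarith, by linarith⟩ hj hk]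
    have e1 := hD.norm_linearResidual_le (by omega) hab hcd hα hα2 hhx hhx1 hhy hhy1 hτ h0 h1 hj hk
    have e2 := hD.norm_second_diff_le (i := 0) (j := 0) (k := 0) (by omega) hxd hyd hτ h0 h1
    have e3 := hD.bound 0 0 0 (by omega) x hxd y hyd t ⟨by linarith, by linarith⟩
    refine (norm_add_le _ _).trans ?_
    rw [norm_mul, hhalf, Complex.norm_real, Real.norm_of_nonneg (by positivity)]
    have e4 : ‖D 0 0 0 x y t‖ ^ 2
        * (‖D 0 0 0 x y (t + τ) + D 0 0 0 x y (t - τ) - 2 * D 0 0 0 x y t‖ / 2)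
        ≤ B ^ 2 * ((2 * B * τ ^ 2) / 2) := by gcongr
    have e5 : B ^ 2 * ((2 * B * τ ^ 2) / 2) ≤ B ^ 3 * ε := by
      calc _ = B ^ 3 * τ ^ 2 := by ring
        _ ≤ _ := by gcongr
    nlinarith [mul_nonneg hLB hε0, mul_nonneg hB3 hε0]
  · intro t h0 h1
    have hW := hD.shift hτ
    have e1 := hW.norm_linearResidual_le (by omega) hab hcd hα hα2 hhx hhx1 hhy hhy1 hτ h0
      (by linarith) hj hk
    rw [hD.linearResidual_shift (by omega) hab hcd hα hα2 hhx hhy hτ (by linarith)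
      (by linarith) hj hk] at e1
    rw [schemeResidual_eq hE hab hcd hhx hhy ⟨by linarith, by linarith⟩ hj hk,
      schemeResidual_eq hE hab hcd hhx hhy ⟨by linarith, by linarith⟩ hj hk]
    have ht : t ∈ Icc 0 T := ⟨by linarith, by linarith⟩
    have hp : t + 2 * τ ∈ Icc 0 T := ⟨by linarith, by linarith⟩
    have a1 := hD.bound 0 0 0 (by omega) x hxd y hyd t ht
    have a2 := hD.bound 0 0 0 (by omega) x hxd y hyd _ hp
    have a3 := hD.norm_sub_le (i := 0) (j := 0) (k := 0) (by omega) hxd hyd ht hp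
    rw [add_sub_cancel_left, abs_of_pos (by linarith : (0 : ℝ) < 2 * τ)] at a3
    have a4 := hD.norm_second_diff_le (i := 0) (j := 0) (k := 0) (by omega) hxd hyd hτ
      (t := t + 2 * τ) (by linarith) (by linarith)
    have a5 := hW.norm_second_diff_le (i := 0) (j := 0) (k := 0) (by omega) hxd hyd hτ
      (t := t) (by linarith) (by linarith)
    have t1 : t + τ + 2 * τ = t + 2 * τ + τ := by ring
    have t2 : t - τ + 2 * τ = t + 2 * τ - τ := by ring
    simp only [t1, t2] at a5
    set u := D 0 0 0 x y t
    set v := D 0 0 0 x y (t + 2 * τ)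
    set up := D 0 0 0 x y (t + τ)
    set um := D 0 0 0 x y (t - τ)
    set vp := D 0 0 0 x y (t + 2 * τ + τ)
    set vm := D 0 0 0 x y (t + 2 * τ - τ)
    set l1 := linearResidual α a c hx hy τ Mx My D (t + 2 * τ) j k
    set l0 := linearResidual α a c hx hy τ Mx My D t j k
    have e : l1 + ((‖v‖ ^ 2 : ℝ) : ℂ) * ((vp + vm - 2 * v) / 2)
        - (l0 + ((‖u‖ ^ 2 : ℝ) : ℂ) * ((up + um - 2 * u) / 2))
        = (l1 - l0) + (((‖v‖ ^ 2 - ‖u‖ ^ 2 : ℝ) : ℂ) * ((vp + vm - 2 * v) / 2)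
          + ((‖u‖ ^ 2 : ℝ) : ℂ) * ((vp - up + (vm - um) - 2 * (v - u)) / 2)) := by
      push_cast; ring
    rw [e]
    refine (norm_add_le _ _).trans ((add_le_add e1 (norm_add_le _ _)).trans ?_)
    rw [norm_mul, norm_mul, hhalf, hhalf, Complex.norm_real, Complex.norm_real, Real.norm_eq_abs,
      Real.norm_of_nonneg (by positivity : 0 ≤ ‖u‖ ^ 2)]
    have b1 : |‖v‖ ^ 2 - ‖u‖ ^ 2| ≤ (B + B) * (B * (2 * τ)) :=
      (abs_sq_norm_sub_le v u).trans (by gcongr)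
    have b2 : |‖v‖ ^ 2 - ‖u‖ ^ 2| * (‖vp + vm - 2 * v‖ / 2)
        ≤ (B + B) * (B * (2 * τ)) * ((2 * B * τ ^ 2) / 2) := by gcongr
    have b3 : ‖u‖ ^ 2 * (‖vp - up + (vm - um) - 2 * (v - u)‖ / 2)
        ≤ B ^ 2 * ((2 * (2 * τ * B) * τ ^ 2) / 2) := by gcongr
    have b4 : B ^ 3 * (τ * τ ^ 2) ≤ B ^ 3 * (τ * ε) := by gcongr
    have hτε0 : 0 ≤ τ * ε := by positivity
    have b5 : L * (2 * τ * B) * ε = 2 * (L * B) * (τ * ε) := by ring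
    rw [b5]
    have b6 : (B + B) * (B * (2 * τ)) * ((2 * B * τ ^ 2) / 2) + B ^ 2 * ((2 * (2 * τ * B) * τ ^ 2) / 2)
        = 6 * (B ^ 3 * (τ * τ ^ 2)) := by ring
    have b7 : (2 * (L * B) + 6 * B ^ 3 + 1) * (τ * ε)
        = 2 * (L * B) * (τ * ε) + 6 * (B ^ 3 * (τ * ε)) + τ * ε := by ring
    linarith

end Family

/-! ### The error of the nonlinear term -/

/-- The difference of the cubic terms of the exact and the discrete equation, for the exact value
`u`, its error `e`, and the means `s`, `r` of the exact values and of the errors at the neighbouring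
time levels. -/
noncomputable def cubicDiff (u e s r : ℂ) : ℂ :=
  ((‖u‖ ^ 2 : ℝ) : ℂ) * s - ((‖u - e‖ ^ 2 : ℝ) : ℂ) * (s - r)

lemma norm_ofReal_sq_sub_le {B : ℝ} {z w : ℂ} (hz : ‖z‖ ≤ B) (hw : ‖w‖ ≤ B) :
    ‖((‖z‖ ^ 2 - ‖w‖ ^ 2 : ℝ) : ℂ)‖ ≤ 2 * B * ‖z - w‖ := by
  rw [Complex.norm_real, Real.norm_eq_abs]
  refine (abs_sq_norm_sub_le z w).trans ?_
  gcongr; linarith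

lemma norm_cubicDiff_le {B : ℝ} {u e s r : ℂ} (hu : ‖u‖ ≤ B) (hs : ‖s‖ ≤ B) (he : ‖e‖ ≤ 1) :
    ‖cubicDiff u e s r‖ ≤ 2 * (B + 1) ^ 2 * (‖e‖ + ‖r‖) := by
  have hB : 0 ≤ B := (norm_nonneg u).trans hu
  have hue : ‖u - e‖ ≤ B + 1 := (norm_sub_le _ _).trans (add_le_add hu he)
  have e1 : cubicDiff u e s r
      = ((‖u‖ ^ 2 - ‖u - e‖ ^ 2 : ℝ) : ℂ) * s + ((‖u - e‖ ^ 2 : ℝ) : ℂ) * r := by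
    unfold cubicDiff; push_cast; ring
  have h1 := norm_ofReal_sq_sub_le (z := u) (w := u - e) (hu.trans (by linarith : B ≤ B + 1)) hue
  rw [sub_sub_cancel] at h1
  rw [e1]
  refine (norm_add_le _ _).trans ?_
  rw [norm_mul, norm_mul, Complex.norm_real (‖u - e‖ ^ 2), Real.norm_of_nonneg (by positivity)]
  have h2 : ‖((‖u‖ ^ 2 - ‖u - e‖ ^ 2 : ℝ) : ℂ)‖ * ‖s‖ ≤ 2 * (B + 1) * ‖e‖ * (B + 1) := by
    gcongr; linarith
  have h3 : ‖u - e‖ ^ 2 * ‖r‖ ≤ (B + 1) ^ 2 * ‖r‖ := by gcongr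
  nlinarith [mul_nonneg (sq_nonneg (B + 1)) (norm_nonneg r)]

/-- Lipschitz bound for differences over two time steps. The bound `1` is not required of the error
`r`, the only one that involves the new time level. -/
lemma norm_cubicDiff_sub_le {B δ : ℝ} {u e s r u' e' s' r' : ℂ} (hu : ‖u‖ ≤ B) (hs : ‖s‖ ≤ B)
    (he : ‖e‖ ≤ 1) (hu' : ‖u'‖ ≤ B) (he' : ‖e'‖ ≤ 1) (hr' : ‖r'‖ ≤ 1)
    (huu : ‖u - u'‖ ≤ δ) (hss : ‖s - s'‖ ≤ δ) :
    ‖cubicDiff u e s r - cubicDiff u' e' s' r'‖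
      ≤ 6 * (B + 1) ^ 2 * (‖e - e'‖ + ‖r - r'‖) + 6 * (B + 1) * δ * (‖e'‖ + ‖r'‖) := by
  have hB : 0 ≤ B := (norm_nonneg u).trans hu
  have hδ : 0 ≤ δ := (norm_nonneg _).trans huu
  have hue : ‖u - e‖ ≤ B + 1 := (norm_sub_le _ _).trans (add_le_add hu he)
  have hue' : ‖u' - e'‖ ≤ B + 1 := (norm_sub_le _ _).trans (add_le_add hu' he')
  set q : ℝ := ‖u‖ ^ 2 - ‖u - e‖ ^ 2 with hq
  set q' : ℝ := ‖u'‖ ^ 2 - ‖u' - e'‖ ^ 2 with hq'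
  have e1 : cubicDiff u e s r - cubicDiff u' e' s' r'
      = ((q - q' : ℝ) : ℂ) * s + (q' : ℂ) * (s - s')
        + (((‖u - e‖ ^ 2 - ‖u' - e'‖ ^ 2 : ℝ) : ℂ) * r' + ((‖u - e‖ ^ 2 : ℝ) : ℂ) * (r - r')) := by
    simp only [cubicDiff, hq, hq']; push_cast; ring
  -- `|u|² - |u - e|² = 2 Re (u ē) - |e|²`
  have hqe : ∀ z w : ℂ, ‖z‖ ^ 2 - ‖z - w‖ ^ 2 = 2 * (z * starRingEnd ℂ w).re - ‖w‖ ^ 2 := by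
    intro z w
    simp only [← Complex.normSq_eq_norm_sq, Complex.normSq_apply, Complex.sub_re, Complex.sub_im,
      Complex.mul_re, Complex.conj_re, Complex.conj_im]
    ring
  have h1 : |q - q'| ≤ 2 * (B + 1) * ‖e - e'‖ + 2 * δ * ‖e'‖ := by
    have e2 : q - q' = 2 * (u * starRingEnd ℂ (e - e') + (u - u') * starRingEnd ℂ e').re
        - (‖e‖ ^ 2 - ‖e'‖ ^ 2) := by
      rw [hq, hq', hqe, hqe]
      have : u * starRingEnd ℂ (e - e') + (u - u') * starRingEnd ℂ e'
          = u * starRingEnd ℂ e - u' * starRingEnd ℂ e' := by rw [map_sub]; ring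
      rw [this, Complex.sub_re]; ring
    rw [e2]
    have h2 : |(u * starRingEnd ℂ (e - e') + (u - u') * starRingEnd ℂ e').re|
        ≤ B * ‖e - e'‖ + δ * ‖e'‖ := by
      refine (Complex.abs_re_le_norm _).trans ((norm_add_le _ _).trans ?_)
      rw [norm_mul, norm_mul, RCLike.norm_conj, RCLike.norm_conj]
      gcongr
    have h3 : |‖e‖ ^ 2 - ‖e'‖ ^ 2| ≤ 2 * ‖e - e'‖ := by
      refine (abs_sq_norm_sub_le e e').trans ?_
      gcongr; linarith
    refine (abs_sub _ _).trans ?_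
    rw [abs_mul, abs_two]
    linarith
  have h4 : ‖(q' : ℂ)‖ ≤ 2 * (B + 1) * ‖e'‖ := by
    have := norm_ofReal_sq_sub_le (z := u') (w := u' - e') (hu'.trans (by linarith : B ≤ B + 1)) hue'
    rwa [sub_sub_cancel] at this
  have h5 : ‖((‖u - e‖ ^ 2 - ‖u' - e'‖ ^ 2 : ℝ) : ℂ)‖ ≤ 2 * (B + 1) * (δ + ‖e - e'‖) := by
    refine (norm_ofReal_sq_sub_le hue hue').trans ?_
    gcongr
    have : u - e - (u' - e') = (u - u') - (e - e') := by ring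
    rw [this]
    exact (norm_sub_le _ _).trans (by gcongr)
  have h6 : ‖((q - q' : ℝ) : ℂ) * s‖ ≤ (2 * (B + 1) * ‖e - e'‖ + 2 * δ * ‖e'‖) * (B + 1) := by
    rw [norm_mul, Complex.norm_real, Real.norm_eq_abs]
    gcongr; linarith
  have h7 : ‖(q' : ℂ) * (s - s')‖ ≤ 2 * (B + 1) * ‖e'‖ * δ := by
    rw [norm_mul]; gcongr
  have h8 : ‖((‖u - e‖ ^ 2 - ‖u' - e'‖ ^ 2 : ℝ) : ℂ) * r'‖
      ≤ 2 * (B + 1) * δ * ‖r'‖ + 2 * (B + 1) * ‖e - e'‖ := by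
    rw [norm_mul]
    calc _ ≤ 2 * (B + 1) * (δ + ‖e - e'‖) * ‖r'‖ := by gcongr
      _ = 2 * (B + 1) * δ * ‖r'‖ + 2 * (B + 1) * ‖e - e'‖ * ‖r'‖ := by ring
      _ ≤ 2 * (B + 1) * δ * ‖r'‖ + 2 * (B + 1) * ‖e - e'‖ * 1 := by gcongr
      _ = _ := by ring
  have h9 : ‖((‖u - e‖ ^ 2 : ℝ) : ℂ) * (r - r')‖ ≤ (B + 1) ^ 2 * ‖r - r'‖ := by
    rw [norm_mul, Complex.norm_real, Real.norm_of_nonneg (by positivity)]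
    gcongr
  rw [e1]
  refine (norm_add_le _ _).trans ((add_le_add (norm_add_le _ _) (norm_add_le _ _)).trans ?_)
  refine (add_le_add (add_le_add h6 h7) (add_le_add h8 h9)).trans ?_
  have hB1 : B + 1 ≤ (B + 1) ^ 2 := by nlinarith
  have p1 := mul_le_mul_of_nonneg_right hB1 (norm_nonneg (e - e'))
  have p2 : 0 ≤ (B + 1) ^ 2 * ‖r - r'‖ := by positivity
  have p3 : 0 ≤ (B + 1) * δ * ‖e'‖ := by positivity
  have p4 : 0 ≤ (B + 1) * δ * ‖r'‖ := by positivity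
  have p5 : 0 ≤ (B + 1) ^ 2 * ‖e - e'‖ := by positivity
  nlinarith

/-! ### From pointwise bounds to Euclidean norms -/

/-- Pointwise domination passes to Euclidean norms, with the number of points in the constant
term. -/
lemma norm_le_sum_of_pointwise {ι : Type*} [Fintype ι] {n : ℕ} (V : EuclideanSpace ℂ ι)
    (W : Fin n → EuclideanSpace ℂ ι) (w : Fin n → ℝ) (hw : ∀ i, 0 ≤ w i) {r : ℝ} (hr : 0 ≤ r)
    (h : ∀ p, ‖V p‖ ≤ ∑ i, w i * ‖W i p‖ + r) :
    ‖V‖ ≤ ∑ i, w i * ‖W i‖ + r * √(Fintype.card ι) := by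
  set A : EuclideanSpace ℂ ι → EuclideanSpace ℝ ι := fun X => WithLp.toLp 2 fun p => ‖X p‖ with hA
  have hAn : ∀ X, ‖A X‖ = ‖X‖ := fun X => by simp [hA, EuclideanSpace.norm_eq]
  set one : EuclideanSpace ℝ ι := WithLp.toLp 2 fun _ => 1 with hone
  have h1 : ‖one‖ = √(Fintype.card ι) := by simp [hone, EuclideanSpace.norm_eq]
  have hle : ‖V‖ ≤ ‖∑ i, w i • A (W i) + r • one‖ := by
    rw [EuclideanSpace.norm_eq, EuclideanSpace.norm_eq]
    refine Real.sqrt_le_sqrt (Finset.sum_le_sum fun p _ => ?_)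
    have e : (∑ i, w i • A (W i) + r • one) p = ∑ i, w i * ‖W i p‖ + r := by
      simp [hA, hone]
    rw [e]
    exact pow_le_pow_left₀ (norm_nonneg _) ((h p).trans (le_abs_self _)) 2
  refine hle.trans ((norm_add_le _ _).trans (add_le_add ((norm_sum_le _ _).trans ?_) ?_))
  · refine Finset.sum_le_sum fun i _ => ?_
    rw [norm_smul, hAn, Real.norm_of_nonneg (hw i)]
  · rw [norm_smul, h1, Real.norm_of_nonneg hr]

lemma norm_le_of_pointwise {ι : Type*} [Fintype ι] (V : EuclideanSpace ℂ ι) {r : ℝ} (hr : 0 ≤ r)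
    (h : ∀ p, ‖V p‖ ≤ r) : ‖V‖ ≤ r * √(Fintype.card ι) := by
  simpa using norm_le_sum_of_pointwise V (n := 0) (fun i => i.elim0) (fun i => i.elim0)
    (fun i => i.elim0) hr (by simpa using h)

lemma sqrt_card_grid_le {a b c d hx hy : ℝ} (hab : a < b) (hcd : c < d) {Mx My : ℕ} (hMx : 0 < Mx)
    (hMy : 0 < My) (hhx : hx = (b - a) / Mx) (hhy : hy = (d - c) / My) :
    √(Fintype.card (Grid Mx My)) ≤ √((b - a) * (d - c) / (hx * hy)) := by
  apply Real.sqrt_le_sqrt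
  have h1 : (0 : ℝ) < Mx := by exact_mod_cast hMx
  have h2 : (0 : ℝ) < My := by exact_mod_cast hMy
  have h3 : 0 < b - a := by linarith
  have h4 : 0 < d - c := by linarith
  have e : (b - a) * (d - c) / (hx * hy) = (Mx * My : ℕ) := by
    rw [hhx, hhy]; push_cast; field_simp
  rw [e]
  have : Fintype.card (Grid Mx My) = (Mx - 1) * (My - 1) := by
    simp [Grid, Fintype.card_prod, Nat.card_Ioo]
  rw [this]
  exact_mod_cast Nat.mul_le_mul (Nat.sub_le _ _) (Nat.sub_le _ _)

lemma diff2_sub (α hx hy : ℝ) (Mx My : ℕ) (V W : ℕ → ℕ → ℂ) (j k : ℕ) :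
    diff2 α hx hy Mx My (fun j k => V j k - W j k) j k
      = diff2 α hx hy Mx My V j k - diff2 α hx hy Mx My W j k := by
  have e : ∀ V : ℕ → ℕ → ℂ, diff2 α hx hy Mx My V j k
      = diff1 α hx Mx (fun s => V s k) j + diff1 α hy My (fun s => V j s) k := fun V => rfl
  rw [e, e, e, diff1_sub, diff1_sub]; ring

lemma diff2_mean (α hx hy : ℝ) (Mx My : ℕ) (V W : ℕ → ℕ → ℂ) (j k : ℕ) :
    diff2 α hx hy Mx My (fun j k => (V j k + W j k) / 2) j k
      = (diff2 α hx hy Mx My V j k + diff2 α hx hy Mx My W j k) / 2 := by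
  have e : ∀ V : ℕ → ℕ → ℂ, diff2 α hx hy Mx My V j k
      = diff1 α hx Mx (fun s => V s k) j + diff1 α hy My (fun s => V j s) k := fun V => rfl
  have h : ∀ z w : ℂ, (z + w) / 2 = 1 / 2 * (z + w) := fun z w => by ring
  simp only [e, h, diff1_const_mul, diff1_add]; ring

lemma diff2_congr {α hx hy : ℝ} {Mx My : ℕ} {V W : ℕ → ℕ → ℂ}
    (h : ∀ j ∈ Finset.Ioo 0 Mx, ∀ k ∈ Finset.Ioo 0 My, V j k = W j k) {j k : ℕ}
    (hj : j ∈ Finset.Ioo 0 Mx) (hk : k ∈ Finset.Ioo 0 My) :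
    diff2 α hx hy Mx My V j k = diff2 α hx hy Mx My W j k :=
  congrArg₂ (· + ·) (diff1_congr (fun s hs => h s hs k hk) j)
    (diff1_congr (fun s hs => h j hj s hs) k)

/-! ### Convergence -/

/-- The values of the solution on the grid at the time level `m`. -/
noncomputable def exactValue (a c hx hy τ : ℝ) (D : ℕ → ℕ → ℕ → ℝ → ℝ → ℝ → ℂ) (m j k : ℕ) : ℂ :=
  D 0 0 0 (a + j * hx) (c + k * hy) (m * τ)

/-- The inhomogeneity of the error equation at the time level `m ≥ 1`. -/
noncomputable def errorSource (α a c hx hy τ : ℝ) (Mx My : ℕ)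
    (D : ℕ → ℕ → ℕ → ℝ → ℝ → ℝ → ℂ) (U : ℕ → ℕ → ℕ → ℂ) (m j k : ℕ) : ℂ :=
  cubicDiff (exactValue a c hx hy τ D m j k) (exactValue a c hx hy τ D m j k - U m j k)
      ((exactValue a c hx hy τ D (m + 1) j k + exactValue a c hx hy τ D (m - 1) j k) / 2)
      ((exactValue a c hx hy τ D (m + 1) j k - U (m + 1) j k
        + (exactValue a c hx hy τ D (m - 1) j k - U (m - 1) j k)) / 2)
    - schemeResidual α a c hx hy τ Mx My D (m * τ) j k

lemma schemeResidual_succ (α a c hx hy τ : ℝ) (Mx My : ℕ) (D : ℕ → ℕ → ℕ → ℝ → ℝ → ℝ → ℂ)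
    (m j k : ℕ) : schemeResidual α a c hx hy τ Mx My D ((m + 1 : ℕ) * τ) j k
      = Complex.I * ((exactValue a c hx hy τ D (m + 2) j k - exactValue a c hx hy τ D m j k) / (2 * τ))
        + (diff2 α hx hy Mx My (exactValue a c hx hy τ D (m + 2)) j k
          + diff2 α hx hy Mx My (exactValue a c hx hy τ D m) j k) / 2
        + ((‖exactValue a c hx hy τ D (m + 1) j k‖ ^ 2 : ℝ) : ℂ)
          * ((exactValue a c hx hy τ D (m + 2) j k + exactValue a c hx hy τ D m j k) / 2) := by
  have t1 : ((m + 1 : ℕ) : ℝ) * τ + τ = (m + 2 : ℕ) * τ := by push_cast; ring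
  have t2 : ((m + 1 : ℕ) : ℝ) * τ - τ = (m : ℕ) * τ := by push_cast; ring
  unfold schemeResidual
  rw [t1, t2, ← diff2_mean]
  rfl

/-- The error equation. -/
lemma error_equation {α a c τ hx hy : ℝ} {N Mx My : ℕ} {u₀ : ℝ → ℝ → ℂ} {U : ℕ → ℕ → ℕ → ℂ}
    (hτ : 0 < τ) (hU : IsSchemeSolution α a c τ hx hy N Mx My u₀ U)
    (D : ℕ → ℕ → ℕ → ℝ → ℝ → ℝ → ℂ) {m j k : ℕ} (hm : m + 2 ≤ N)
    (hj : j ∈ Finset.Ioo 0 Mx) (hk : k ∈ Finset.Ioo 0 My) :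
    Complex.I * (exactValue a c hx hy τ D (m + 2) j k - U (m + 2) j k
        - (exactValue a c hx hy τ D m j k - U m j k))
      + τ * (diff2 α hx hy Mx My (fun j k => exactValue a c hx hy τ D (m + 2) j k - U (m + 2) j k) j k
        + diff2 α hx hy Mx My (fun j k => exactValue a c hx hy τ D m j k - U m j k) j k)
      + 2 * τ * errorSource α a c hx hy τ Mx My D U (m + 1) j k = 0 := by
  have hS := hU.step (m + 1) (by omega) (by omega) j hj k hk
  have hτc : (τ : ℂ) ≠ 0 := by exact_mod_cast hτ.ne'
  rw [diff2_sub, diff2_sub]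
  unfold errorSource
  rw [schemeResidual_succ]
  simp only [Nat.add_sub_cancel, cubicDiff, sub_sub_cancel] at hS ⊢
  set up := exactValue a c hx hy τ D (m + 2) j k
  set um := exactValue a c hx hy τ D m j k
  set u := exactValue a c hx hy τ D (m + 1) j k
  set dup := diff2 α hx hy Mx My (exactValue a c hx hy τ D (m + 2)) j k
  set dum := diff2 α hx hy Mx My (exactValue a c hx hy τ D m) j k
  have e1 : m + 1 + 1 = m + 2 := rfl
  rw [e1] at hS ⊢
  set dUp := diff2 α hx hy Mx My (U (m + 2)) j k
  set dUm := diff2 α hx hy Mx My (U m) j k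
  set q : ℂ := ((‖U (m + 1) j k‖ ^ 2 : ℝ) : ℂ)
  set Q : ℂ := ((‖u‖ ^ 2 : ℝ) : ℂ)
  have hS' : U (m + 2) j k - U m j k
      = Complex.I * τ * (q * (U (m + 2) j k + U m j k) + dUp + dUm) := by
    field_simp at hS
    linear_combination hS
  have e2 : 2 * (τ : ℂ) * (Complex.I * ((up - um) / (2 * τ))) = Complex.I * (up - um) := by
    field_simp
  have e3 : Complex.I * (Complex.I * τ * (q * (U (m + 2) j k + U m j k) + dUp + dUm))
      = -(τ * (q * (U (m + 2) j k + U m j k) + dUp + dUm)) := by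
    rw [← mul_assoc, ← mul_assoc, Complex.I_mul_I]; ring
  linear_combination (-Complex.I) * hS' - e2 - e3

/-- The constant in the Lipschitz bounds for the source of the error equation. -/
noncomputable def sourceConst (B : ℝ) : ℝ := 24 * (B + 1) ^ 2

lemma one_le_sourceConst {B : ℝ} (hB : 0 ≤ B) : 1 ≤ sourceConst B := by
  unfold sourceConst; nlinarith

lemma norm_half (z : ℂ) : ‖z / 2‖ = ‖z‖ / 2 := by rw [norm_div]; simp

lemma norm_half_add_le {z w : ℂ} {r : ℝ} (hz : ‖z‖ ≤ r) (hw : ‖w‖ ≤ r) : ‖(z + w) / 2‖ ≤ r := by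
  rw [norm_half]; linarith [norm_add_le z w]

lemma norm_half_add_le_add (z w : ℂ) : ‖(z + w) / 2‖ ≤ ‖z‖ + ‖w‖ := by
  rw [norm_half]; linarith [norm_add_le z w, norm_nonneg z, norm_nonneg w]

lemma norm_errorSource_le {α a c hx hy τ B R : ℝ} {Mx My : ℕ}
    {D : ℕ → ℕ → ℕ → ℝ → ℝ → ℝ → ℂ} {U e : ℕ → ℕ → ℕ → ℂ} {m j k : ℕ}
    (he : ∀ m, e m j k = exactValue a c hx hy τ D m j k - U m j k)
    (hu : ∀ i ≤ 2, ‖exactValue a c hx hy τ D (m + i) j k‖ ≤ B) (h1 : ‖e (m + 1) j k‖ ≤ 1)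
    (hR : ‖schemeResidual α a c hx hy τ Mx My D ((m + 1 : ℕ) * τ) j k‖ ≤ R) :
    ‖errorSource α a c hx hy τ Mx My D U (m + 1) j k‖
      ≤ sourceConst B * (‖e (m + 1) j k‖ + ‖e (m + 2) j k‖ + ‖e m j k‖) + R := by
  have hB : 0 ≤ B := (norm_nonneg _).trans (hu 0 (by norm_num))
  unfold errorSource
  simp only [← he, Nat.add_sub_cancel]
  have b4 := norm_cubicDiff_le
    (s := (exactValue a c hx hy τ D (m + 2) j k + exactValue a c hx hy τ D m j k) / 2)
    (r := (e (m + 2) j k + e m j k) / 2) (hu 1 (by norm_num))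
    (norm_half_add_le (hu 2 le_rfl) (hu 0 (by norm_num))) h1
  have b6 := norm_half_add_le_add (e (m + 2) j k) (e m j k)
  refine (norm_sub_le _ _).trans ((add_le_add b4 hR).trans ?_)
  have b8 : 2 * (B + 1) ^ 2 ≤ sourceConst B := by unfold sourceConst; nlinarith
  have b7 := mul_le_mul b8 (add_le_add_right b6 ‖e (m + 1) j k‖) (by positivity)
    (zero_le_one.trans (one_le_sourceConst hB))
  linarith

/-- The error at the newest level `m + 4` is not assumed to be bounded by `1`, so that the estimate
can be used to bound it. -/
lemma norm_errorSource_sub_le {α a c hx hy τ B R : ℝ} {Mx My : ℕ}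
    {D : ℕ → ℕ → ℕ → ℝ → ℝ → ℝ → ℂ} {U e : ℕ → ℕ → ℕ → ℂ} {m j k : ℕ} (hτ : 0 ≤ τ)
    (he : ∀ m, e m j k = exactValue a c hx hy τ D m j k - U m j k)
    (hu : ∀ i ≤ 4, ‖exactValue a c hx hy τ D (m + i) j k‖ ≤ B)
    (hud : ∀ i ≤ 2, ‖exactValue a c hx hy τ D (m + i + 2) j k - exactValue a c hx hy τ D (m + i) j k‖
      ≤ 2 * B * τ)
    (h1 : ∀ i ≤ 3, ‖e (m + i) j k‖ ≤ 1)
    (hR : ‖schemeResidual α a c hx hy τ Mx My D ((m + 3 : ℕ) * τ) j k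
      - schemeResidual α a c hx hy τ Mx My D ((m + 1 : ℕ) * τ) j k‖ ≤ R) :
    ‖errorSource α a c hx hy τ Mx My D U (m + 3) j k
        - errorSource α a c hx hy τ Mx My D U (m + 1) j k‖
      ≤ sourceConst B * (‖e (m + 3) j k - e (m + 1) j k‖ + ‖e (m + 4) j k - e (m + 2) j k‖
        + ‖e (m + 2) j k - e m j k‖
        + τ * (‖e (m + 1) j k‖ + ‖e (m + 2) j k‖ + ‖e m j k‖)) + R := by
  have hB : 0 ≤ B := (norm_nonneg _).trans (hu 0 (by norm_num))
  have i1 : m + 3 + 1 = m + 4 := rfl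
  have i2 : m + 3 - 1 = m + 2 := rfl
  have i3 : m + 1 + 1 = m + 2 := rfl
  have hudi : ∀ x y z : ℂ, (x + y) / 2 - (y + z) / 2 = ((x - y) + (y - z)) / 2 := fun x y z => by ring
  have s2 : ‖(exactValue a c hx hy τ D (m + 4) j k + exactValue a c hx hy τ D (m + 2) j k) / 2
      - (exactValue a c hx hy τ D (m + 2) j k + exactValue a c hx hy τ D m j k) / 2‖ ≤ 2 * B * τ := by
    rw [hudi]
    exact norm_half_add_le (hud 2 le_rfl) (hud 0 (by norm_num))
  have r2 : ‖(e (m + 4) j k + e (m + 2) j k) / 2 - (e (m + 2) j k + e m j k) / 2‖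
      ≤ ‖e (m + 4) j k - e (m + 2) j k‖ + ‖e (m + 2) j k - e m j k‖ := by
    rw [hudi]
    exact norm_half_add_le_add _ _
  have r1 := norm_half_add_le_add (e (m + 2) j k) (e m j k)
  have b := norm_cubicDiff_sub_le (hu 3 (by norm_num))
    (norm_half_add_le (hu 4 le_rfl) (hu 2 (by norm_num))) (h1 3 le_rfl) (hu 1 (by norm_num))
    (h1 1 (by norm_num)) (norm_half_add_le (h1 2 (by norm_num)) (h1 0 (by norm_num)))
    (hud 1 (by norm_num)) s2 (r := (e (m + 4) j k + e (m + 2) j k) / 2)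
  unfold errorSource
  simp only [← he, Nat.add_sub_cancel, i1, i2, i3]
  rw [sub_sub_sub_comm]
  refine (norm_sub_le _ _).trans ((add_le_add b hR).trans ?_)
  have c1 : 6 * (B + 1) ^ 2 ≤ sourceConst B := by unfold sourceConst; nlinarith
  have c2 : 6 * (B + 1) * (2 * B * τ) ≤ sourceConst B * τ := by
    have : 6 * (B + 1) * (2 * B) ≤ sourceConst B := by unfold sourceConst; nlinarith
    calc _ = 6 * (B + 1) * (2 * B) * τ := by ring
      _ ≤ _ := by gcongr
  have hκ := zero_le_one.trans (one_le_sourceConst hB)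
  have d1 := mul_le_mul c1 (add_le_add_right r2 ‖e (m + 3) j k - e (m + 1) j k‖) (by positivity) hκ
  have d2 := mul_le_mul c2 (add_le_add_right r1 ‖e (m + 1) j k‖) (by positivity) (by positivity)
  simp only [add_zero] at d1 d2 ⊢
  linarith

lemma norm_le_of_pointwise_three {ι : Type*} [Fintype ι] {V W₁ W₂ W₃ : EuclideanSpace ℂ ι} {κ r : ℝ}
    (hκ : 0 ≤ κ) (hr : 0 ≤ r) (h : ∀ p, ‖V p‖ ≤ κ * (‖W₁ p‖ + ‖W₂ p‖ + ‖W₃ p‖) + r) :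
    ‖V‖ ≤ κ * (‖W₁‖ + ‖W₂‖ + ‖W₃‖) + r * √(Fintype.card ι) := by
  have := norm_le_sum_of_pointwise V ![W₁, W₂, W₃] (fun _ => κ) (fun _ => hκ) hr (fun p => by
    refine (h p).trans (le_of_eq ?_)
    rw [← Finset.mul_sum, Fin.sum_univ_three]
    rfl)
  rw [← Finset.mul_sum, Fin.sum_univ_three] at this
  exact this

lemma norm_le_of_pointwise_six {ι : Type*} [Fintype ι] {V W₁ W₂ W₃ W₄ W₅ W₆ : EuclideanSpace ℂ ι}
    {κ τ r : ℝ} (hκ : 0 ≤ κ) (hτ : 0 ≤ τ) (hr : 0 ≤ r)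
    (h : ∀ p, ‖V p‖ ≤ κ * (‖W₁ p‖ + ‖W₂ p‖ + ‖W₃ p‖ + τ * (‖W₄ p‖ + ‖W₅ p‖ + ‖W₆ p‖)) + r) :
    ‖V‖ ≤ κ * (‖W₁‖ + ‖W₂‖ + ‖W₃‖ + τ * (‖W₄‖ + ‖W₅‖ + ‖W₆‖)) + r * √(Fintype.card ι) := by
  have := norm_le_sum_of_pointwise V ![W₁, W₂, W₃, W₄, W₅, W₆] ![κ, κ, κ, κ * τ, κ * τ, κ * τ]
    (by intro i; fin_cases i <;> first | exact hκ | exact mul_nonneg hκ hτ) hr (fun p => by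
      refine (h p).trans (le_of_eq ?_)
      rw [Fin.sum_univ_six]
      change _ = κ * ‖W₁ p‖ + κ * ‖W₂ p‖ + κ * ‖W₃ p‖ + κ * τ * ‖W₄ p‖ + κ * τ * ‖W₅ p‖
        + κ * τ * ‖W₆ p‖ + r
      ring)
  rw [Fin.sum_univ_six] at this
  change _ ≤ κ * ‖W₁‖ + κ * ‖W₂‖ + κ * ‖W₃‖ + κ * τ * ‖W₄‖ + κ * τ * ‖W₅‖ + κ * τ * ‖W₆‖
    + r * √(Fintype.card ι) at this
  linarith

namespace Family

variable {α a b c d T B : ℝ} {D : ℕ → ℕ → ℕ → ℝ → ℝ → ℝ → ℂ}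

set_option maxHeartbeats 1000000 in
/-- The step of the induction over the time levels: as long as the error stays below `1`, it is of
second order one time level further. -/
lemma exists_error_bound (hD : Family 17 α a b c d T B D) (hab : a < b) (hcd : c < d) (hT : 0 < T)
    (hα : 1 < α) (hα2 : α ≤ 2) (hE : SolvesEquation α a b c d T D) :
    ∃ τ₀ C, 0 < τ₀ ∧ 0 < C ∧ ∀ (N Mx My : ℕ) (τ hx hy : ℝ), 0 < N → 0 < Mx → 0 < My →
      τ = T / N → hx = (b - a) / Mx → hy = (d - c) / My → τ < τ₀ → hx ≤ 1 → hy ≤ 1 →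
      ∀ U : ℕ → ℕ → ℕ → ℂ,
      IsSchemeSolution α a c τ hx hy N Mx My (fun x y => D 0 0 0 x y 0) U →
      ∀ n, n + 1 ≤ N →
        (∀ m ≤ n, ∀ j ∈ Finset.Ioo 0 Mx, ∀ k ∈ Finset.Ioo 0 My,
          ‖exactValue a c hx hy τ D m j k - U m j k‖ ≤ 1) →
        ∀ m ≤ n + 1, ∀ j ∈ Finset.Ioo 0 Mx, ∀ k ∈ Finset.Ioo 0 My,
          ‖exactValue a c hx hy τ D m j k - U m j k‖ ≤ C * (τ ^ 2 + hx ^ 2 + hy ^ 2) := by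
  have hB := hD.bound_nonneg hab hcd hT.le
  obtain ⟨C₁, hC₁, hfirst⟩ := hD.exists_norm_firstError_le hab hcd hT hα hα2 (by norm_num) hE
  obtain ⟨C₂, hC₂, hresid⟩ := hD.exists_norm_schemeResidual_le (K := 16) hab hcd hT hα hα2
    (by norm_num) hE
  obtain ⟨S, hS, hsob⟩ := discrete_sobolev hα hα2
  set κ : ℝ := sourceConst B with hκ
  have hκ1 : 1 ≤ κ := one_le_sourceConst hB
  have hκ0 : 0 < κ := by linarith
  obtain ⟨C₃, hC₃, hstab⟩ := scheme_stability hκ0 hT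
  have hba : 0 < b - a := by linarith
  have hdc : 0 < d - c := by linarith
  set A : ℝ := √((b - a) * (d - c)) with hA
  have hA0 : 0 < A := Real.sqrt_pos.2 (by positivity)
  refine ⟨min 1 (1 / (12 * κ)), S * (C₃ * ((C₁ + C₂) * A)), by positivity, by positivity, ?_⟩
  intro N Mx My τ hx hy hN hMx hMy hτN hhx hhy hτ₀ hhx1 hhy1 U hU n hn hsmall
  have hN' : (0 : ℝ) < N := by exact_mod_cast hN
  have hMx' : (0 : ℝ) < Mx := by exact_mod_cast hMx
  have hMy' : (0 : ℝ) < My := by exact_mod_cast hMy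
  have hτ : 0 < τ := by rw [hτN]; positivity
  have hx0 : 0 < hx := by rw [hhx]; positivity
  have hy0 : 0 < hy := by rw [hhy]; positivity
  have hτ1 : τ ≤ 1 := (hτ₀.le.trans (min_le_left _ _))
  have hτκ : 12 * κ * τ ≤ 1 := by
    have := hτ₀.le.trans (min_le_right _ _)
    rw [le_div_iff₀ (by positivity)] at this
    linarith
  have hNT : (N : ℝ) * τ = T := by rw [hτN]; field_simp
  have hlevel : ∀ m : ℕ, m ≤ N → (m : ℝ) * τ ≤ T := fun m hm => by
    rw [← hNT]; gcongr
  have hmem : ∀ m : ℕ, m ≤ N → (m : ℝ) * τ ∈ Icc 0 T := fun m hm =>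
    ⟨by positivity, hlevel m hm⟩
  have hτT : τ ≤ T := by
    have := hlevel 1 (by omega)
    simpa using this
  set u := exactValue a c hx hy τ D with hu
  set e : ℕ → ℕ → ℕ → ℂ := fun m j k => u m j k - U m j k with he
  set ε := τ ^ 2 + hx ^ 2 + hy ^ 2 with hε
  have hε0 : 0 < ε := by positivity
  set G : ℝ := √((b - a) * (d - c) / (hx * hy)) with hG
  have hG0 : 0 < G := Real.sqrt_pos.2 (by positivity)
  have hcard : √(Fintype.card (Grid Mx My)) ≤ G := sqrt_card_grid_le hab hcd hMx hMy hhx hhy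
  have hub : ∀ m ≤ N, ∀ j ∈ Finset.Ioo 0 Mx, ∀ k ∈ Finset.Ioo 0 My, ‖u m j k‖ ≤ B :=
    fun m hm j hj k hk => hD.bound 0 0 0 (by omega) _ (mem_dom_of_grid hab hhx hj) _
      (mem_dom_of_grid hcd hhy hk) _ (hmem m hm)
  have hud : ∀ m, m + 2 ≤ N → ∀ j ∈ Finset.Ioo 0 Mx, ∀ k ∈ Finset.Ioo 0 My,
      ‖u (m + 2) j k - u m j k‖ ≤ 2 * B * τ := by
    intro m hm j hj k hk
    refine (hD.norm_sub_le (i := 0) (j := 0) (k := 0) (by omega) (mem_dom_of_grid hab hhx hj)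
      (mem_dom_of_grid hcd hhy hk) (hmem m (by omega)) (hmem (m + 2) hm)).trans (le_of_eq ?_)
    have : ((m + 2 : ℕ) : ℝ) * τ - m * τ = 2 * τ := by push_cast; ring
    rw [this, abs_of_pos (by positivity)]; ring
  -- the errors and the sources as Euclidean vectors
  set E : ℕ → EuclideanSpace ℂ (Grid Mx My) := fun m => WithLp.toLp 2 fun q => e m q.1 q.2 with hEdef
  set f := errorSource α a c hx hy τ Mx My D U with hf
  set F : ℕ → EuclideanSpace ℂ (Grid Mx My) := fun m => WithLp.toLp 2 fun q => f m q.1 q.2 with hFdef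
  set L := laplaceLin α hx hy Mx My with hL
  have hLE : ∀ m p, L (E m) p = diff2 α hx hy Mx My (e m) p.1 p.2 := fun m p =>
    laplaceLin_apply α hx hy Mx My (e m) p
  set η : ℝ := (C₁ + C₂) * ε * G with hη
  have hη0 : 0 ≤ η := by positivity
  have hpt : ∀ (V : EuclideanSpace ℂ (Grid Mx My)), (∀ p, ‖V p‖ ≤ C₁ * ε) → ‖V‖ ≤ η := by
    intro V hV
    refine (norm_le_of_pointwise V (by positivity) hV).trans ?_
    rw [hη]
    gcongr
    linarith
  have he1 : ∀ j ∈ Finset.Ioo 0 Mx, ∀ k ∈ Finset.Ioo 0 My,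
      e 1 j k = firstError α a c hx hy τ Mx My D j k := by
    intro j hj k hk
    simp only [he, hu, exactValue, firstError]
    rw [hU.first j hj k hk, hU.initial j hj k hk]
    simp [onGrid]
  have hf1 := hfirst hx hy τ Mx My hhx hhx1 hhy hhy1 hτ hτT hτ1
  have hR : ∀ m, m + 2 ≤ N → ∀ j ∈ Finset.Ioo 0 Mx, ∀ k ∈ Finset.Ioo 0 My,
      ‖schemeResidual α a c hx hy τ Mx My D ((m + 1 : ℕ) * τ) j k‖ ≤ C₂ * ε := by
    intro m hm j hj k hk
    refine (hresid hx hy τ Mx My hhx hhx1 hhy hhy1 hτ j hj k hk).1 _ ?_ ?_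
    · push_cast; nlinarith [(by positivity : 0 ≤ (m : ℝ) * τ)]
    · have := hlevel (m + 2) hm
      push_cast at this ⊢; linarith
  have hRd : ∀ m, m + 4 ≤ N → ∀ j ∈ Finset.Ioo 0 Mx, ∀ k ∈ Finset.Ioo 0 My,
      ‖schemeResidual α a c hx hy τ Mx My D ((m + 3 : ℕ) * τ) j k
        - schemeResidual α a c hx hy τ Mx My D ((m + 1 : ℕ) * τ) j k‖ ≤ C₂ * (τ * ε) := by
    intro m hm j hj k hk
    have := (hresid hx hy τ Mx My hhx hhx1 hhy hhy1 hτ j hj k hk).2 ((m + 1 : ℕ) * τ)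
      (by push_cast; nlinarith [(by positivity : 0 ≤ (m : ℝ) * τ)])
      (by have := hlevel (m + 4) hm; push_cast at this ⊢; linarith)
    have t : ((m + 1 : ℕ) : ℝ) * τ + 2 * τ = (m + 3 : ℕ) * τ := by push_cast; ring
    rwa [t] at this
  have hres := hstab (EuclideanSpace ℂ (Grid Mx My)) L (laplaceLin_isSymmetric hα hx0 hy0 Mx My)
    τ η n E F hτ.le hη0 hτκ (by exact_mod_cast hlevel (n + 1) hn) (by
      ext p
      simp only [hEdef, he, hu, exactValue]
      rw [hU.initial _ p.1.2 _ p.2.2]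
      simp [onGrid]) (hpt _ fun p => by
      have : E 1 p = e 1 p.1 p.2 := rfl
      rw [this, he1 _ p.1.2 _ p.2.2]
      exact (hf1 _ p.1.2 _ p.2.2).1) (hpt _ fun p => by
      rw [hLE, diff2_congr he1 p.1.2 p.2.2]
      exact (hf1 _ p.1.2 _ p.2.2).2) (by
      intro m h1 hmn
      obtain ⟨m, rfl⟩ : ∃ k, m = k + 1 := ⟨m - 1, by omega⟩
      ext p
      have := error_equation hτ hU D (m := m) (by omega) p.1.2 p.2.2
      rw [map_add]
      simp only [PiLp.add_apply, PiLp.sub_apply, PiLp.smul_apply, smul_eq_mul, hLE,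
        Nat.add_sub_cancel, PiLp.zero_apply]
      exact this) (by
      intro m h1 hmn
      obtain ⟨m, rfl⟩ : ∃ k, m = k + 1 := ⟨m - 1, by omega⟩
      simp only [Nat.add_sub_cancel]
      have := norm_le_of_pointwise_three (V := F (m + 1)) (W₁ := E (m + 1)) (W₂ := E (m + 2))
        (W₃ := E m) hκ0.le (r := C₂ * ε) (by positivity) fun p =>
          norm_errorSource_le (e := e) (fun m => rfl)
            (fun i hi => hub (m + i) (by omega) _ p.1.2 _ p.2.2)
            (hsmall (m + 1) (by omega) _ p.1.2 _ p.2.2) (hR m (by omega) _ p.1.2 _ p.2.2)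
      have h2 : C₂ * ε * √(Fintype.card (Grid Mx My)) ≤ κ * η := by
        calc _ ≤ C₂ * ε * G := by gcongr
          _ ≤ η := by rw [hη]; gcongr; linarith
          _ ≤ κ * η := le_mul_of_one_le_left hη0 hκ1
      have i4 : m + 1 + 1 = m + 2 := rfl
      rw [i4]
      linarith) (by
      intro m h1 hmn
      obtain ⟨m, rfl⟩ : ∃ k, m = k + 3 := ⟨m - 3, by omega⟩
      have i1 : m + 3 - 2 = m + 1 := rfl
      have i2 : m + 3 - 1 = m + 2 := rfl
      have i3 : m + 3 - 3 = m := rfl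
      have i4 : m + 3 + 1 = m + 4 := rfl
      rw [i1, i2, i3, i4]
      have := norm_le_of_pointwise_six (V := F (m + 3) - F (m + 1)) (W₁ := E (m + 3) - E (m + 1))
        (W₂ := E (m + 4) - E (m + 2)) (W₃ := E (m + 2) - E m) (W₄ := E (m + 1)) (W₅ := E (m + 2))
        (W₆ := E m) hκ0.le hτ.le (r := C₂ * (τ * ε)) (by positivity) fun p =>
          norm_errorSource_sub_le (e := e) hτ.le (fun m => rfl)
            (fun i hi => hub (m + i) (by omega) _ p.1.2 _ p.2.2)
            (fun i hi => hud (m + i) (by omega) _ p.1.2 _ p.2.2)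
            (fun i hi => hsmall (m + i) (by omega) _ p.1.2 _ p.2.2) (hRd m (by omega) _ p.1.2 _ p.2.2)
      have h2 : C₂ * (τ * ε) * √(Fintype.card (Grid Mx My)) ≤ κ * τ * η := by
        calc _ ≤ C₂ * (τ * ε) * G := by gcongr
          _ = τ * (C₂ * ε * G) := by ring
          _ ≤ τ * η := by rw [hη]; gcongr; linarith
          _ ≤ τ * (κ * η) := by gcongr; exact le_mul_of_one_le_left hη0 hκ1
          _ = _ := by ring
      have h3 : 0 ≤ κ * τ * (‖E (m + 3)‖ + ‖E (m + 4)‖) := by positivity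
      linarith)
  intro m hm j hj k hk
  have h1 := hsob Mx My hx hy hx0 hy0 (E m) (⟨j, hj⟩, ⟨k, hk⟩)
  have h2 := hres m hm
  have h3 : √(hx * hy) * G = A := by
    rw [hG, hA, ← Real.sqrt_mul (by positivity)]
    congr 1; field_simp
  calc ‖u m j k - U m j k‖ ≤ S * √(hx * hy) * (‖E m‖ + ‖L (E m)‖) := h1
    _ ≤ S * √(hx * hy) * (C₃ * η) := by gcongr
    _ = S * (C₃ * ((C₁ + C₂) * (√(hx * hy) * G))) * ε := by rw [hη]; ring
    _ = _ := by rw [h3]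

end Family

lemma supNorm_le {Mx My : ℕ} {V : ℕ → ℕ → ℂ} {r : ℝ} (hr : 0 ≤ r)
    (h : ∀ j ∈ Finset.Ioo 0 Mx, ∀ k ∈ Finset.Ioo 0 My, ‖V j k‖ ≤ r) : supNorm Mx My V ≤ r := by
  lift r to NNReal using hr
  unfold supNorm
  rw [NNReal.coe_le_coe, Finset.sup_le_iff]
  intro p hp
  rw [Finset.mem_product] at hp
  exact_mod_cast h _ hp.1 _ hp.2

end FracNLS

open FracNLS in
theorem theorem5 :
    ∃ K : ℕ, ∀ (α a b c d T : ℝ) (u₀ : ℝ → ℝ → ℂ) (u : ℝ → ℝ → ℝ → ℂ),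
      1 < α → α ≤ 2 → a < b → c < d → 0 < T →
      FracNLS.IsSolution α a b c d T u₀ u →
      FracNLS.IsSmoothOfOrder K α a b c d T u →
      ∃ Cm : ℝ,
        IsGreatest {r : ℝ | ∃ x ∈ Set.Icc a b, ∃ y ∈ Set.Icc c d, ∃ t ∈ Set.Icc 0 T,
          r = ‖u x y t‖} Cm ∧
        ∃ τ₀ h₀ C₀ : ℝ, 0 < τ₀ ∧ 0 < h₀ ∧ 0 < C₀ ∧
          ∀ (N Mx My : ℕ) (τ hx hy : ℝ), 0 < N → 0 < Mx → 0 < My →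
            τ = T / N → hx = (b - a) / Mx → hy = (d - c) / My →
            τ < τ₀ → hx < h₀ → hy < h₀ →
            ∀ U : ℕ → ℕ → ℕ → ℂ, FracNLS.IsSchemeSolution α a c τ hx hy N Mx My u₀ U →
              ∀ n : ℕ, 1 ≤ n → n ≤ N →
                FracNLS.supNorm Mx My
                    (fun j k => FracNLS.onGrid a c hx hy (fun x y => u x y (n * τ)) j k - U n j k)
                  ≤ C₀ * (τ ^ 2 + hx ^ 2 + hy ^ 2) ∧
                FracNLS.supNorm Mx My (U n) ≤ Cm + 1 := by
  refine ⟨18, ?_⟩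
  intro α a b c d T u₀ u hα hα2 hab hcd hT hu hs
  obtain ⟨B, D, hD, hDu⟩ := exists_family 17 hα2 hab hcd hT hu hs
  have hE := hD.solvesEquation hab hcd hα hα2 (by norm_num) hu hDu
  obtain ⟨τ₁, C, hτ₁, hC, hstep⟩ := hD.exists_error_bound hab hcd hT hα hα2 hE
  obtain ⟨p, hp, hmax⟩ := (isCompact_Icc.prod (isCompact_Icc.prod isCompact_Icc)).exists_isMaxOn
    (s := Icc a b ×ˢ Icc c d ×ˢ Icc 0 T)
    ((nonempty_Icc.2 hab.le).prod ((nonempty_Icc.2 hcd.le).prod (nonempty_Icc.2 hT.le)))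
    hs.on_box.continuousOn.norm
  refine ⟨‖u p.1 p.2.1 p.2.2‖, ⟨⟨_, hp.1, _, hp.2.1, _, hp.2.2, rfl⟩, ?_⟩, ?_⟩
  · rintro r ⟨x, hx, y, hy, t, ht, rfl⟩
    exact hmax (show (x, y, t) ∈ _ from ⟨hx, hy, ht⟩)
  set Cm := ‖u p.1 p.2.1 p.2.2‖ with hCm
  -- the restrictions make the error bound at most one
  set δ := 1 / (3 * (C + 1)) with hδ
  have hδ0 : 0 < δ := by positivity
  have hδ1 : δ ≤ 1 := by
    rw [hδ, div_le_one (by positivity)]; linarith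
  refine ⟨min τ₁ δ, δ, C, by positivity, hδ0, hC, ?_⟩
  intro N Mx My τ hx hy hN hMx hMy hτ hhx hhy hτ₀ hhx₀ hhy₀ U hU
  have hN' : (0 : ℝ) < N := by exact_mod_cast hN
  have hMx' : (0 : ℝ) < Mx := by exact_mod_cast hMx
  have hMy' : (0 : ℝ) < My := by exact_mod_cast hMy
  have hτ0 : 0 < τ := by rw [hτ]; positivity
  have hx0 : 0 < hx := by rw [hhx]; apply div_pos <;> linarith
  have hy0 : 0 < hy := by rw [hhy]; apply div_pos <;> linarith
  have hsmall : C * (τ ^ 2 + hx ^ 2 + hy ^ 2) ≤ 1 := by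
    have h1 : ∀ z, 0 < z → z < δ → z ^ 2 ≤ δ := fun z h0 h1 => by nlinarith
    have h2 := h1 τ hτ0 (hτ₀.trans_le (min_le_right _ _))
    have h3 := h1 hx hx0 hhx₀
    have h4 := h1 hy hy0 hhy₀
    have h5 : C * (3 * δ) ≤ 1 := by
      rw [hδ]
      have : C * (3 * (1 / (3 * (C + 1)))) = C / (C + 1) := by field_simp
      rw [this, div_le_one (by positivity)]
      linarith
    refine le_trans ?_ h5
    gcongr
    linarith
  have hu₀ : u₀ = fun x y => D 0 0 0 x y 0 := by
    ext x y; rw [hDu, hu.initial]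
  rw [hu₀] at hU
  have hpt : ∀ n, n ≤ N → ∀ m ≤ n, ∀ j ∈ Finset.Ioo 0 Mx, ∀ k ∈ Finset.Ioo 0 My,
      ‖exactValue a c hx hy τ D m j k - U m j k‖ ≤ C * (τ ^ 2 + hx ^ 2 + hy ^ 2) := by
    intro n
    induction n with
    | zero =>
      intro _ m hm j hj k hk
      obtain rfl : m = 0 := by omega
      rw [hU.initial j hj k hk]
      simp only [exactValue, onGrid, Nat.cast_zero, zero_mul, sub_self, norm_zero]
      positivity
    | succ n ih =>
      intro hn
      exact hstep N Mx My τ hx hy hN hMx hMy hτ hhx hhy (hτ₀.trans_le (min_le_left _ _))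
        (hhx₀.le.trans hδ1) (hhy₀.le.trans hδ1) U hU n hn
        fun m hm j hj k hk => (ih (by omega) m hm j hj k hk).trans hsmall
  intro n _ hn
  have herr : ∀ j ∈ Finset.Ioo 0 Mx, ∀ k ∈ Finset.Ioo 0 My,
      ‖onGrid a c hx hy (fun x y => u x y (n * τ)) j k - U n j k‖
        ≤ C * (τ ^ 2 + hx ^ 2 + hy ^ 2) := by
    intro j hj k hk
    have := hpt n hn n le_rfl j hj k hk
    simp only [exactValue, hDu] at this
    exact this
  refine ⟨supNorm_le (by positivity) herr, supNorm_le (by positivity) fun j hj k hk => ?_⟩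
  have h1 := (herr j hj k hk).trans hsmall
  have hxm := grid_mem_Ioo hMx hab hhx hj
  have hym := grid_mem_Ioo hMy hcd hhy hk
  have htm : (n : ℝ) * τ ∈ Icc 0 T := by
    refine ⟨by positivity, ?_⟩
    have : (n : ℝ) ≤ N := by exact_mod_cast hn
    calc (n : ℝ) * τ ≤ N * τ := by gcongr
      _ = T := by rw [hτ]; field_simp
  have h2 : ‖onGrid a c hx hy (fun x y => u x y (n * τ)) j k‖ ≤ Cm :=
    hmax (show ((a + j * hx, c + k * hy, (n : ℝ) * τ) : ℝ × ℝ × ℝ) ∈ _ from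
      ⟨Ioo_subset_Icc_self hxm, Ioo_subset_Icc_self hym, htm⟩)
  have h3 := norm_sub_le (onGrid a c hx hy (fun x y => u x y (n * τ)) j k)
    (onGrid a c hx hy (fun x y => u x y (n * τ)) j k - U n j k)
  rw [sub_sub_cancel] at h3
  linarith
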